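/- Let $n,\alpha,\beta$ be integers with $1\le\alpha<\beta\le n-1$ and let $\alpha\mapsto\beta$ be the corresponding Belavin--Drinfeld triple of minimal size for $SL_n$. Let $X=(x_{ij})_{i,j=1}^n$ be the matrix of coordinate functions on $SL_n$ over $\mathbb C$, and write $X_{[r,r']}^{[c,c']}$ for its submatrix with rows $r,\dots,r'$ and columns $c,\dots,c'$. **Initial cluster.** For $i,j\in[1,n]$ define $\varphi_{ij}$ as the determinant of the following square matrix. * If $i=n+j-\alpha$: the matrix formed by the block $X_{[i,n]}^{[j,\alpha+1]}$ and, in the rows below it, the block $X_{[1,n-\beta]}^{[\beta,n]}$, placed so that the columns $\alpha,\alpha+1$ of the first block and $\beta,\beta+1$ of the second one lie in the same two columns, with zeros elsewhere. If $n=2\beta$, the second block is replaced by $X_{[1,\beta+1]}^{[\beta,n]}$ and a third block $X_{[\alpha,n]}^{[1,n-\alpha]}$ is added in the columns to the right, placed so that the rows $\beta,\beta+1$ of the second block and $\alpha,\alpha+1$ of the third one lie in the same two rows. * If $j=n+i-\beta$: the matrix formed by the block $X_{[i,\beta+1]}^{[j,n]}$ and, in the columns to the right of it, the block $X_{[\alpha,n]}^{[1,n-\alpha]}$,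 placed so that the rows $\beta,\beta+1$ of the first block and $\alpha,\alpha+1$ of the second one lie in the same two rows, with zeros elsewhere. If $n=2\alpha$, the second block is replaced by $X_{[\alpha,n]}^{[1,\alpha+1]}$ and a third block $X_{[1,n-\beta]}^{[\beta,n]}$ is added in the rows below, placed so that the columns $\alpha,\alpha+1$ of the second block and $\beta,\beta+1$ of the third one lie in the same two columns. * Otherwise: the maximal contiguous square submatrix of $X$ with $x_{ij}$ in its upper left corner. **Initial quiver.** The vertices are the $(i,j)\in[1,n]^2$ with $(i,j)\ne(1,1)$, and $\varphi_{ij}$ is attached to $(i,j)$. The vertices of the first row and of the first column are frozen, except for $(\alpha+1,1)$ and $(1,\beta+1)$; all other vertices are mutable. There are arrows $(i,j)\to(i+1,j)$, $(i,j)\to(i,j+1)$ and $(i,j)\to(i-1,j-1)$ whenever both ends are vertices and do not both lie in the union of the first row and the first column; in addition there are the arrows $(\alpha,1)\to(\alpha+1,1)$ (if $\alpha\neq1$), $(1,\beta)\to(1,\beta+1)$, $(n,\alpha+1)\to(1,\beta+1)\to(n,\alpha)$ and $(\beta+1,n)\to(\alpha+1,1)\to(\beta,n)$. Let $\mathcal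 C_{\alpha\beta}$ be the cluster structure of geometric type in the field $\mathbb C(SL_n)$ with this initial seed, that is, the set of all seeds obtained from it by finite sequences of seed mutations at mutable vertices. Let $\overline{\mathcal A}_{\alpha\beta}$ be its upper cluster algebra: the intersection, over all seeds in $\mathcal C_{\alpha\beta}$, of the rings of Laurent polynomials in the cluster variables of the seed with coefficients in the polynomial ring over $\mathbb Z$ in the frozen variables (which are not inverted). Let $\overline{\mathcal A}_{\alpha\beta,\mathbb C}$ be the same with $\mathbb C$ in place of $\mathbb Z$. Then for all $i,j\in[1,n]$ the matrix entry $x_{ij}$ lies in $\overline{\mathcal A}_{\alpha\beta}$, and in $\overline{\mathcal A}_{\alpha\beta,\mathbb C}$. -/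

import Mathlib

namespace ExoticSL

/-! ### Cluster structures of geometric type -/

/-- A seed, as data, in the field `K`: the vertices are `V`, the mutable ones are those of `M`, the
others are frozen. `var` is the extended cluster and `mat` the extended exchange matrix, with
one row for each cluster variable and one column for each element of the extended cluster. -/
structure Seed (V : Type) (M : Set V) (K : Type) where
  var : V → K
  mat : M → V → ℤ

namespace Seed

variable {V : Type} [Fintype V] [DecidableEq V] {M : Set V} {K : Type} [Field K]

/-- The variable `x'_k` given by the exchange relation
`x_k * x'_k = ∏_{b_kj > 0} x_j ^ b_kj + ∏_{b_kj < 0} x_j ^ (-b_kj)`. -/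
noncomputable def exchangeVar (S : Seed V M K) (k : M) : K :=
  ((∏ j : V, S.var j ^ (S.mat k j).toNat) + ∏ j : V, S.var j ^ (-S.mat k j).toNat) / S.var k

/-- Seed mutation in direction `k`. The integer division by two is exact. -/
noncomputable def mutate (S : Seed V M K) (k : M) : Seed V M K where
  var := Function.update S.var k (S.exchangeVar k)
  mat := fun i j =>
    if i = k ∨ j = k then -S.mat i j
    else S.mat i j + (|S.mat i k| * S.mat k j + S.mat i k * |S.mat k j|) / 2

/-- `T` is obtained from `S` by a finite sequence of seed mutations. -/
def MutationEquivalent (S T : Seed V M K) : Prop :=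
  Relation.ReflTransGen (fun A B : Seed V M K => ∃ k : M, B = A.mutate k) S T

/-- The cluster structure of `S`: all the seeds that are mutation equivalent to `S`. -/
def clusterStructure (S : Seed V M K) : Set (Seed V M K) :=
  {T | S.MutationEquivalent T}

/-- The ring of Laurent polynomials in the cluster variables of `S` over the ring of polynomials,
with coefficients in `R`, in the frozen variables (frozen variables are not inverted). -/
def laurentRing (R : Type) [CommRing R] [Algebra R K] (S : Seed V M K) : Subalgebra R K :=
  Algebra.adjoin R (Set.range S.var ∪ Set.range fun k : M => (S.var k)⁻¹)

/-- The upper cluster algebra of the cluster structure of `S`, with coefficients in `R`. -/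
def upperClusterAlgebra (R : Type) [CommRing R] [Algebra R K] (S : Seed V M K) :
    Subalgebra R K :=
  ⨅ T ∈ S.clusterStructure, T.laurentRing R

end Seed

/-! ### Regular and rational functions on `SL_n` -/

/-- The coordinate ring of `SL_n` over the complex numbers. -/
abbrev SLCoordRing (n : ℕ) : Type :=
  MvPolynomial (Fin n × Fin n) ℂ ⧸
    Ideal.span {(Matrix.mvPolynomialX (Fin n) (Fin n) ℂ).det - 1}

/-- The matrix of coordinate functions on `SL_n`. -/
noncomputable def coordMatrix (n : ℕ) : Matrix (Fin n) (Fin n) (SLCoordRing n) :=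
  (Matrix.mvPolynomialX (Fin n) (Fin n) ℂ).map (Ideal.Quotient.mk _)

theorem det_coordMatrix (n : ℕ) : (coordMatrix n).det = 1 := by
  have h : (coordMatrix n).det
      = Ideal.Quotient.mk (Ideal.span {(Matrix.mvPolynomialX (Fin n) (Fin n) ℂ).det - 1})
          (Matrix.mvPolynomialX (Fin n) (Fin n) ℂ).det := by
    rw [RingHom.map_det]; rfl
  rw [h, ← map_one (Ideal.Quotient.mk _), Ideal.Quotient.eq]
  exact Ideal.subset_span rfl

/-- Dividing the first row of an invertible matrix by its determinant shows that the coordinate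
ring of `SL_n` embeds in the one of `GL_n`. -/
instance isDomain_SLCoordRing (n : ℕ) : IsDomain (SLCoordRing n) := by
  have hdet : (Matrix.mvPolynomialX (Fin n) (Fin n) ℂ).det ≠ 0 :=
    Matrix.det_mvPolynomialX_ne_zero (Fin n) ℂ
  let L := Localization.Away (Matrix.mvPolynomialX (Fin n) (Fin n) ℂ).det
  have : IsDomain L := IsLocalization.isDomain_localization
    (powers_le_nonZeroDivisors_of_noZeroDivisors hdet)
  let u : L := IsLocalization.Away.invSelf (Matrix.mvPolynomialX (Fin n) (Fin n) ℂ).det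
  let Y : Matrix (Fin n) (Fin n) L := (Matrix.mvPolynomialX (Fin n) (Fin n) ℂ).map (algebraMap _ L)
  have hY : Y.det = algebraMap _ L (Matrix.mvPolynomialX (Fin n) (Fin n) ℂ).det := by
    rw [RingHom.map_det]; rfl
  let d : Fin n → L := fun i => if i.1 = 0 then u else 1
  have hd : (Matrix.diagonal d * Y).det = 1 := by
    rw [Matrix.det_mul, Matrix.det_diagonal, hY]
    cases n with
    | zero => simp
    | succ m =>
      rw [Fin.prod_univ_succ]
      simp only [d, Fin.val_zero, Fin.val_succ, if_true, Nat.succ_ne_zero, if_false,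
        Finset.prod_const_one, mul_one, u]
      rw [mul_comm]
      exact IsLocalization.Away.mul_invSelf _
  let e : MvPolynomial (Fin n × Fin n) ℂ →ₐ[ℂ] L :=
    MvPolynomial.aeval fun p => (Matrix.diagonal d * Y) p.1 p.2
  have he : e (Matrix.mvPolynomialX (Fin n) (Fin n) ℂ).det = 1 := by
    rw [AlgHom.map_det, ← hd]
    congr 1
    ext a b
    simp [e, Matrix.mvPolynomialX]
  let F : SLCoordRing n →+* L := Ideal.Quotient.lift _ e.toRingHom (by
    intro a ha
    obtain ⟨c, rfl⟩ := Ideal.mem_span_singleton'.1 ha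
    change e (c * (_ - 1)) = 0
    rw [map_mul, map_sub, he, map_one, sub_self, mul_zero])
  have hX : Ideal.Quotient.mk (Ideal.span {(Matrix.mvPolynomialX (Fin n) (Fin n) ℂ).det - 1})
      (Matrix.mvPolynomialX (Fin n) (Fin n) ℂ).det = 1 := by
    rw [← det_coordMatrix n, RingHom.map_det]; rfl
  let G : L →+* SLCoordRing n := IsLocalization.Away.lift
    (Matrix.mvPolynomialX (Fin n) (Fin n) ℂ).det
    (g := Ideal.Quotient.mk (Ideal.span {(Matrix.mvPolynomialX (Fin n) (Fin n) ℂ).det - 1}))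
    (by rw [hX]; exact isUnit_one)
  have hG : ∀ a, G (algebraMap _ L a) = Ideal.Quotient.mk _ a := fun a =>
    IsLocalization.Away.lift_eq _ _ a
  have hu : G u = 1 := by
    have h := congrArg G (IsLocalization.Away.mul_invSelf (S := L)
      (Matrix.mvPolynomialX (Fin n) (Fin n) ℂ).det)
    rw [map_mul, hG, hX, one_mul, map_one] at h
    exact h
  have hGF : ∀ x, G (F x) = x := by
    have h : (G.comp F).comp (Ideal.Quotient.mk
        (Ideal.span {(Matrix.mvPolynomialX (Fin n) (Fin n) ℂ).det - 1})) = Ideal.Quotient.mk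
        (Ideal.span {(Matrix.mvPolynomialX (Fin n) (Fin n) ℂ).det - 1}) := by
      apply MvPolynomial.ringHom_ext
      · intro r
        change G (e (MvPolynomial.C r)) = _
        rw [show e (MvPolynomial.C r) = algebraMap _ L (MvPolynomial.C r) from by
          simp only [e, MvPolynomial.aeval_C]
          rw [IsScalarTower.algebraMap_apply ℂ (MvPolynomial (Fin n × Fin n) ℂ) L]; rfl, hG]
      · intro p
        change G (e (MvPolynomial.X p)) = _
        have : e (MvPolynomial.X p) =
            d p.1 * algebraMap (MvPolynomial (Fin n × Fin n) ℂ) L (MvPolynomial.X p) := by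
          simp only [e, MvPolynomial.aeval_X]
          rw [Matrix.diagonal_mul]
          rfl
        rw [this, map_mul, hG]
        have h1 : G (d p.1) = 1 := by
          by_cases h0 : p.1.1 = 0
          · simp only [d, h0, if_true, hu]
          · simp only [d, h0, if_false, map_one]
        rw [h1, one_mul]
    intro x
    obtain ⟨a, rfl⟩ := Ideal.Quotient.mk_surjective x
    exact RingHom.congr_fun h a
  exact Function.Injective.isDomain F (Function.LeftInverse.injective hGF)

/-- The field of rational functions on `SL_n`. -/
abbrev SLFunctionField (n : ℕ) : Type := FractionRing (SLCoordRing n)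

/-- The matrix of coordinate functions, as rational functions on `SL_n`. -/
noncomputable def genericMatrix (n : ℕ) : Matrix (Fin n) (Fin n) (SLFunctionField n) :=
  (coordMatrix n).map (algebraMap (SLCoordRing n) (SLFunctionField n))

/-! ### The initial cluster

Rows and columns are numbered from `1` to `n`, as usual for matrices. -/

section Functions

variable {R : Type} [CommRing R] {n : ℕ}

/-- The entry `x_ij`, `1 ≤ i, j ≤ n`, of an `n × n` matrix (zero outside of this range). -/
def entry (X : Matrix (Fin n) (Fin n) R) (i j : ℕ) : R :=
  if h : (1 ≤ i ∧ i ≤ n) ∧ (1 ≤ j ∧ j ≤ n) then X ⟨i - 1, by omega⟩ ⟨j - 1, by omega⟩ else 0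

/-- The infinite array of zeros in which the submatrix of `X` with rows `[r, r']` and columns
`[c, c']` is placed just after the first `p` rows and the first `q` columns
(the array is indexed from zero). -/
def block (X : Matrix (Fin n) (Fin n) R) (r r' c c' p q : ℕ) (s t : ℕ) : R :=
  if (p ≤ s ∧ r + (s - p) ≤ r') ∧ (q ≤ t ∧ c + (t - q) ≤ c') then
    entry X (r + (s - p)) (c + (t - q))
  else 0

/-- The determinant of the upper left `N × N` corner of an array. -/
def cornerDet (N : ℕ) (A : ℕ → ℕ → R) : R :=
  (Matrix.of fun s t : Fin N => A s t).det

/-- `f_ij = det M_ij`, where `M_ij` is the maximal contiguous square submatrix of `X` with `x_ij`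
in its upper left corner. -/
def f (X : Matrix (Fin n) (Fin n) R) (i j : ℕ) : R :=
  if i < j then cornerDet (n - j + 1) (block X i (n - j + i) j n 0 0)
  else cornerDet (n - i + 1) (block X i n j (n - i + j) 0 0)

/-- For `i = n + j - α`, the determinant of the matrix that consists of `X_[i,n]^[j,α+1]` and,
below it, `X_[1,n-β]^[β,n]`, the columns `α, α+1` of the former being continued by the columns
`β, β+1` of the latter. If `n = 2β`, the last row of the second block is the row `β` of `X`;
then the second block gets one more row, and a third block `X_[α,n]^[1,n-α]` is placed to the right
of it, the rows `β, β+1` of the second block being continued by the rows `α, α+1` of the third. -/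
def theta (X : Matrix (Fin n) (Fin n) R) (α β i j : ℕ) : R :=
  if n = 2 * β then
    cornerDet ((n - i + 1) + (n - β) + (n - α))
      (block X i n j (α + 1) 0 0
        + block X 1 (β + 1) β n (n - i + 1) (n - i)
        + block X α n 1 (n - α) (n - i + β) (n - i + (n - β + 1)))
  else
    cornerDet ((n - i + 1) + (n - β))
      (block X i n j (α + 1) 0 0 + block X 1 (n - β) β n (n - i + 1) (n - i))

/-- For `j = n + i - β`, the determinant of the matrix that consists of `X_[i,β+1]^[j,n]` and,
to the right of it, `X_[α,n]^[1,n-α]`, the rows `β, β+1` of the former being continued by the rows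
`α, α+1` of the latter. If `n = 2α`, the last column of the second block is the column `α` of `X`;
then the second block gets one more column, and a third block `X_[1,n-β]^[β,n]` is placed below it,
the columns `α, α+1` of the second block being continued by the columns `β, β+1` of the third. -/
def psi (X : Matrix (Fin n) (Fin n) R) (α β i j : ℕ) : R :=
  if n = 2 * α then
    cornerDet ((n - j + 1) + (n - α) + (n - β))
      (block X i (β + 1) j n 0 0
        + block X α n 1 (α + 1) (n - j) (n - j + 1)
        + block X 1 (n - β) β n (n - j + (n - α + 1)) (n - j + α))
  else
    cornerDet ((n - j + 1) + (n - α))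
      (block X i (β + 1) j n 0 0 + block X α n 1 (n - α) (n - j) (n - j + 1))

/-- The function `φ_ij` of the initial cluster for `α ↦ β`. -/
def phi (X : Matrix (Fin n) (Fin n) R) (α β i j : ℕ) : R :=
  if i + α = n + j then theta X α β i j
  else if j + β = n + i then psi X α β i j
  else f X i j

end Functions

/-! ### The initial quiver -/

/-- The vertices: the `n × n` grid without `(1, 1)`. -/
abbrev Vertex (n : ℕ) : Type :=
  {v : ℕ × ℕ // v ∈ (Finset.Icc 1 n ×ˢ Finset.Icc 1 n).erase (1, 1)}

/-- The mutable vertices of the quiver for `α ↦ β`. -/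
def mutableVertices (n α β : ℕ) : Set (Vertex n) :=
  {v | (2 ≤ v.1.1 ∧ 2 ≤ v.1.2) ∨ v.1 = (α + 1, 1) ∨ v.1 = (1, β + 1)}

/-- The arrows `u → v` of the standard quiver. There are none between two vertices of the first row
and column, which are frozen in the standard quiver. -/
def StandardArrow (u v : ℕ × ℕ) : Prop :=
  (v = (u.1 + 1, u.2) ∨ v = (u.1, u.2 + 1) ∨ u = (v.1 + 1, v.2 + 1)) ∧
    ¬((u.1 = 1 ∨ u.2 = 1) ∧ (v.1 = 1 ∨ v.2 = 1))

/-- The arrows `u → v` that are added to the standard quiver for `α ↦ β`. -/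
def AddedArrow (n α β : ℕ) (u v : ℕ × ℕ) : Prop :=
  (u = (α, 1) ∧ v = (α + 1, 1)) ∨ (u = (1, β) ∧ v = (1, β + 1)) ∨
  (u = (n, α + 1) ∧ v = (1, β + 1)) ∨ (u = (1, β + 1) ∧ v = (n, α)) ∨
  (u = (β + 1, n) ∧ v = (α + 1, 1)) ∨ (u = (α + 1, 1) ∧ v = (β, n))

/-- The arrows `u → v` of the quiver for `α ↦ β`. -/
def Arrow (n α β : ℕ) (u v : ℕ × ℕ) : Prop :=
  StandardArrow u v ∨ AddedArrow n α β u v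

instance (n α β : ℕ) (u v : ℕ × ℕ) : Decidable (Arrow n α β u v) := by
  unfold Arrow StandardArrow AddedArrow; infer_instance

/-- The initial seed on `SL_n` for the Belavin-Drinfeld triple `α ↦ β`. -/
noncomputable def initialSeed (n α β : ℕ) :
    Seed (Vertex n) (mutableVertices n α β) (SLFunctionField n) where
  var := fun v => phi (genericMatrix n) α β v.1.1 v.1.2
  mat := fun u v =>
    (if Arrow n α β u.1.1 v.1 then 1 else 0) - (if Arrow n α β v.1 u.1.1 then 1 else 0)

end ExoticSL

/-! The argument has two halves: a criterion that replaces all seeds by the initial seed and its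
neighbours, and an explicit reconstruction of the matrix entries in these seeds.

For the criterion, suppose that a seed generates the field, has a skew-symmetric exchange matrix
with independent rows, and has no more variables than the transcendence degree. All of this survives
mutation (`Seed.IsFull.mutate`). If `z` is Laurent in a seed and in all its neighbours, it is
Laurent in any seed `T` two mutations away. Indeed, two expansions of `z` turn into expansions in
`T` with denominators powers of `P` and of `Q`, up to monomials, where `P` and `Q` are relatively
prime polynomials. Unique factorization then removes both denominators
(`Seed.mem_laurentRing_of_isRelPrime`). The coprimality comes from the independence of the rows when
the two directions are not joined (`isRelPrime_exchPoly`), and from direct computation otherwise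
(`exists_relPrime_of_pos`). No exchange polynomial is divisible by a variable, so frozen variables
never have to be inverted.

For the reconstruction, the generic matrix `x` is written as `y` followed by one row operation (at
`β`, with multiplier `s`) and one column operation (at `α`, with multiplier `t`). Both multipliers
are quotients of minors of `y` (`IsGauge`). By Schur complements, each `φ_ij` is then the standard
trailing minor of `y` at `(i, j)`, times a factor `φ_{α+1,1}` or `φ_{1,β+1}` on two special
diagonals (`IsGauge.phi_eq`). Trailing minors recover the entries of `y` from the lower right corner
upwards, and `s`, `t` then give `x`.

After a mutation one inverse is missing. At an interior vertex, two Desnanot-Jacobi identities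
express the new variable through a minor containing the missing entry
(`corner_mem_of_stdExchange_of_le`), and the added arrows supply exactly the factors that make the
exchange relation of the `φ` that of the standard minors of `y` (`IsGauge.stdExchange_div`). At `(1,
β+1)` the denominator of `t` is no longer invertible, so another column multiplier is used
(`entry_mem_of_mutate`); `(α+1, 1)` follows by transposition.

The rank condition becomes a system of difference equations on the grid
(`eq_zero_of_grid_equations`), and the nonvanishing of all `φ_ij` follows by specialization to
suitable matrices of determinant one. -/

set_option linter.unusedSectionVars false
set_option linter.unusedVariables false

namespace ExoticSL

/-! ### Monomials and exchange polynomials -/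

section Polynomials

open MvPolynomial

variable {V : Type} [Fintype V] [DecidableEq V]

/-- The monomial with exponents `e`. -/
noncomputable def mon (e : V → ℕ) : MvPolynomial V ℤ := ∏ j, X j ^ e j

/-- The sum of the two monomials in the exchange relation given by the row `r`. -/
noncomputable def exchPoly (r : V → ℤ) : MvPolynomial V ℤ :=
  mon (fun j => (r j).toNat) + mon (fun j => (-r j).toNat)

theorem mon_eq_monomial (e : V → ℕ) : mon e = monomial (Finsupp.equivFunOnFinite.symm e) 1 := by
  rw [monomial_eq, C_1, one_mul, Finsupp.prod_fintype _ _ (by simp)]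
  simp [mon]

theorem mon_add (e g : V → ℕ) : mon (fun j => e j + g j) = mon e * mon g := by
  simp [mon, pow_add, Finset.prod_mul_distrib]

theorem mon_pow (e : V → ℕ) (c : ℕ) : mon (fun j => c * e j) = mon e ^ c := by
  simp [mon, ← Finset.prod_pow, ← pow_mul, mul_comm]

theorem mon_update (e : V → ℕ) (k : V) : mon e = X k ^ e k * mon (Function.update e k 0) := by
  unfold mon
  rw [← Finset.mul_prod_erase Finset.univ _ (Finset.mem_univ k),
    ← Finset.mul_prod_erase Finset.univ (fun j => X j ^ Function.update e k 0 j)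
      (Finset.mem_univ k)]
  simp only [Function.update_self, pow_zero, one_mul]
  congr 1
  refine Finset.prod_congr rfl fun j hj => ?_
  rw [Function.update_of_ne (Finset.ne_of_mem_erase hj)]

theorem degreeOf_mon (e : V → ℕ) (i : V) : degreeOf i (mon e) = e i := by
  rw [mon_eq_monomial, degreeOf_monomial_eq _ _ one_ne_zero]; simp

theorem exchPoly_neg (r : V → ℤ) : exchPoly (-r) = exchPoly r := by
  simp [exchPoly, add_comm]

theorem degreeOf_exchPoly {r : V → ℤ} {i : V} (h : r i = 0) : degreeOf i (exchPoly r) = 0 := by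
  refine Nat.le_zero.1 ((degreeOf_add_le _ _ _).trans ?_)
  simp [degreeOf_mon, h]

theorem eval_one_exchPoly (r : V → ℤ) : eval (fun _ => (1 : ℤ)) (exchPoly r) = 2 := by
  simp [exchPoly, mon]

theorem exchPoly_ne_zero (r : V → ℤ) : exchPoly r ≠ 0 := fun h => by
  have := eval_one_exchPoly r
  simp [h] at this

theorem eval_update_mon (e : V → ℕ) (i : V) :
    eval (Function.update (fun _ => (1 : ℤ)) i 0) (mon e) = if e i = 0 then 1 else 0 := by
  rw [mon, map_prod, Finset.prod_eq_single i]
  · split_ifs with h <;> simp [h]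
  · intro j _ hj; simp [hj]
  · simp

/-- At most one of the two monomials involves `X i`, so setting `X i = 0` and the other variables to
one gives 1 or 2, never 0. -/
theorem X_not_dvd_exchPoly (r : V → ℤ) (i : V) : ¬ X i ∣ exchPoly r := by
  rintro ⟨q, hq⟩
  have h := congrArg (eval (Function.update (fun _ => (1 : ℤ)) i 0)) hq
  rw [exchPoly, map_add, eval_update_mon, eval_update_mon] at h
  simp only [map_mul, eval_X, Function.update_self, zero_mul] at h
  split_ifs at h <;> omega

theorem not_dvd_X_of_dvd_exchPoly {p : MvPolynomial V ℤ} (hp : Prime p) {r : V → ℤ}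
    (h : p ∣ exchPoly r) (i : V) : ¬ p ∣ X i := fun hi =>
  X_not_dvd_exchPoly r i (((hp.associated_of_dvd X_prime hi).dvd_iff_dvd_left).1 h)

theorem not_dvd_mon_of_dvd_exchPoly {p : MvPolynomial V ℤ} (hp : Prime p) {r : V → ℤ}
    (h : p ∣ exchPoly r) (e : V → ℕ) : ¬ p ∣ mon e := fun hd => by
  obtain ⟨i, -, hi⟩ := (hp.dvd_finsetProd_iff _).1 hd
  exact not_dvd_X_of_dvd_exchPoly hp h i (hp.dvd_of_dvd_pow hi)

theorem degreeOf_eq_zero_of_dvd {p q : MvPolynomial V ℤ} (h : p ∣ q) (hq : q ≠ 0) {i : V}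
    (hi : degreeOf i q = 0) : degreeOf i p = 0 := by
  obtain ⟨s, rfl⟩ := h
  rw [degreeOf_mul_eq (left_ne_zero_of_mul hq) (right_ne_zero_of_mul hq)] at hi
  omega

/-- A prime divisor of `exchPoly r` and `exchPoly r'` divides the difference of the monomials of the
positive and the negative part of twice any integral combination of `r` and `r'`. -/
theorem dvd_mon_sub_mon {p : MvPolynomial V ℤ} (hp : Prime p) {r r' : V → ℤ}
    (h : p ∣ exchPoly r) (h' : p ∣ exchPoly r') (a b : ℤ) :
    p ∣ mon (fun j => (2 * (a * r j + b * r' j)).toNat)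
      - mon (fun j => (-(2 * (a * r j + b * r' j))).toNat) := by
  -- In the residue field at `p` the variables are nonzero, so Laurent monomials with integer
  -- exponents make sense there.
  have : (Ideal.span {p}).IsPrime := (Ideal.span_singleton_prime hp.ne_zero).2 hp
  let E := FractionRing (MvPolynomial V ℤ ⧸ Ideal.span {p})
  let π : MvPolynomial V ℤ →+* E :=
    (algebraMap (MvPolynomial V ℤ ⧸ Ideal.span {p}) E).comp (Ideal.Quotient.mk _)
  have hπ : ∀ q, π q = 0 ↔ p ∣ q := fun q => by
    rw [RingHom.comp_apply, FaithfulSMul.algebraMap_eq_zero_iff, Ideal.Quotient.eq_zero_iff_mem,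
      Ideal.mem_span_singleton]
  have hX : ∀ i, π (X i) ≠ 0 := fun i => by
    rw [Ne, hπ]; exact not_dvd_X_of_dvd_exchPoly hp h i
  have hmon : ∀ s : V → ℤ, ∏ j, π (X j) ^ s j
      = π (mon fun j => (s j).toNat) / π (mon fun j => (-s j).toNat) := fun s => by
    simp only [mon, map_prod, map_pow]
    rw [← Finset.prod_div_distrib]
    refine Finset.prod_congr rfl fun j _ => ?_
    rw [← zpow_natCast, ← zpow_natCast, ← zpow_sub₀ (hX j)]
    congr 1
    omega
  have hne : ∀ e, π (mon e) ≠ 0 := fun e => by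
    rw [Ne, hπ]; exact not_dvd_mon_of_dvd_exchPoly hp h e
  -- Divisibility by `p` says that the ratio of the two monomials is -1 in the residue field;
  -- doubling the exponents removes this sign.
  have hr : ∀ s : V → ℤ, p ∣ exchPoly s → ∏ j, π (X j) ^ s j = -1 := fun s hs => by
    rw [hmon, div_eq_iff (hne _)]
    have := (hπ _).2 hs
    rw [exchPoly, map_add] at this
    linear_combination this
  have h1 : ∏ j, π (X j) ^ (2 * (a * r j + b * r' j)) = 1 := by
    have : ∀ j, π (X j) ^ (2 * (a * r j + b * r' j))
        = ((π (X j) ^ r j) ^ a * (π (X j) ^ r' j) ^ b) ^ (2 : ℤ) := fun j => by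
      rw [← zpow_mul, ← zpow_mul, ← zpow_add₀ (hX j), ← zpow_mul]; ring_nf
    simp only [this]
    rw [Finset.prod_zpow, Finset.prod_mul_distrib, Finset.prod_zpow, Finset.prod_zpow, hr r h,
      hr r' h', mul_zpow, ← zpow_mul, ← zpow_mul, mul_comm a, mul_comm b, zpow_mul, zpow_mul]
    norm_num
  rw [hmon, div_eq_one_iff_eq (hne _)] at h1
  rw [← hπ, map_sub, h1, sub_self]

theorem mon_sub_mon_ne_zero {s : V → ℤ} (h : s ≠ 0) :
    mon (fun j => (s j).toNat) - mon (fun j => (-s j).toNat) ≠ 0 := by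
  intro h0
  apply h
  funext i
  have := congrArg (degreeOf i) (sub_eq_zero.1 h0)
  rw [degreeOf_mon, degreeOf_mon] at this
  simp only [Pi.zero_apply]; omega

/-- For each variable some nontrivial integral combination of `r` and `r'` vanishes at it. A common
prime divides the corresponding nonzero difference of monomials, which is free of this variable,
hence so is the prime. A prime constant is excluded because a coefficient of `exchPoly r` is 1. -/
theorem isRelPrime_exchPoly {r r' : V → ℤ} (h : LinearIndependent ℤ ![r, r']) :
    IsRelPrime (exchPoly r) (exchPoly r') := by
  rw [UniqueFactorizationMonoid.isRelPrime_iff_no_prime_factors (exchPoly_ne_zero r)]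
  intro p hp hp' hprime
  rw [LinearIndependent.pair_iff] at h
  have hfree : ∀ i, degreeOf i p = 0 := by
    intro i
    obtain ⟨a, b, hab, hi⟩ : ∃ a b : ℤ, ¬ (a = 0 ∧ b = 0) ∧ a * r i + b * r' i = 0 := by
      by_cases hi : r i = 0 ∧ r' i = 0
      · exact ⟨1, 0, by simp, by simp [hi.1]⟩
      · exact ⟨r' i, -r i, fun hc => hi ⟨by omega, hc.1⟩, by ring⟩
    refine degreeOf_eq_zero_of_dvd (dvd_mon_sub_mon hprime hp hp' a b)
      (mon_sub_mon_ne_zero (s := fun j => 2 * (a * r j + b * r' j)) fun hs => hab (h a b ?_)) ?_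
    · funext j
      have := congrFun hs j
      simp only [Pi.zero_apply, Pi.add_apply, Pi.smul_apply, smul_eq_mul] at this ⊢
      omega
    · refine Nat.le_zero.1 ((degreeOf_sub_le _ _ _).trans ?_)
      simp [degreeOf_mon, hi]
  have hvars : p.vars = ∅ := by
    ext i; rw [mem_vars_iff_degreeOf_ne_zero]; simp [hfree i]
  obtain ⟨a, rfl⟩ : ∃ a, p = C a := ⟨_, vars_eq_empty_iff_eq_C.1 hvars⟩
  -- Nonvanishing of `r` makes the two monomials distinct, so that the coefficient examined below is
  -- 1 rather than 2.
  have hr : r ≠ 0 := fun h0 => by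
    have := (h 1 0 (by simp [h0])).1
    omega
  have ha := (C_dvd_iff_dvd_coeff _ _).1 hp (Finsupp.equivFunOnFinite.symm fun j => (r j).toNat)
  rw [exchPoly, coeff_add, mon_eq_monomial, mon_eq_monomial, coeff_monomial, coeff_monomial,
    if_pos rfl, if_neg, add_zero] at ha
  · exact hprime.not_isUnit ((isUnit_of_dvd_one ha).map C)
  · intro he
    apply hr
    funext j
    have := DFunLike.congr_fun he j
    simp only [Finsupp.equivFunOnFinite_symm_apply_apply] at this
    simp only [Pi.zero_apply]; omega

end Polynomials
-- Exchange polynomials after two mutations in adjacent directions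
section ExchangeAlgebra

open MvPolynomial

variable {V : Type} [Fintype V] [DecidableEq V] {K : Type} [Field K]

theorem aeval_mon (x : V → K) (e : V → ℕ) : aeval x (mon e) = ∏ j, x j ^ e j := by
  simp [mon]

theorem aeval_mon_congr {x y : V → K} {e : V → ℕ} (h : ∀ j, e j ≠ 0 → x j = y j) :
    aeval x (mon e) = aeval y (mon e) := by
  rw [aeval_mon, aeval_mon]
  refine Finset.prod_congr rfl fun j _ => ?_
  by_cases hj : e j = 0
  · simp [hj]
  · rw [h j hj]

theorem aeval_exchPoly_congr {x y : V → K} {r : V → ℤ} (h : ∀ j, r j ≠ 0 → x j = y j) :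
    aeval x (exchPoly r) = aeval y (exchPoly r) := by
  rw [exchPoly, map_add, map_add, aeval_mon_congr fun j hj => h j fun h0 => hj (by simp [h0]),
    aeval_mon_congr fun j hj => h j fun h0 => hj (by simp [h0])]

/-- The value of the cofactor at `c = 1` is recorded because the coprimality argument treats a
simple arrow separately. -/
theorem exists_pow_sub_pow (c : ℕ) (hc : 1 ≤ c) (A B : MvPolynomial V ℤ) :
    ∃ H, A ^ c - B ^ c = (A - B) * H ∧ (c = 1 → H = 1) := by
  obtain rfl | h := eq_or_lt_of_le hc
  · exact ⟨1, by simp, fun _ => rfl⟩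
  · obtain ⟨H, hH⟩ := sub_dvd_pow_sub_pow A B c
    exact ⟨H, hH, fun h1 => by omega⟩

/-- A prime divisor of `exchPoly r`, where `r l = 0`, does not involve the variable `X l`, so that
it can only divide `mon e * X l + mon g` if it divides the two monomials. -/
theorem not_dvd_mul_X_add {p : MvPolynomial V ℤ} (hp : Prime p) {r : V → ℤ}
    (h : p ∣ exchPoly r) {l : V} (hl : r l = 0) (e g : V → ℕ) (hg : g l = 0) :
    ¬ p ∣ mon e * X l + mon g := by
  intro hd
  have hpl : degreeOf l p = 0 :=
    degreeOf_eq_zero_of_dvd h (exchPoly_ne_zero r) (degreeOf_exchPoly hl)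
  let τ : MvPolynomial V ℤ →+* MvPolynomial V ℤ :=
    (aeval (Function.update X l (0 : MvPolynomial V ℤ))).toRingHom
  have hτ : ∀ q : MvPolynomial V ℤ, degreeOf l q = 0 → τ q = q := fun q hq =>
    hom_congr_vars (f₂ := RingHom.id _) (by ext; simp [τ]) (fun i hi _ => by
      have : i ≠ l := by
        rintro rfl
        exact (mem_vars_iff_degreeOf_ne_zero.1 hi) hq
      simp [τ, this]) rfl
  have := map_dvd τ hd
  rw [map_add, map_mul, hτ p hpl, hτ (mon g) (by rw [degreeOf_mon, hg])] at this
  have h0 : τ (X l) = 0 := by simp [τ]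
  rw [h0, mul_zero, zero_add] at this
  exact not_dvd_mon_of_dvd_exchPoly hp h g this

/-- Let `x` be an extended cluster, `a` and `b` the rows of the exchange matrix at `k` and `l`, and
let `y` be the extended cluster after mutations at `k` and then at `l`. If `x'` is the variable that
replaces `x l` in the mutation of `x` at `l`, then, up to monomials in `y k` and `y l`,
both `x k` and `x'` are polynomials in `y` which are relatively prime to the exchange polynomial
of the second mutation. -/
theorem exists_relPrime_of_pos {x y : V → K} {k l : V} (hkl : k ≠ l) {a b b' : V → ℤ} {c : ℕ}
    (hc : 1 ≤ c) (hak : a k = 0) (hal : a l = c) (hbk : b k = -c) (hbl : b l = 0)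
    (hb'k : b' k = c) (hb'l : b' l = 0)
    (hb' : ∀ j, j ≠ k → b' j = b j - c * (-a j).toNat)
    (hxy : ∀ j, j ≠ k → j ≠ l → x j = y j)
    (hP : aeval y (exchPoly b') ≠ 0)
    (hl : x l * y l = aeval y (exchPoly b')) (hk : x k * y k = aeval x (exchPoly a)) {x' : K}
    (hx' : x' * x l = aeval x (exchPoly b)) :
    ∃ Qa Qb : MvPolynomial V ℤ, IsRelPrime (exchPoly b') Qa ∧ IsRelPrime (exchPoly b') Qb ∧
      x k * (y l ^ c * y k) = aeval y Qa ∧ x' * (y k ^ c * y l ^ (c * c)) = aeval y Qb := by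
  let f : V → ℕ := Function.update (fun j => (a j).toNat) l 0
  let w : V → ℕ := fun j => (-a j).toNat
  let u : V → ℕ := fun j => (b j).toNat
  let v : V → ℕ := Function.update (fun j => (-b j).toNat) k 0
  let u' : V → ℕ := Function.update (fun j => (b' j).toNat) k 0
  let v' : V → ℕ := fun j => (-b' j).toNat
  -- Away from `k` one has `b' ≤ b`, so the truncated subtraction is a true one.
  let m : V → ℕ := fun j => u j - u' j
  have ha : exchPoly a = X l ^ c * mon f + mon w := by
    rw [exchPoly, mon_update _ l, hal, Int.toNat_natCast]
  have hb : exchPoly b = mon u + X k ^ c * mon v := by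
    rw [exchPoly, mon_update (fun j => (-b j).toNat) k, hbk, neg_neg, Int.toNat_natCast]
  have hbe : exchPoly b' = X k ^ c * mon u' + mon v' := by
    rw [exchPoly, mon_update _ k, hb'k, Int.toNat_natCast]
  have hmu : mon u = mon m * mon u' := by
    rw [← mon_add]
    congr 1
    funext j
    simp only [m, u, u']
    by_cases hj : j = k
    · subst hj; simp
    · rw [Function.update_of_ne hj]
      have := hb' j hj
      have h2 : (0 : ℤ) ≤ c * ((-a j).toNat : ℤ) := by positivity
      omega
  have hmv : mon v * mon w ^ c = mon m * mon v' := by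
    rw [← mon_pow, ← mon_add, ← mon_add]
    congr 1
    funext j
    simp only [m, u, u', v, v', w]
    by_cases hj : j = k
    · subst hj; simp [hak, hbk, hb'k]
    · rw [Function.update_of_ne hj, Function.update_of_ne hj]
      have := hb' j hj
      have h2 : (0 : ℤ) ≤ c * ((-a j).toNat : ℤ) := by positivity
      have h3 : ((c * (-a j).toNat : ℕ) : ℤ) = c * ((-a j).toNat : ℤ) := by push_cast; rfl
      omega
  have hfk : f k = 0 := by simp [f, Function.update_of_ne hkl, hak]
  have hfl : f l = 0 := by simp [f]
  have hwk : w k = 0 := by simp [w, hak]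
  have hwl : w l = 0 := by simp [w, hal]
  have huk : u k = 0 := by simp [u, hbk]
  have hul : u l = 0 := by simp [u, hbl]
  have hvk : v k = 0 := by simp [v]
  have hvl : v l = 0 := by simp [v, Function.update_of_ne hkl.symm, hbl]
  have hcongr : ∀ e : V → ℕ, e k = 0 → e l = 0 → aeval x (mon e) = aeval y (mon e) :=
    fun e h1 h2 => aeval_mon_congr fun j hj =>
      hxy j (fun h => hj (h ▸ h1)) (fun h => hj (h ▸ h2))
  -- This is the exchange relation for `x k` with `x l` replaced by `P / y l`, where `P` is the
  -- exchange polynomial of `b'`, after multiplication by `y l ^ c`.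
  let Qa : MvPolynomial V ℤ := mon w * X l ^ c + mon f * exchPoly b' ^ c
  obtain ⟨H, hH, hH1⟩ := exists_pow_sub_pow c hc Qa (mon w * X l ^ c)
  have hdiff : Qa - mon w * X l ^ c = mon f * exchPoly b' ^ c := by simp only [Qa]; ring
  rw [hdiff] at hH
  -- Substituting `x k` in the relation for `x'` gives a numerator divisible by `P`: the terms free
  -- of `P` combine through `hmu` and `hmv` into `mon m * X l ^ (c * c) * P`. The denominator `x l =
  -- P / y l` cancels this `P` and contributes the factor `X l`.
  let Qb : MvPolynomial V ℤ :=
    X l * (mon m * X l ^ (c * c) + mon v * mon f * exchPoly b' ^ (c - 1) * H)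
  have hXl : ∀ N, aeval y (X l ^ N : MvPolynomial V ℤ) = y l ^ N := by simp
  have hpow : exchPoly b' ^ c = exchPoly b' ^ (c - 1) * exchPoly b' := by
    rw [← pow_succ, Nat.sub_add_cancel hc]
  have e1 : x k * (y l ^ c * y k) = aeval y Qa := by
    rw [ha, map_add, map_mul, map_pow, aeval_X, hcongr f hfk hfl, hcongr w hwk hwl] at hk
    simp only [Qa, map_add, map_mul, map_pow, aeval_X, ← hl, mul_pow]
    linear_combination y l ^ c * hk
  have e2 : x' * (y k ^ c * y l ^ (c * c)) = aeval y Qb := by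
    apply mul_right_cancel₀ hP
    rw [hb, map_add, map_mul, map_pow, aeval_X, hcongr u huk hul, hcongr v hvk hvl] at hx'
    have h1 : x k ^ c * (y k ^ c * y l ^ (c * c)) = aeval y Qa ^ c := by
      rw [← e1]; ring
    have h2 := congrArg (aeval y) hH
    have h3 := congrArg (aeval y) hmu
    have h4 := congrArg (aeval y) hmv
    have h5 := congrArg (aeval y) hbe
    have h6 := congrArg (aeval y) hpow
    simp only [map_add, map_sub, map_mul, map_pow, aeval_X] at h2 h3 h4 h5 h6
    simp only [Qb, map_add, map_mul, map_pow, aeval_X]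
    generalize aeval y (exchPoly b') = P at *
    have h7 : (y l ^ c) ^ c = y l ^ (c * c) := by rw [← pow_mul]
    rw [mul_pow, h7] at h2
    linear_combination (y k ^ c * y l ^ (c * c) * y l) * hx' -
      x' * y k ^ c * y l ^ (c * c) * hl
      + (aeval y (mon v)) * y l * h1 + (aeval y (mon v)) * y l * h2
      + y l * y l ^ (c * c) * y k ^ c * h3 + y l * y l ^ (c * c) * h4
      - y l * y l ^ (c * c) * aeval y (mon m) * h5
      + y l * aeval y (mon v) * aeval y (mon f) * aeval y H * h6
  have hXmon : ∀ N, (X l ^ N : MvPolynomial V ℤ) = mon (Function.update (fun _ => 0) l N) := by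
    intro N
    rw [mon_update _ l]
    simp [mon]
  refine ⟨Qa, Qb, ?_, ?_, e1, e2⟩
  · rw [UniqueFactorizationMonoid.isRelPrime_iff_no_prime_factors (exchPoly_ne_zero _)]
    intro p hp hpa hprime
    have h1 : p ∣ mon w * X l ^ c :=
      (dvd_add_left ((hp.trans (dvd_pow_self _ (by omega))).mul_left _)).1 hpa
    rw [hXmon, ← mon_add] at h1
    exact not_dvd_mon_of_dvd_exchPoly hprime hp _ h1
  · rw [UniqueFactorizationMonoid.isRelPrime_iff_no_prime_factors (exchPoly_ne_zero _)]
    intro p hp hpb hprime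
    have h1 := (hprime.dvd_mul.1 hpb).resolve_left (not_dvd_X_of_dvd_exchPoly hprime hp l)
    -- For `c ≥ 2` the second summand still contains `P`, so only a monomial is left to exclude. For
    -- `c = 1` it does not, and one uses that `p` is free of `X l`.
    obtain h | h := eq_or_lt_of_le hc
    · subst h
      rw [hH1 rfl, Nat.sub_self, pow_zero, mul_one, mul_one, ← mon_add] at h1
      simp only [mul_one, pow_one] at h1
      exact not_dvd_mul_X_add hprime hp hb'l m _ (by simp [hvl, hfl]) h1
    · have h2 : p ∣ mon m * X l ^ (c * c) :=
        (dvd_add_left (((hp.trans (dvd_pow_self _ (by omega))).mul_left _).mul_right _)).1 h1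
      rw [hXmon, ← mon_add] at h2
      exact not_dvd_mon_of_dvd_exchPoly hprime hp _ h2

/-- Changing the sign of all rows leaves the exchange polynomials unchanged, so the arrow between
`k` and `l` may be assumed to have positive sign; the symmetric mutation formula then becomes the
one-sided formula of `exists_relPrime_of_pos`. -/
theorem exists_relPrime_of_ne_zero {x y : V → K} {k l : V} (hkl : k ≠ l) {a b b' : V → ℤ}
    (hal : a l ≠ 0) (hak : a k = 0) (hbk : b k = -a l) (hbl : b l = 0)
    (hb'k : b' k = a l) (hb'l : b' l = 0)
    (hb' : ∀ j, j ≠ k → b' j = b j + (|b k| * a j + b k * |a j|) / 2)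
    (hxy : ∀ j, j ≠ k → j ≠ l → x j = y j)
    (hP : aeval y (exchPoly b') ≠ 0)
    (hl : x l * y l = aeval y (exchPoly b')) (hk : x k * y k = aeval x (exchPoly a)) {x' : K}
    (hx' : x' * x l = aeval x (exchPoly b)) :
    ∃ (Qa Qb : MvPolynomial V ℤ) (c : ℕ), IsRelPrime (exchPoly b') Qa ∧
      IsRelPrime (exchPoly b') Qb ∧
      x k * (y l ^ c * y k) = aeval y Qa ∧ x' * (y k ^ c * y l ^ (c * c)) = aeval y Qb := by
  obtain h | h := lt_or_gt_of_ne hal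
  · rw [← exchPoly_neg] at hP hl hk hx'
    obtain ⟨Qa, Qb, h1⟩ := exists_relPrime_of_pos (a := -a) (b := -b) (b' := -b') (x := x) (y := y)
      (c := (-a l).toNat) hkl (by omega) (by simp [hak]) (by simp; omega)
      (by simp [hbk]; omega) (by simp [hbl]) (by simp [hb'k]; omega) (by simp [hb'l])
      (fun j hj => by
        have h2 := hb' j hj
        have h3 : (((-a l).toNat : ℕ) : ℤ) = - a l := by omega
        rw [hbk, abs_of_pos (by omega : 0 < -a l), ← mul_add] at h2
        simp only [Pi.neg_apply, neg_neg]
        rw [h2, h3]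
        obtain h4 | h4 := le_total 0 (a j)
        · rw [abs_of_nonneg h4, Int.toNat_of_nonneg h4,
            show -a l * (a j + a j) = (-a l * a j) * 2 by ring, Int.mul_ediv_cancel _ two_ne_zero]
          ring
        · rw [abs_of_nonpos h4, Int.toNat_of_nonpos h4]
          simp)
      hxy hP hl hk hx'
    rw [exchPoly_neg] at h1
    exact ⟨Qa, Qb, _, h1⟩
  · obtain ⟨Qa, Qb, h1⟩ := exists_relPrime_of_pos (a := a) (b := b) (b' := b') (x := x) (y := y)
      (c := (a l).toNat) hkl (by omega) hak (by omega)
      (by omega) hbl (by omega) hb'l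
      (fun j hj => by
        have h2 := hb' j hj
        have h3 : (((a l).toNat : ℕ) : ℤ) = a l := by omega
        rw [hbk, abs_of_neg (by omega : -a l < 0), neg_neg] at h2
        rw [h2, h3]
        obtain h4 | h4 := le_total 0 (a j)
        · rw [abs_of_nonneg h4, Int.toNat_of_nonpos (by omega)]
          simp
        · rw [abs_of_nonpos h4, Int.toNat_of_nonneg (by omega),
            show a l * a j + -a l * -a j = (a l * a j) * 2 by ring,
            Int.mul_ediv_cancel _ two_ne_zero]
          ring)
      hxy hP hl hk hx'
    exact ⟨Qa, Qb, _, h1⟩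

end ExchangeAlgebra
/-! ### Upper bounds are invariant under mutation -/

/-- A generating family no larger than the transcendence degree is a transcendence basis. Thus
independence need not be followed through mutations: generation of the field suffices. -/
theorem algebraicIndependent_of_adjoin_eq_top {V F K : Type} [Finite V] [Field F] [Field K]
    [CharZero F] [Algebra F K] {x : V → K} (hx : IntermediateField.adjoin F (Set.range x) = ⊤)
    (hV : Cardinal.mk V ≤ Algebra.trdeg F K) : AlgebraicIndependent ℤ x := by
  have : Algebra.IsAlgebraic (Algebra.adjoin F (Set.range x)) K := ⟨fun z => by
    have hz : z ∈ IntermediateField.adjoin F (Set.range x) := hx ▸ IntermediateField.mem_top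
    obtain ⟨r, hr, s, hs, rfl⟩ := IntermediateField.mem_adjoin_iff_div.1 hz
    rw [div_eq_mul_inv]
    exact (isAlgebraic_algebraMap (⟨r, hr⟩ : Algebra.adjoin F (Set.range x))).mul
      (isAlgebraic_algebraMap (⟨s, hs⟩ : Algebra.adjoin F (Set.range x))).inv⟩
  exact (Algebra.IsAlgebraic.isTranscendenceBasis_of_le_trdeg_of_finite F x hV).1.restrictScalars
    (by simp [Int.cast_injective])

/-- The elements that fall into `B` after multiplication by some power of `a` form a subalgebra, so
generators are enough. -/
theorem exists_pow_mul_mem_of_mem_adjoin {R K : Type} [CommRing R] [Field K] [Algebra R K]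
    {B : Subalgebra R K} {a : K} (ha : a ∈ B) {s : Set K} (hs : ∀ z ∈ s, ∃ N : ℕ, z * a ^ N ∈ B)
    {z : K} (hz : z ∈ Algebra.adjoin R s) : ∃ N : ℕ, z * a ^ N ∈ B := by
  induction hz using Algebra.adjoin_induction with
  | mem x hx => exact hs x hx
  | algebraMap r => exact ⟨0, by simp⟩
  | add x y _ _ hx hy =>
    obtain ⟨N, hN⟩ := hx
    obtain ⟨N', hN'⟩ := hy
    refine ⟨N + N', ?_⟩
    have : (x + y) * a ^ (N + N') = x * a ^ N * a ^ N' + y * a ^ N' * a ^ N := by ring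
    rw [this]
    exact add_mem (mul_mem hN (pow_mem ha _)) (mul_mem hN' (pow_mem ha _))
  | mul x y _ _ hx hy =>
    obtain ⟨N, hN⟩ := hx
    obtain ⟨N', hN'⟩ := hy
    refine ⟨N + N', ?_⟩
    have : x * y * a ^ (N + N') = x * a ^ N * (y * a ^ N') := by ring
    rw [this]
    exact mul_mem hN hN'

namespace Seed

open MvPolynomial

variable {V : Type} [Fintype V] [DecidableEq V] {M : Set V} {K : Type} [Field K]

theorem exchangeVar_eq (S : Seed V M K) (k : M) :
    S.exchangeVar k = aeval S.var (exchPoly (S.mat k)) / S.var k := by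
  simp [exchangeVar, exchPoly, aeval_mon]

theorem mutate_var_self (S : Seed V M K) (k : M) :
    (S.mutate k).var k = aeval S.var (exchPoly (S.mat k)) / S.var k := by
  simp [mutate, exchangeVar_eq]

theorem mutate_var_of_ne (S : Seed V M K) (k : M) {j : V} (h : j ≠ k) :
    (S.mutate k).var j = S.var j := by
  simp [mutate, h]

theorem mutate_mat_self (S : Seed V M K) (k : M) : (S.mutate k).mat k = -S.mat k := by
  funext j; simp [mutate]

theorem mutate_mat_right (S : Seed V M K) (k i : M) : (S.mutate k).mat i k = -S.mat i k := by
  simp [mutate]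

theorem mutate_mat_of_ne (S : Seed V M K) {k i : M} {j : V} (hi : i ≠ k) (hj : j ≠ k) :
    (S.mutate k).mat i j = S.mat i j + (|S.mat i k| * S.mat k j + S.mat i k * |S.mat k j|) / 2 := by
  simp [mutate, hi, hj]

/-- The form with positive parts shows that the division by two is exact and is additive enough to
be summed over rows. -/
theorem abs_mul_add_mul_abs_div_two (a b : ℤ) :
    (|a| * b + a * |b|) / 2 = (a.toNat : ℤ) * b + a * ((-b).toNat : ℤ) := by
  obtain ha | ha := le_total 0 a <;> obtain hb | hb := le_total 0 b
  · rw [abs_of_nonneg ha, abs_of_nonneg hb, Int.toNat_of_nonneg ha,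
      Int.toNat_of_nonpos (by omega), ← two_mul, Int.mul_ediv_cancel_left _ two_ne_zero]; simp
  · rw [abs_of_nonneg ha, abs_of_nonpos hb, Int.toNat_of_nonneg ha, Int.toNat_of_nonneg (by omega)]
    simp
  · rw [abs_of_nonpos ha, abs_of_nonneg hb, Int.toNat_of_nonpos ha, Int.toNat_of_nonpos (by omega)]
    simp
  · rw [abs_of_nonpos ha, abs_of_nonpos hb, Int.toNat_of_nonpos ha, Int.toNat_of_nonneg (by omega),
      show -a * b + a * -b = 2 * (a * -b) by ring, Int.mul_ediv_cancel_left _ two_ne_zero]; simp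

/-- The conditions on a seed under which its upper bound is the upper cluster algebra: it generates
the field, the exchange matrix is skew-symmetric and has full rank. -/
structure IsFull (F : Type) [Field F] [Algebra F K] (S : Seed V M K) : Prop where
  adjoin_eq_top : IntermediateField.adjoin F (Set.range S.var) = ⊤
  skew : ∀ i j : M, S.mat i j = -S.mat j i
  rows : LinearIndependent ℤ S.mat

section

variable {F : Type} [Field F] [CharZero F] [Algebra F K] {S : Seed V M K}

theorem IsFull.mat_self (h : S.IsFull F) (k : M) : S.mat k k = 0 := by
  have := h.skew k k; omega

theorem IsFull.indep (h : S.IsFull F) (hV : Cardinal.mk V ≤ Algebra.trdeg F K) :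
    AlgebraicIndependent ℤ S.var := algebraicIndependent_of_adjoin_eq_top h.adjoin_eq_top hV

theorem IsFull.var_ne_zero (h : S.IsFull F) (hV : Cardinal.mk V ≤ Algebra.trdeg F K) (j : V) :
    S.var j ≠ 0 := (h.indep hV).ne_zero j

theorem IsFull.aeval_ne_zero (h : S.IsFull F) (hV : Cardinal.mk V ≤ Algebra.trdeg F K)
    {p : MvPolynomial V ℤ} (hp : p ≠ 0) : aeval S.var p ≠ 0 := fun h0 =>
  hp ((h.indep hV).eq_zero_of_aeval_eq_zero _ h0)

/-- The exchange relation, read in the mutated seed. -/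
theorem IsFull.mutate_var_mul (h : S.IsFull F) (hV : Cardinal.mk V ≤ Algebra.trdeg F K) (k : M) :
    (S.mutate k).var k * S.var k = aeval (S.mutate k).var (exchPoly (S.mat k)) := by
  rw [mutate_var_self, div_mul_cancel₀ _ (h.var_ne_zero hV k)]
  refine aeval_exchPoly_congr fun j hj => (S.mutate_var_of_ne k ?_).symm
  rintro rfl
  exact hj (h.mat_self k)

theorem IsFull.mutate_adjoin (h : S.IsFull F) (hV : Cardinal.mk V ≤ Algebra.trdeg F K) (k : M) :
    IntermediateField.adjoin F (Set.range (S.mutate k).var) = ⊤ := by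
  rw [eq_top_iff, ← h.adjoin_eq_top, IntermediateField.adjoin_le_iff]
  have hmem : ∀ j, (S.mutate k).var j ∈ IntermediateField.adjoin F (Set.range (S.mutate k).var) :=
    fun j => IntermediateField.subset_adjoin _ _ ⟨j, rfl⟩
  rintro _ ⟨j, rfl⟩
  by_cases hj : j = k
  · subst hj
    have h1 := h.mutate_var_mul hV k
    have hP : aeval (S.mutate k).var (exchPoly (S.mat k)) ≠ 0 := by
      rw [← h1, mutate_var_self]
      rw [div_mul_cancel₀ _ (h.var_ne_zero hV k)]
      exact h.aeval_ne_zero hV (exchPoly_ne_zero _)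
    have h2 : S.var k = aeval (S.mutate k).var (exchPoly (S.mat k)) / (S.mutate k).var k := by
      rw [← h1] at hP ⊢
      rw [mul_div_cancel_left₀ _ (left_ne_zero_of_mul hP)]
    rw [h2]
    refine div_mem ?_ (hmem _)
    simp only [exchPoly, map_add, aeval_mon]
    exact add_mem (prod_mem fun j _ => pow_mem (hmem j) _) (prod_mem fun j _ => pow_mem (hmem j) _)
  · rw [← S.mutate_var_of_ne k hj]
    exact hmem j

theorem IsFull.mutate_skew (h : S.IsFull F) (k i j : M) :
    (S.mutate k).mat i j = -(S.mutate k).mat j i := by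
  by_cases hi : i = k
  · subst hi
    rw [mutate_mat_self, mutate_mat_right, Pi.neg_apply, h.skew i j]
  by_cases hj : j = k
  · subst hj
    rw [mutate_mat_self, mutate_mat_right, Pi.neg_apply, h.skew i j]
  rw [mutate_mat_of_ne S hi (fun h => hj (Subtype.ext h)),
    mutate_mat_of_ne S hj (fun h => hi (Subtype.ext h)), h.skew i j, h.skew i k, h.skew k j,
    abs_mul_add_mul_abs_div_two, abs_mul_add_mul_abs_div_two]
  have e : ∀ a : ℤ, (a.toNat : ℤ) = a + (-a).toNat := fun a => by omega
  rw [neg_neg, e (S.mat j k), e (-S.mat k i), neg_neg]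
  ring

/-- A relation among the mutated rows yields one among the old rows. The coefficients away from `k`
are unchanged, while the one at `k` becomes `c - g k`. -/
theorem IsFull.mutate_rows (h : S.IsFull F) (k : M) : LinearIndependent ℤ (S.mutate k).mat := by
  classical
  have : Fintype M := Fintype.ofFinite M
  rw [Fintype.linearIndependent_iff]
  intro g hg
  have hcol : ∀ j, ∑ i, g i * (S.mutate k).mat i j = 0 := fun j => by
    simpa using congrFun hg j
  let c : ℤ := ∑ i ∈ Finset.univ.erase k, g i * ((S.mat i k).toNat : ℤ)
  -- The column `k` of the relation kills the terms of the mutation formula that carry the negative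
  -- part of row `k`; only those with multiplier `c` remain.
  have hk0 : ∑ i ∈ Finset.univ.erase k, g i * S.mat i k = 0 := by
    have h1 := hcol k
    rw [← Finset.add_sum_erase _ _ (Finset.mem_univ k), mutate_mat_right, h.mat_self] at h1
    simp only [neg_zero, mul_zero, zero_add] at h1
    rw [← neg_eq_zero, ← Finset.sum_neg_distrib, ← h1]
    refine Finset.sum_congr rfl fun i hi => ?_
    rw [mutate_mat_right]; ring
  have key : ∑ i, Function.update g k (c - g k) i • S.mat i = 0 := by
    funext j
    simp only [Finset.sum_apply, Pi.smul_apply, smul_eq_mul, Pi.zero_apply]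
    rw [← Finset.add_sum_erase _ _ (Finset.mem_univ k), Function.update_self,
      Finset.sum_congr rfl (g := fun i => g i * S.mat i j) fun i hi => by
        rw [Function.update_of_ne (Finset.ne_of_mem_erase hi)]]
    by_cases hj : j = k
    · subst hj
      rw [hk0, h.mat_self]; simp
    · have h1 := hcol j
      rw [← Finset.add_sum_erase _ _ (Finset.mem_univ k), mutate_mat_self,
        Finset.sum_congr rfl (g := fun i => g i * S.mat i j
            + (g i * ((S.mat i k).toNat : ℤ)) * S.mat k j
            + (g i * S.mat i k) * ((-S.mat k j).toNat : ℤ)) fun i hi => by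
          rw [mutate_mat_of_ne S (Finset.ne_of_mem_erase hi) hj, abs_mul_add_mul_abs_div_two]; ring,
        Finset.sum_add_distrib, Finset.sum_add_distrib, ← Finset.sum_mul, ← Finset.sum_mul, hk0]
        at h1
      simp only [Pi.neg_apply] at h1
      linear_combination h1
  have hz := Fintype.linearIndependent_iff.1 h.rows _ key
  have hi : ∀ i, i ≠ k → g i = 0 := fun i hi => by simpa [hi] using hz i
  have hc : c = 0 := Finset.sum_eq_zero fun i h => by rw [hi i (Finset.ne_of_mem_erase h), zero_mul]
  intro i
  by_cases h1 : i = k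
  · subst h1
    have := hz i
    rw [Function.update_self, hc] at this
    omega
  · exact hi i h1

theorem IsFull.mutate (h : S.IsFull F) (hV : Cardinal.mk V ≤ Algebra.trdeg F K) (k : M) :
    (S.mutate k).IsFull F := ⟨h.mutate_adjoin hV k, h.mutate_skew k, h.mutate_rows k⟩

end

/-! ### Numerators and denominators in Laurent rings -/

section Laurent

variable {S : Seed V M K}

theorem var_mem_laurentRing (S : Seed V M K) (j : V) : S.var j ∈ S.laurentRing ℤ :=
  Algebra.subset_adjoin (Or.inl ⟨j, rfl⟩)

theorem inv_mem_laurentRing (S : Seed V M K) (k : M) : (S.var k)⁻¹ ∈ S.laurentRing ℤ :=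
  Algebra.subset_adjoin (Or.inr ⟨k, rfl⟩)

theorem aeval_mem_laurentRing (S : Seed V M K) (p : MvPolynomial V ℤ) :
    aeval S.var p ∈ S.laurentRing ℤ := by
  induction p using MvPolynomial.induction_on with
  | C a => simp
  | add p q hp hq => rw [map_add]; exact add_mem hp hq
  | mul_X p i hp => rw [map_mul, aeval_X]; exact mul_mem hp (S.var_mem_laurentRing i)

/-- The denominator is kept together with its invertibility in the ring, so that no frozen variable
ever enters it. -/
theorem exists_aeval_eq_of_mem_laurentRing (hS : ∀ j, S.var j ≠ 0) {z : K}
    (hz : z ∈ S.laurentRing ℤ) :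
    ∃ m f : MvPolynomial V ℤ, (aeval S.var m)⁻¹ ∈ S.laurentRing ℤ ∧ aeval S.var m ≠ 0 ∧
      z * aeval S.var m = aeval S.var f := by
  induction hz using Algebra.adjoin_induction with
  | mem x hx =>
    obtain ⟨j, rfl⟩ | ⟨k, rfl⟩ := hx
    · exact ⟨1, X j, by simp [one_mem], by simp, by simp⟩
    · exact ⟨X k, 1, by simpa using S.inv_mem_laurentRing k, by simp [hS k], by simp [hS k]⟩
  | algebraMap r => exact ⟨1, C r, by simp [one_mem], by simp, by simp⟩
  | add x y _ _ hx hy =>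
    obtain ⟨m, f, h1, h2, h3⟩ := hx
    obtain ⟨m', f', h1', h2', h3'⟩ := hy
    refine ⟨m * m', f * m' + f' * m, ?_, ?_, ?_⟩
    · rw [map_mul, mul_inv]; exact mul_mem h1 h1'
    · rw [map_mul]; exact mul_ne_zero h2 h2'
    · rw [map_mul, map_add, map_mul, map_mul, ← h3, ← h3']; ring
  | mul x y _ _ hx hy =>
    obtain ⟨m, f, h1, h2, h3⟩ := hx
    obtain ⟨m', f', h1', h2', h3'⟩ := hy
    refine ⟨m * m', f * f', ?_, ?_, ?_⟩
    · rw [map_mul, mul_inv]; exact mul_mem h1 h1'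
    · rw [map_mul]; exact mul_ne_zero h2 h2'
    · rw [map_mul, map_mul, ← h3, ← h3']; ring

/-- After clearing the admissible denominators, both memberships become one equation between
polynomials by algebraic independence. There `P ^ N` is prime to `Q ^ N'`, hence divides the
numerator over the product of the two denominators. -/
theorem mem_laurentRing_of_isRelPrime (hS : AlgebraicIndependent ℤ S.var)
    {P Q : MvPolynomial V ℤ} (hPQ : IsRelPrime P Q) (hP0 : P ≠ 0) {z : K} {N N' : ℕ}
    (hP : z * aeval S.var P ^ N ∈ S.laurentRing ℤ) (hQ : z * aeval S.var Q ^ N' ∈ S.laurentRing ℤ) :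
    z ∈ S.laurentRing ℤ := by
  obtain ⟨m, f, h1, h2, h3⟩ := exists_aeval_eq_of_mem_laurentRing (fun j => hS.ne_zero j) hP
  obtain ⟨m', f', h1', h2', h3'⟩ := exists_aeval_eq_of_mem_laurentRing (fun j => hS.ne_zero j) hQ
  have h4 : f * m' * Q ^ N' = P ^ N * (f' * m) := by
    apply hS
    simp only [map_mul, map_pow, ← h3, ← h3']; ring
  obtain ⟨g, hg⟩ := (hPQ.pow (m := N) (n := N')).dvd_of_dvd_mul_right ⟨_, h4⟩
  have hP1 : aeval S.var P ^ N ≠ 0 := pow_ne_zero _ fun h0 =>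
    hP0 (hS.eq_zero_of_aeval_eq_zero _ h0)
  have h5 : z = aeval S.var g * (aeval S.var m)⁻¹ * (aeval S.var m')⁻¹ := by
    have := congrArg (aeval S.var) hg
    simp only [map_mul, map_pow, ← h3] at this
    field_simp
    apply mul_left_cancel₀ hP1
    linear_combination this
  rw [h5]
  exact mul_mem (mul_mem (S.aeval_mem_laurentRing g) h1) h1'

end Laurent

section

variable {F : Type} [Field F] [CharZero F] [Algebra F K] {S : Seed V M K}

theorem mem_laurentRing_of_forall {A B : Seed V M K} {a : K} (ha : a ∈ B.laurentRing ℤ)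
    (h1 : ∀ j, ∃ N : ℕ, A.var j * a ^ N ∈ B.laurentRing ℤ)
    (h2 : ∀ k : M, ∃ N : ℕ, (A.var k)⁻¹ * a ^ N ∈ B.laurentRing ℤ) {z : K}
    (hz : z ∈ A.laurentRing ℤ) : ∃ N : ℕ, z * a ^ N ∈ B.laurentRing ℤ :=
  exists_pow_mul_mem_of_mem_adjoin ha
    (by rintro _ (⟨j, rfl⟩ | ⟨k, rfl⟩) <;> [exact h1 j; exact h2 k]) hz

/-- An element `u` with `u * m = a` where `m` is invertible in the Laurent ring. -/
theorem mem_and_inv_mul_mem {B : Seed V M K} {u m a : K} (ha : a ∈ B.laurentRing ℤ)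
    (ha0 : a ≠ 0) (hm : m ∈ B.laurentRing ℤ) (hm' : m⁻¹ ∈ B.laurentRing ℤ) (h : u * m = a) :
    u ∈ B.laurentRing ℤ ∧ u⁻¹ * a ∈ B.laurentRing ℤ := by
  have hu : u ≠ 0 := fun h0 => ha0 (by rw [← h, h0, zero_mul])
  have hm0 : m ≠ 0 := fun h0 => ha0 (by rw [← h, h0, mul_zero])
  constructor
  · rw [show u = a * m⁻¹ by rw [← h, mul_assoc, mul_inv_cancel₀ hm0, mul_one]]
    exact mul_mem ha hm'
  · rw [← h, inv_mul_cancel_left₀ hu]; exact hm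

/-- Relative to the final seed `T`, the seed `S.mutate k` differs only at `l`, so an expansion there
costs powers of `P`. The seed `S.mutate l` differs at `k` and `l`, and an expansion there costs
powers of a `Q` prime to `P`. The two expansions together give `z`. -/
theorem IsFull.mem_laurentRing_mutate_mutate (h : S.IsFull F)
    (hV : Cardinal.mk V ≤ Algebra.trdeg F K) {z : K} (h0 : z ∈ S.laurentRing ℤ)
    (h1 : ∀ k, z ∈ (S.mutate k).laurentRing ℤ) (k l : M) :
    z ∈ ((S.mutate k).mutate l).laurentRing ℤ := by
  have g1 := h.mutate hV k
  have g2 := g1.mutate hV l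
  by_cases hkl : l = k
  · subst hkl
    have : ((S.mutate l).mutate l).var = S.var := by
      funext j
      by_cases hj : j = l
      · subst hj
        have h2 := h.mutate_var_mul hV l
        have h3 := g1.mutate_var_mul hV l
        rw [mutate_var_self, mutate_mat_self, exchPoly_neg, ← h2,
          mul_div_cancel_left₀ _ (g1.var_ne_zero hV l)]
      · rw [mutate_var_of_ne _ _ hj, mutate_var_of_ne _ _ hj]
    rw [laurentRing, this]
    exact h0
  have hkl' : (l : V) ≠ k := fun h => hkl (Subtype.ext h)
  set T := (S.mutate k).mutate l with hT
  let P := exchPoly ((S.mutate k).mat l)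
  have hTV := g2.indep hV
  have hTj : ∀ j, j ≠ (k : V) → j ≠ l → S.var j = T.var j := fun j hj hj' => by
    rw [hT, mutate_var_of_ne _ _ hj', mutate_var_of_ne _ _ hj]
  have hTk : T.var k = (S.mutate k).var k := by rw [hT, mutate_var_of_ne _ _ hkl'.symm]
  have hSl : (S.mutate k).var l = S.var l := mutate_var_of_ne _ _ hkl'
  have hl : S.var l * T.var l = aeval T.var P := by
    rw [← hSl, mul_comm]; exact g1.mutate_var_mul hV l
  have hP0 : aeval T.var P ≠ 0 := g2.aeval_ne_zero hV (exchPoly_ne_zero _)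
  have hk : S.var k * T.var k = aeval S.var (exchPoly (S.mat k)) := by
    rw [hTk, mutate_var_self, mul_div_cancel₀ _ (h.var_ne_zero hV k)]
  have hx' : (S.mutate l).var l * S.var l = aeval S.var (exchPoly (S.mat l)) := by
    rw [mutate_var_self, div_mul_cancel₀ _ (h.var_ne_zero hV l)]
  have hself : ∀ j, ∃ N : ℕ, T.var j * aeval T.var P ^ N ∈ T.laurentRing ℤ := fun j =>
    ⟨0, by simpa using T.var_mem_laurentRing j⟩
  -- from the first mutation
  obtain ⟨N, hN⟩ : ∃ N : ℕ, z * aeval T.var P ^ N ∈ T.laurentRing ℤ := by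
    have hL := mem_and_inv_mul_mem (T.aeval_mem_laurentRing P) hP0 (T.var_mem_laurentRing l)
      (T.inv_mem_laurentRing l) hl
    refine mem_laurentRing_of_forall (T.aeval_mem_laurentRing P) (fun j => ?_) (fun j => ?_) (h1 k)
    · by_cases hj : j = l
      · subst hj; rw [hSl]; exact ⟨0, by simpa using hL.1⟩
      · refine ⟨0, ?_⟩
        rw [← mutate_var_of_ne (S.mutate k) l hj, pow_zero, mul_one]
        exact T.var_mem_laurentRing j
    · by_cases hj : (j : V) = l
      · rw [hj, hSl]; exact ⟨1, by simpa using hL.2⟩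
      · refine ⟨0, ?_⟩
        rw [← mutate_var_of_ne (S.mutate k) l hj, pow_zero, mul_one]
        exact T.inv_mem_laurentRing j
  -- from the second one
  obtain ⟨Q, hPQ, hk1, hk2, hl1, hl2⟩ : ∃ Q : MvPolynomial V ℤ, IsRelPrime P Q ∧
      (S.var k) ∈ T.laurentRing ℤ ∧ (S.var k)⁻¹ * aeval T.var Q ∈ T.laurentRing ℤ ∧
      (S.mutate l).var l ∈ T.laurentRing ℤ ∧
      ((S.mutate l).var l)⁻¹ * aeval T.var Q ∈ T.laurentRing ℤ := by
    -- Without an arrow between `k` and `l`, mutation at `k` changes neither row `l` nor the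
    -- variables occurring there. Then `P` and `Q` are the exchange polynomials of two rows of `S`,
    -- and full rank makes them relatively prime.
    by_cases hb : S.mat k l = 0
    · have hb' : S.mat l k = 0 := by rw [h.skew, hb, neg_zero]
      have hmat : (S.mutate k).mat l = S.mat l := by
        funext j
        by_cases hj : j = k
        · subst hj; rw [mutate_mat_right, hb', neg_zero]
        · rw [mutate_mat_of_ne S hkl hj, hb']; simp
      have hk3 : S.var k * T.var k = aeval T.var (exchPoly (S.mat k)) := by
        rw [hk]
        refine aeval_exchPoly_congr fun j hj => hTj j ?_ ?_
        · rintro rfl; exact hj (h.mat_self k)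
        · rintro rfl; exact hj hb
      have hl3 : (S.mutate l).var l = T.var l := by
        apply mul_right_cancel₀ (h.var_ne_zero hV l)
        rw [hx', mul_comm (T.var l), hl]
        simp only [P, hmat]
        refine aeval_exchPoly_congr fun j hj => hTj j ?_ ?_
        · rintro rfl; exact hj hb'
        · rintro rfl; exact hj (h.mat_self l)
      have h4 := mem_and_inv_mul_mem (T.aeval_mem_laurentRing (exchPoly (S.mat k)))
        (g2.aeval_ne_zero hV (exchPoly_ne_zero _)) (T.var_mem_laurentRing k)
        (T.inv_mem_laurentRing k) hk3
      refine ⟨exchPoly (S.mat k), ?_, h4.1, h4.2, hl3 ▸ T.var_mem_laurentRing l, ?_⟩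
      · simp only [P, hmat]
        apply isRelPrime_exchPoly
        have hinj : Function.Injective ![l, k] := by
          intro a b hab
          fin_cases a <;> fin_cases b <;> simp_all
        convert h.rows.comp ![l, k] hinj using 1
        funext i
        fin_cases i <;> rfl
      · rw [hl3]; exact mul_mem (T.inv_mem_laurentRing l) (T.aeval_mem_laurentRing _)
    · obtain ⟨Qa, Qb, c, ra, rb, ha, hb⟩ := exists_relPrime_of_ne_zero (x := S.var) (y := T.var)
        hkl'.symm (a := S.mat k) (b := S.mat l) (b' := (S.mutate k).mat l) hb (h.mat_self k)
        (h.skew l k) (h.mat_self l) (by rw [mutate_mat_right, h.skew l k, neg_neg])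
        (by
          rw [mutate_mat_of_ne S hkl hkl', h.mat_self, h.skew l k, abs_mul_add_mul_abs_div_two,
            zero_add]
          have e : ∀ a : ℤ, (a.toNat : ℤ) = a + (-a).toNat := fun a => by omega
          rw [e (-S.mat k l), neg_neg]
          ring)
        (fun j hj => mutate_mat_of_ne S hkl hj) hTj hP0 hl hk hx'
      have hpow : ∀ c d : ℕ, T.var k ^ c * T.var l ^ d ∈ T.laurentRing ℤ ∧
          (T.var k ^ c * T.var l ^ d)⁻¹ ∈ T.laurentRing ℤ := fun c d => by
        refine ⟨mul_mem (pow_mem (T.var_mem_laurentRing _) _)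
          (pow_mem (T.var_mem_laurentRing _) _), ?_⟩
        rw [mul_inv, ← inv_pow, ← inv_pow]
        exact mul_mem (pow_mem (T.inv_mem_laurentRing _) _) (pow_mem (T.inv_mem_laurentRing _) _)
      rw [mul_comm (T.var l ^ c), ← pow_one (T.var k)] at ha
      have hTv := g2.var_ne_zero hV
      have hTv' : ∀ c d : ℕ, T.var k ^ c * T.var l ^ d ≠ 0 := fun c d =>
        mul_ne_zero (pow_ne_zero _ (hTv _)) (pow_ne_zero _ (hTv _))
      have hxk := mem_and_inv_mul_mem (T.aeval_mem_laurentRing Qa)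
        (ha ▸ mul_ne_zero (h.var_ne_zero hV k) (hTv' 1 c)) (hpow 1 c).1 (hpow 1 c).2 ha
      have hxl := mem_and_inv_mul_mem (T.aeval_mem_laurentRing Qb)
        (hb ▸ mul_ne_zero ((h.mutate hV l).var_ne_zero hV l) (hTv' c (c * c))) (hpow _ _).1
        (hpow _ _).2 hb
      refine ⟨Qa * Qb, ra.mul_right rb, hxk.1, ?_, hxl.1, ?_⟩
      · rw [map_mul, ← mul_assoc]; exact mul_mem hxk.2 (T.aeval_mem_laurentRing Qb)
      · rw [map_mul, mul_left_comm]; exact mul_mem (T.aeval_mem_laurentRing Qa) hxl.2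
  obtain ⟨N', hN'⟩ : ∃ N : ℕ, z * aeval T.var Q ^ N ∈ T.laurentRing ℤ := by
    refine mem_laurentRing_of_forall (T.aeval_mem_laurentRing Q) (fun j => ?_) (fun j => ?_) (h1 l)
    · refine ⟨0, ?_⟩
      rw [pow_zero, mul_one]
      by_cases hj : j = l
      · subst hj; exact hl1
      rw [mutate_var_of_ne _ _ hj]
      by_cases hj' : j = k
      · subst hj'; exact hk1
      · rw [hTj j hj' hj]; exact T.var_mem_laurentRing j
    · by_cases hj : (j : V) = l
      · rw [hj]; exact ⟨1, by simpa using hl2⟩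
      rw [mutate_var_of_ne _ _ hj]
      by_cases hj' : (j : V) = k
      · rw [hj']; exact ⟨1, by simpa using hk2⟩
      · rw [hTj j hj' hj]; exact ⟨0, by simpa using T.inv_mem_laurentRing j⟩
  exact mem_laurentRing_of_isRelPrime hTV hPQ (exchPoly_ne_zero _) hN hN'

/-- If a seed generates the field and has a skew-symmetric exchange matrix of full rank, its upper
bound is contained in the upper cluster algebra. -/
theorem IsFull.mem_upperClusterAlgebra (h : S.IsFull F)
    (hV : Cardinal.mk V ≤ Algebra.trdeg F K) {z : K} (h0 : z ∈ S.laurentRing ℤ)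
    (h1 : ∀ k, z ∈ (S.mutate k).laurentRing ℤ) : z ∈ S.upperClusterAlgebra ℤ := by
  simp only [upperClusterAlgebra, Algebra.mem_iInf]
  intro T hT
  -- The induction along mutations must carry the seed conditions and the membership in all
  -- neighbouring seeds.
  suffices T.IsFull F ∧ z ∈ T.laurentRing ℤ ∧ ∀ k, z ∈ (T.mutate k).laurentRing ℤ from this.2.1
  induction hT with
  | refl => exact ⟨h, h0, h1⟩
  | @tail A B _ hstep ih =>
    obtain ⟨k, rfl⟩ := hstep
    exact ⟨ih.1.mutate hV k, ih.2.2 k, ih.1.mem_laurentRing_mutate_mutate hV ih.2.1 ih.2.2 k⟩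

end

theorem laurentRing_int_subset (F : Type) [Field F] [Algebra F K] (S : Seed V M K) {z : K}
    (hz : z ∈ S.laurentRing ℤ) : z ∈ S.laurentRing F := by
  induction hz using Algebra.adjoin_induction with
  | mem x hx => exact Algebra.subset_adjoin hx
  | algebraMap r => simp
  | add x y _ _ hx hy => exact add_mem hx hy
  | mul x y _ _ hx hy => exact mul_mem hx hy

theorem upperClusterAlgebra_int_subset (F : Type) [Field F] [Algebra F K] (S : Seed V M K) {z : K}
    (hz : z ∈ S.upperClusterAlgebra ℤ) : z ∈ S.upperClusterAlgebra F := by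
  simp only [upperClusterAlgebra, Algebra.mem_iInf] at hz ⊢
  exact fun T hT => T.laurentRing_int_subset F (hz T hT)

end Seed
/-! ### Determinants -/

section Determinants

open Matrix

/-- A three-term Plücker relation. -/
theorem det_mul_det_updateCol_updateCol {ι R : Type} [Fintype ι] [DecidableEq ι] [CommRing R]
    (A : Matrix ι ι R) {p q : ι} (hpq : p ≠ q) (x y : ι → R) :
    A.det * ((A.updateCol p x).updateCol q y).det
      = (A.updateCol p x).det * (A.updateCol q y).det
        - (A.updateCol q x).det * (A.updateCol p y).det := by
  set B := A.updateCol q y with hB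
  -- The same Cramer coordinate is computed twice: from `A *ᵥ cramer A x = A.det • x`, and by
  -- expanding along the columns of `A`, of which all but `p` and `q` also occur in `B` and
  -- contribute nothing.
  have h1 : cramer B (A *ᵥ cramer A x) p = A.det * ((A.updateCol p x).updateCol q y).det := by
    rw [mulVec_cramer, map_smul, Pi.smul_apply, smul_eq_mul, cramer_apply, hB,
      updateCol_comm _ hpq]
  have h2 : A *ᵥ cramer A x = ∑ i, cramer A x i • A.col i := by
    funext j
    simp [mulVec, dotProduct, mul_comm]
  have h3 : ∀ i, i ≠ p → i ≠ q → cramer B (A.col i) p = 0 := fun i hp hq => by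
    rw [cramer_apply]
    refine det_zero_of_column_eq hp fun j => ?_
    simp [hB, hp, hq]
  have h4 : cramer B (A.col p) p = B.det := by
    rw [cramer_apply]
    congr 1
    ext i j
    by_cases hj : j = p
    · subst hj; simp [hB, hpq]
    · simp [hj]
  have h5 : cramer B (A.col q) p = -(A.updateCol p y).det := by
    have h6 := det_permute' (Equiv.swap p q) (A.updateCol p y)
    rw [Equiv.Perm.sign_swap hpq] at h6
    rw [cramer_apply, ← neg_one_mul]
    simp only [Units.val_neg, Units.val_one, Int.cast_neg, Int.cast_one] at h6
    rw [← h6]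
    congr 1
    ext i j
    by_cases hj : j = p
    · subst hj; simp [hB, hpq.symm]
    by_cases hj' : j = q
    · subst hj'; simp [hB, hpq.symm]
    · simp [hB, hj, hj', Equiv.swap_apply_of_ne_of_ne]
  have h6 : ∀ i, cramer B (cramer A x i • A.col i) p = cramer A x i * cramer B (A.col i) p :=
    fun i => by rw [map_smul, Pi.smul_apply, smul_eq_mul]
  rw [← h1, h2, map_sum, Finset.sum_apply,
    Finset.sum_eq_add p q hpq (fun i _ hi => by rw [h6, h3 i hi.1 hi.2, mul_zero])
      (by simp) (by simp), h6, h6, h4, h5, cramer_apply, cramer_apply]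
  ring

theorem det_updateCol_single {R : Type} [CommRing R] {n : ℕ}
    (A : Matrix (Fin (n + 1)) (Fin (n + 1)) R) (i j : Fin (n + 1)) :
    (A.updateCol j (Pi.single i 1)).det
      = (-1) ^ (i.1 + j.1) * (A.submatrix i.succAbove j.succAbove).det := by
  rw [det_succ_column _ j, Finset.sum_eq_single i]
  · rw [submatrix_updateCol_succAbove]; simp
  · intro b _ hb; simp [hb]
  · simp

end Determinants

/-! ### Corners of infinite arrays and the Desnanot-Jacobi identity -/

section Corner

variable {R : Type} [CommRing R]

theorem cornerDet_congr {N : ℕ} {A B : ℕ → ℕ → R} (h : ∀ s t, s < N → t < N → A s t = B s t) :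
    cornerDet N A = cornerDet N B := by
  unfold cornerDet
  congr 1
  ext s t
  exact h s t s.2 t.2

@[simp] theorem cornerDet_zero (A : ℕ → ℕ → R) : cornerDet 0 A = 1 := by
  simp [cornerDet]

theorem cornerDet_one (A : ℕ → ℕ → R) : cornerDet 1 A = A 0 0 := by
  simp [cornerDet]

theorem cornerDet_transpose (N : ℕ) (A : ℕ → ℕ → R) :
    cornerDet N (fun s t => A t s) = cornerDet N A := by
  unfold cornerDet
  rw [← Matrix.det_transpose]
  rfl

theorem map_cornerDet {S : Type} [CommRing S] (g : R →+* S) (N : ℕ) (A : ℕ → ℕ → R) :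
    g (cornerDet N A) = cornerDet N (fun s t => g (A s t)) := by
  unfold cornerDet
  rw [RingHom.map_det]
  rfl

theorem cornerDet_mem {N : ℕ} {A : ℕ → ℕ → R} (L : Subring R)
    (h : ∀ s t, s < N → t < N → A s t ∈ L) : cornerDet N A ∈ L := by
  unfold cornerDet
  rw [Matrix.det_apply]
  exact sum_mem fun σ _ => by
    rw [Units.smul_def]
    exact zsmul_mem (prod_mem fun i _ => h _ _ (σ i).2 i.2) _

/-- The difference of a determinant and of the contribution of its upper left corner is the
determinant with the corner replaced by zero. -/
theorem cornerDet_succ (N : ℕ) (A : ℕ → ℕ → R) :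
    cornerDet (N + 1) A = A 0 0 * cornerDet N (fun s t => A (s + 1) (t + 1))
      + cornerDet (N + 1) (fun s t => if s = 0 ∧ t = 0 then 0 else A s t) := by
  unfold cornerDet
  rw [Matrix.det_succ_row_zero, Matrix.det_succ_row_zero, Fin.sum_univ_succ, Fin.sum_univ_succ]
  simp only [Matrix.of_apply, Fin.val_zero, Fin.val_succ, pow_zero, one_mul, and_self, if_true,
    mul_zero, zero_mul, zero_add]
  congr 1

/-- A ring that contains a determinant and all of its entries but the corner contains the corner if
the cofactor of the corner is invertible. -/
theorem corner_mem {N : ℕ} {A : ℕ → ℕ → R} (L : Subring R)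
    (h : ∀ s t, s < N + 1 → t < N + 1 → ¬(s = 0 ∧ t = 0) → A s t ∈ L)
    (hdet : cornerDet (N + 1) A ∈ L) {u : R} (hu : u ∈ L)
    (hc : cornerDet N (fun s t => A (s + 1) (t + 1)) * u = 1) : A 0 0 ∈ L := by
  rw [cornerDet_succ] at hdet
  have h1 : cornerDet (N + 1) (fun s t => if s = 0 ∧ t = 0 then 0 else A s t) ∈ L :=
    cornerDet_mem L fun s t hs ht => by
      split_ifs with h0
      · exact zero_mem L
      · exact h s t hs ht h0
  have h2 := mul_mem ((add_mem_cancel_right h1).1 hdet) hu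
  rwa [mul_assoc, hc, mul_one] at h2

theorem cornerDet_of_col_zero {N : ℕ} {A : ℕ → ℕ → R} (h0 : A 0 0 = 1)
    (h : ∀ s, s < N → A (s + 1) 0 = 0) :
    cornerDet (N + 1) A = cornerDet N (fun s t => A (s + 1) (t + 1)) := by
  unfold cornerDet
  rw [Matrix.det_succ_column_zero, Fin.sum_univ_succ, Finset.sum_eq_zero]
  · simp only [Matrix.of_apply, Fin.val_zero, h0, pow_zero, one_mul, add_zero]
    rfl
  · intro i _
    simp [h i i.2]

theorem cornerDet_of_col_last {N : ℕ} {A : ℕ → ℕ → R} (h0 : A N N = 1)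
    (h : ∀ s, s < N → A s N = 0) : cornerDet (N + 1) A = cornerDet N A := by
  unfold cornerDet
  rw [Matrix.det_succ_column _ (Fin.last N), Finset.sum_eq_single (Fin.last N)]
  · simp only [Matrix.of_apply, Fin.val_last, h0, ← two_mul, pow_mul, neg_one_sq, one_pow, one_mul]
    congr 1
    ext s t
    simp
  · intro i _ hi
    have : i.1 < N := Fin.val_lt_last hi
    simp [h i this]
  · simp

/-- The rows `0, 2, 3, …`. -/
def skipOne (s : ℕ) : ℕ := if s = 0 then 0 else s + 1

theorem cornerDet_submatrix {N : ℕ} (A : ℕ → ℕ → R) (σ τ : Fin N → Fin (N + 1)) (f g : ℕ → ℕ)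
    (hf : ∀ s, (σ s).1 = f s) (hg : ∀ s, (τ s).1 = g s) :
    ((Matrix.of fun s t : Fin (N + 1) => A s t).submatrix σ τ).det
      = cornerDet N (fun s t => A (f s) (g t)) := by
  unfold cornerDet
  congr 1
  ext s t
  simp [hf, hg]

theorem val_succAbove_one {m : ℕ} (s : Fin (m + 1)) :
    ((1 : Fin (m + 2)).succAbove s).1 = skipOne s := by
  unfold skipOne
  by_cases h : s = 0
  · subst h; simp
  · have h' : s.1 ≠ 0 := fun h1 => h (Fin.ext h1)
    rw [Fin.succAbove_of_le_castSucc _ _ (by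
      rw [Fin.le_def]; simp; omega), if_neg h']
    simp

/-- The Desnanot-Jacobi identity for the first two rows and the first and the last column. -/
theorem desnanot_jacobi (m : ℕ) (A : ℕ → ℕ → R) :
    cornerDet (m + 2) A * cornerDet m (fun s t => A (s + 2) (t + 1))
      = cornerDet (m + 1) (fun s t => A (s + 1) (t + 1)) * cornerDet (m + 1) (fun s t => A (skipOne s) t)
        - cornerDet (m + 1) (fun s t => A (s + 1) t)
          * cornerDet (m + 1) (fun s t => A (skipOne s) (t + 1)) := by
  let B : Matrix (Fin (m + 2)) (Fin (m + 2)) R := Matrix.of fun s t => A s t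
  -- Inserting unit vectors for the first two rows in the first and the last column turns the
  -- Plücker relation into one between minors.
  have h := det_mul_det_updateCol_updateCol B (p := 0) (q := Fin.last (m + 1))
    (by simp [Fin.ext_iff]) (Pi.single 0 1) (Pi.single 1 1)
  rw [det_updateCol_single, det_updateCol_single, det_updateCol_single, det_updateCol_single,
    det_updateCol_single] at h
  have e0 : ∀ s : Fin (m + 1), ((0 : Fin (m + 2)).succAbove s).1 = s.1 + 1 := fun s => by simp
  have el : ∀ s : Fin (m + 1), ((Fin.last (m + 1)).succAbove s).1 = s.1 := fun s => by simp
  have h2 : ((B.updateCol 0 (Pi.single 0 1)).submatrix (Fin.succAbove 1)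
      (Fin.last (m + 1)).succAbove).det = cornerDet m (fun s t => A (s + 2) (t + 1)) := by
    have : ((B.updateCol 0 (Pi.single 0 1)).submatrix (Fin.succAbove 1)
        (Fin.last (m + 1)).succAbove).det = cornerDet (m + 1)
          (fun s t => if t = 0 then (if s = 0 then 1 else 0) else A (skipOne s) t) := by
      unfold cornerDet
      congr 1
      ext s t
      simp only [Matrix.submatrix_apply, Matrix.of_apply, Matrix.updateCol_apply]
      have ht : (Fin.last (m + 1)).succAbove t = 0 ↔ t.1 = 0 := by rw [Fin.ext_iff, el]; simp
      have hs : (Fin.succAbove 1 s = (0 : Fin (m + 2))) ↔ s.1 = 0 := by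
        rw [Fin.ext_iff, val_succAbove_one, skipOne]; split_ifs <;> simp_all
      by_cases h0 : t.1 = 0
      · rw [if_pos (ht.2 h0), if_pos h0, Pi.single_apply]
        simp only [hs]
      · rw [if_neg (fun h => h0 (ht.1 h)), if_neg h0]
        simp only [B, Matrix.of_apply, el, val_succAbove_one]
    rw [this, cornerDet_of_col_zero (by simp) (by simp)]
    exact cornerDet_congr fun s t _ _ => by simp [skipOne]
  rw [h2, cornerDet_submatrix A _ _ (· + 1) (· + 1) e0 e0,
    cornerDet_submatrix A _ _ skipOne (fun t => t) val_succAbove_one el,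
    cornerDet_submatrix A _ _ (· + 1) (fun t => t) e0 el,
    cornerDet_submatrix A _ _ skipOne (· + 1) val_succAbove_one e0] at h
  change cornerDet (m + 2) A * _ = _ at h
  simp only [Fin.val_zero, Fin.val_last, Fin.val_one, pow_add, pow_zero, pow_one, one_mul] at h
  have hs : ((-1 : R) ^ m) * (-1) ^ m = 1 := by rw [← mul_pow]; simp
  simp only [mul_one, mul_neg, neg_mul, one_mul, neg_neg] at h
  linear_combination (-1) ^ m * h - (cornerDet (m + 2) A * cornerDet m (fun s t => A (s + 2) (t + 1))
    - cornerDet (m + 1) (fun s t => A (s + 1) (t + 1)) * cornerDet (m + 1) (fun s t => A (skipOne s) t)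
    + cornerDet (m + 1) (fun s t => A (s + 1) t)
          * cornerDet (m + 1) (fun s t => A (skipOne s) (t + 1))) * hs

/-- Replacing the column `p` by a combination of the columns `p` and `q`. -/
theorem cornerDet_col_add {N : ℕ} {A B : ℕ → ℕ → R} {p q : ℕ} (hpq : p ≠ q) (hq : p < N → q < N)
    (c : R) (h : ∀ s t, s < N → t < N → B s t = A s t + if t = p then c * A s q else 0) :
    cornerDet N B = cornerDet N A := by
  by_cases hp : p < N
  · unfold cornerDet
    rw [← Matrix.det_updateCol_add_smul_self (Matrix.of fun s t : Fin N => A s t)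
      (i := ⟨p, hp⟩) (j := ⟨q, hq hp⟩) (by simpa using hpq) c]
    congr 1
    ext s t
    rw [Matrix.of_apply, h s t s.2 t.2, Matrix.updateCol_apply]
    simp only [Fin.ext_iff]
    split_ifs with h1
    · simp [h1]
    · simp
  · refine cornerDet_congr fun s t hs ht => ?_
    rw [h s t hs ht, if_neg (by omega), add_zero]

/-- The determinant is linear in the column `p`. -/
theorem cornerDet_col_linear {N p : ℕ} (hp : p < N) {A B C : ℕ → ℕ → R} (b c : R)
    (hB : ∀ s t, s < N → t < N → t ≠ p → B s t = A s t)
    (hC : ∀ s t, s < N → t < N → t ≠ p → C s t = A s t)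
    (h : ∀ s, s < N → A s p = b * B s p + c * C s p) :
    cornerDet N A = b * cornerDet N B + c * cornerDet N C := by
  unfold cornerDet
  let M : Matrix (Fin N) (Fin N) R := Matrix.of fun s t => A s t
  have e : ∀ D : ℕ → ℕ → R, (∀ s t, s < N → t < N → t ≠ p → D s t = A s t) →
      (Matrix.of fun s t : Fin N => D s t) = M.updateCol ⟨p, hp⟩ (fun s => D s p) := fun D hD => by
    ext s t
    rw [Matrix.updateCol_apply]
    split_ifs with h1
    · simp [h1]
    · exact hD s t s.2 t.2 fun h2 => h1 (Fin.ext h2)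
  rw [e A (fun _ _ _ _ _ => rfl), e B hB, e C hC]
  have : (fun s : Fin N => A s p) = b • (fun s : Fin N => B s p) + c • fun s : Fin N => C s p := by
    funext s; simp [h s s.2]
  rw [this, Matrix.det_updateCol_add, Matrix.det_updateCol_smul, Matrix.det_updateCol_smul]

end Corner

/-- The determinant of two square blocks, the last column of the first one and the column before
the first one of the second one being aligned. -/
theorem cornerDet_glue {K : Type} [Field K] {m r : ℕ} (hr : 0 < r) {A : ℕ → ℕ → K} {q v : ℕ → K}
    {τ : K} (h12 : ∀ s t, s < m → t < r → A s (m + t) = if t = 0 then q s else 0)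
    (h21 : ∀ s t, s < r → t < m → A (m + s) t = if t + 1 = m then v s else 0)
    (hD : cornerDet r (fun s t => A (m + s) (m + t)) ≠ 0)
    (hτ : τ * cornerDet r (fun s t => A (m + s) (m + t))
      = cornerDet r (fun s t => if t = 0 then v s else A (m + s) (m + t))) :
    cornerDet (m + r) A = cornerDet r (fun s t => A (m + s) (m + t))
      * cornerDet m (fun s t => A s t + if t + 1 = m then -τ * q s else 0) := by
  -- The determinant is computed by the Schur complement of `D`. The upper right block lives in its
  -- first column and the lower left block in its last, so the correction changes only column `m -
  -- 1`, by one entry of the inverse of `D` times `v`.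
  let D : Matrix (Fin r) (Fin r) K := Matrix.of fun s t => A (m + s) (m + t)
  have hD' : D.det ≠ 0 := hD
  have : Invertible D.det := invertibleOfNonzero hD'
  have : Invertible D := Matrix.invertibleOfDetInvertible D
  let P : Matrix (Fin m) (Fin m) K := Matrix.of fun s t => A s t
  let Q : Matrix (Fin m) (Fin r) K := Matrix.of fun s t => A s (m + t)
  let C : Matrix (Fin r) (Fin m) K := Matrix.of fun s t => A (m + s) t
  have h1 : cornerDet (m + r) A = (Matrix.fromBlocks P Q C D).det := by
    unfold cornerDet
    rw [← Matrix.det_submatrix_equiv_self finSumFinEquiv]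
    congr 1
    ext s t
    rcases s with s | s <;> rcases t with t | t <;> simp [P, Q, C, D]
  let z : Fin r := ⟨0, hr⟩
  -- Cramer's rule identifies this entry as the quotient of determinants given by `hτ`.
  have hw : (D⁻¹.mulVec fun s => v s) z = τ := by
    have h2 := congrFun (Matrix.det_smul_inv_mulVec_eq_cramer D (fun s => v s)
      (isUnit_iff_ne_zero.2 hD')) z
    rw [Pi.smul_apply, smul_eq_mul, Matrix.cramer_apply] at h2
    apply mul_left_cancel₀ hD'
    rw [h2, mul_comm]
    refine Eq.trans ?_ hτ.symm
    unfold cornerDet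
    congr 1
    ext s t
    rw [Matrix.updateCol_apply]
    simp only [z, Fin.ext_iff, Matrix.of_apply, D]
  rw [h1, Matrix.det_fromBlocks₂₂, Matrix.invOf_eq_nonsing_inv]
  change D.det * _ = D.det * _
  congr 1
  unfold cornerDet
  congr 1
  ext s t
  rw [Matrix.sub_apply, Matrix.mul_assoc, Matrix.mul_apply, Finset.sum_eq_single z]
  · have h3 : Q s z = q s := by simpa [Q, z] using h12 s 0 s.2 hr
    rw [h3, Matrix.mul_apply]
    simp only [C, P, Matrix.of_apply]
    by_cases ht : t.1 + 1 = m
    · rw [if_pos ht, ← hw]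
      simp only [Matrix.mulVec, dotProduct]
      rw [Finset.sum_congr rfl fun x _ => by rw [h21 x t x.2 t.2, if_pos ht]]
      ring
    · rw [if_neg ht, Finset.sum_eq_zero fun x _ => by rw [h21 x t x.2 t.2, if_neg ht, mul_zero]]
      ring
  · intro b _ hb
    have h3 : Q s b = 0 := by
      simp only [Q, Matrix.of_apply]
      rw [h12 s b s.2 b.2, if_neg fun h => hb (Fin.ext h)]
    rw [h3, zero_mul]
  · simp

/-! ### Standard minors and gauge transformations -/

section Minors

variable {R : Type} [CommRing R]

/-- The maximal contiguous minor of the array `x` in rows and columns `[1, n]` with upper left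
corner `(i, j)`. -/
def stdMinor (n : ℕ) (x : ℕ → ℕ → R) (i j : ℕ) : R :=
  cornerDet (n + 1 - max i j) (fun s t => x (i + s) (j + t))

/-- The minor with rows `[1, n - β]` and columns `β, β + 2, …, n`. -/
def skipMinor (n β : ℕ) (x : ℕ → ℕ → R) : R :=
  cornerDet (n - β) (fun s t => x (1 + s) (β + skipOne t))

/-- The multiple `c` of the row `β + 1` is added to the row `β`. -/
def rowOp (β : ℕ) (c : R) (x : ℕ → ℕ → R) (i j : ℕ) : R :=
  x i j + if i = β then c * x (i + 1) j else 0

/-- The multiple `c` of the column `α + 1` is added to the column `α`. -/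
def colOp (α : ℕ) (c : R) (x : ℕ → ℕ → R) (i j : ℕ) : R :=
  x i j + if j = α then c * x i (j + 1) else 0

/-- The transposed array. -/
def tr (x : ℕ → ℕ → R) (i j : ℕ) : R := x j i

theorem tr_tr (x : ℕ → ℕ → R) : tr (tr x) = x := rfl

theorem tr_rowOp (β : ℕ) (c : R) (x : ℕ → ℕ → R) : tr (rowOp β c x) = colOp β c (tr x) := rfl

theorem tr_colOp (α : ℕ) (c : R) (x : ℕ → ℕ → R) : tr (colOp α c x) = rowOp α c (tr x) := rfl

theorem rowOp_colOp (α β : ℕ) (c d : R) (x : ℕ → ℕ → R) :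
    rowOp β c (colOp α d x) = colOp α d (rowOp β c x) := by
  funext i j
  unfold rowOp colOp
  by_cases hi : i = β <;> by_cases hj : j = α <;> simp only [hi, hj, if_true, if_false] <;> ring

theorem rowOp_rowOp (β : ℕ) (c d : R) (x : ℕ → ℕ → R) :
    rowOp β c (rowOp β d x) = rowOp β (c + d) x := by
  funext i j
  unfold rowOp
  split_ifs
  · omega
  · ring
  · ring

theorem rowOp_zero (β : ℕ) (x : ℕ → ℕ → R) : rowOp β 0 x = x := by
  funext i j; simp [rowOp]

theorem colOp_colOp (α : ℕ) (c d : R) (x : ℕ → ℕ → R) :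
    colOp α c (colOp α d x) = colOp α (c + d) x := by
  rw [← tr_tr (colOp _ _ _), tr_colOp, tr_colOp, rowOp_rowOp, tr_rowOp, tr_tr]

theorem colOp_zero (α : ℕ) (x : ℕ → ℕ → R) : colOp α 0 x = x := by
  funext i j; simp [colOp]

theorem stdMinor_tr (n : ℕ) (x : ℕ → ℕ → R) (i j : ℕ) :
    stdMinor n (tr x) j i = stdMinor n x i j := by
  rw [stdMinor, stdMinor, ← cornerDet_transpose, max_comm]
  rfl

theorem stdMinor_eq_one {n : ℕ} (x : ℕ → ℕ → R) {i j : ℕ} (h : n < max i j) :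
    stdMinor n x i j = 1 := by
  rw [stdMinor, Nat.sub_eq_zero_of_le (by omega), cornerDet_zero]

/-- The row operation is invisible to a minor that misses row `β` or contains row `β + 1` as well.
The excluded diagonal consists of the minors whose last row is `β`. -/
theorem stdMinor_rowOp {n β : ℕ} (hβ : β < n) (c : R) (x : ℕ → ℕ → R) {i j : ℕ}
    (h : j + β ≠ n + i) : stdMinor n (rowOp β c x) i j = stdMinor n x i j := by
  unfold stdMinor
  by_cases hi : i ≤ β
  · rw [← cornerDet_transpose, ← cornerDet_transpose _ (fun s t => x (i + s) (j + t))]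
    refine cornerDet_col_add (p := β - i) (q := β - i + 1) (by omega) (by omega) c
      fun s t hs ht => ?_
    unfold rowOp
    congr 1
    by_cases h1 : i + t = β
    · rw [if_pos h1, if_pos (by omega), show i + t + 1 = i + (β - i + 1) by omega]
    · rw [if_neg h1, if_neg (by omega)]
  · refine cornerDet_congr fun s t _ _ => ?_
    rw [rowOp, if_neg (by omega), add_zero]

theorem stdMinor_colOp {n α : ℕ} (hα : α < n) (c : R) (x : ℕ → ℕ → R) {i j : ℕ}
    (h : i + α ≠ n + j) : stdMinor n (colOp α c x) i j = stdMinor n x i j := by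
  rw [← stdMinor_tr, tr_colOp, stdMinor_rowOp hα c _ h, stdMinor_tr]

/-- Column `β + 1` is skipped, but column `α` only occurs for `α > β + 1`, and then column `α + 1`
occurs too. -/
theorem skipMinor_colOp {n α β : ℕ} (hα : α < n) (hαβ : α ≠ β) (c : R)
    (x : ℕ → ℕ → R) : skipMinor n β (colOp α c x) = skipMinor n β x := by
  unfold skipMinor
  by_cases h : β + 1 < α
  · refine cornerDet_col_add (p := α - β - 1) (q := α - β) (by omega) (by omega) c
      fun s t hs ht => ?_
    unfold colOp skipOne
    congr 1
    by_cases h0 : t = 0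
    · rw [if_pos h0, if_neg (by omega), if_neg (by omega)]
    · rw [if_neg h0, if_neg (by omega : ¬ α - β = 0)]
      by_cases h1 : β + (t + 1) = α
      · rw [if_pos h1, if_pos (by omega), show β + (t + 1) + 1 = β + (α - β + 1) by omega]
      · rw [if_neg h1, if_neg (by omega)]
  · refine cornerDet_congr fun s t _ _ => ?_
    rw [colOp, if_neg, add_zero]
    unfold skipOne
    split_ifs <;> omega

/-- For `n = 2 * β` the last row of this minor would be `β`, and the row operation would no longer
be invisible. -/
theorem skipMinor_rowOp {n β : ℕ} (hn : n ≠ 2 * β) (c : R) (x : ℕ → ℕ → R) :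
    skipMinor n β (rowOp β c x) = skipMinor n β x := by
  unfold skipMinor
  by_cases hi : 1 ≤ β
  · rw [← cornerDet_transpose, ← cornerDet_transpose _ (fun s t => x (1 + s) (β + skipOne t))]
    refine cornerDet_col_add (p := β - 1) (q := β) (by omega) (by omega) c
      fun s t hs ht => ?_
    unfold rowOp
    congr 1
    by_cases h1 : 1 + t = β
    · rw [if_pos h1, if_pos (by omega), show 1 + t + 1 = 1 + β by omega]
    · rw [if_neg h1, if_neg (by omega)]
  · refine cornerDet_congr fun s t _ _ => ?_
    rw [rowOp, if_neg (by omega), add_zero]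

/-- The functions `f_ij` are the standard minors. -/
theorem f_eq_stdMinor {n : ℕ} (X : Matrix (Fin n) (Fin n) R) {i j : ℕ} (hi : i ≤ n) (hj : j ≤ n) :
    f X i j = stdMinor n (entry X) i j := by
  unfold f stdMinor
  split_ifs with h
  · rw [show n + 1 - max i j = n - j + 1 by omega]
    refine cornerDet_congr fun s t hs ht => ?_
    rw [block, if_pos (by omega)]; simp
  · rw [show n + 1 - max i j = n - i + 1 by omega]
    refine cornerDet_congr fun s t hs ht => ?_
    rw [block, if_pos (by omega)]; simp

theorem entry_transpose {n : ℕ} (X : Matrix (Fin n) (Fin n) R) :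
    entry X.transpose = tr (entry X) := by
  funext i j
  unfold entry tr
  simp only [and_comm, Matrix.transpose_apply]

theorem block_transpose {n : ℕ} (X : Matrix (Fin n) (Fin n) R) (r r' c c' p q s t : ℕ) :
    block X.transpose c c' r r' q p t s = block X r r' c c' p q s t := by
  unfold block
  rw [entry_transpose, tr]
  simp only [and_comm]

theorem psi_eq_theta {n : ℕ} (X : Matrix (Fin n) (Fin n) R) (α β i j : ℕ) :
    psi X α β i j = theta X.transpose β α j i := by
  unfold psi theta
  split_ifs
  · rw [← cornerDet_transpose]
    refine cornerDet_congr fun s t _ _ => ?_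
    simp only [Pi.add_apply, block_transpose]
  · rw [← cornerDet_transpose]
    refine cornerDet_congr fun s t _ _ => ?_
    simp only [Pi.add_apply, block_transpose]

/-- Transposition exchanges `α` with `β` and the two exceptional diagonals. To exploit this
symmetry, the lemmas on gauges assume `α ≠ β` instead of `α < β`. -/
theorem phi_transpose {n : ℕ} (X : Matrix (Fin n) (Fin n) R) {α β i j : ℕ} (hα : α < n)
    (hβ : β < n) (hi : i ≤ n) (hj : j ≤ n) : phi X.transpose β α j i = phi X α β i j := by
  have e : ∀ i j, theta X α β i j = psi X.transpose β α j i := fun i j => by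
    rw [psi_eq_theta, Matrix.transpose_transpose]
  unfold phi
  by_cases h1 : i + α = n + j
  · rw [if_neg (by omega), if_pos h1, if_pos h1, e]
  by_cases h2 : j + β = n + i
  · rw [if_pos h2, if_neg h1, if_pos h2, psi_eq_theta]
  · rw [if_neg h2, if_neg h1, if_neg h1, if_neg h2, f_eq_stdMinor _ hj hi, f_eq_stdMinor _ hi hj,
      entry_transpose, stdMinor_tr]

end Minors

/-! ### Gluing of blocks as a column operation -/

section Theta

variable {K : Type} [Field K] {n α β : ℕ} {X : Matrix (Fin n) (Fin n) K}

/-- The determinant of the columns `j, …, α + 1` of the last rows of `x` and of the columns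
`β, …, n` of the first `n - β` rows of `z`, the columns `α, α + 1` of the former being continued by
the columns `β, β + 1` of the latter. -/
theorem cornerDet_theta {x z A : ℕ → ℕ → K} {m i j : ℕ} (hm : m = n + 1 - i) (hα : α < n)
    (hβ : β < n) (hi : i ≤ n) (hij : i + α = n + j) {τ : K}
    (hA1 : ∀ s t, s < m → t < m + (n - β) → A s t = if t ≤ m then x (i + s) (j + t) else 0)
    (hA2 : ∀ s t, s < n - β → t < m + (n - β) →
      A (m + s) t = if m ≤ t + 1 then z (1 + s) (β + (t + 1 - m)) else 0)
    (hB : stdMinor n z 1 (β + 1) ≠ 0)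
    (hτ : τ * stdMinor n z 1 (β + 1) = skipMinor n β z) :
    cornerDet (m + (n - β)) A = stdMinor n z 1 (β + 1) * stdMinor n (colOp α (-τ) x) i j := by
  have hBe : stdMinor n z 1 (β + 1) = cornerDet (n - β) (fun s t => z (1 + s) (β + 1 + t)) := by
    rw [stdMinor, show n + 1 - max 1 (β + 1) = n - β by omega]
  have hA : ∀ s t, s < n - β → t < n - β → A (m + s) (m + t) = z (1 + s) (β + 1 + t) :=
    fun s t hs ht => by
      rw [hA2 s _ hs (by omega), if_pos (by omega)]
      congr 1; omega
  have hAd : cornerDet (n - β) (fun s t => A (m + s) (m + t)) = stdMinor n z 1 (β + 1) := by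
    rw [hBe]; exact cornerDet_congr hA
  rw [cornerDet_glue (m := m) (r := n - β) (by omega) (τ := τ)
    (q := fun s => x (i + s) (α + 1)) (v := fun s => z (1 + s) β)
    (fun s t hs ht => by
      rw [hA1 s _ hs (by omega)]
      by_cases ht : t = 0
      · rw [if_pos (by omega), if_pos ht]; congr 1; omega
      · rw [if_neg (by omega), if_neg ht])
    (fun s t hs ht => by
      rw [hA2 s _ hs (by omega)]
      by_cases ht : t + 1 = m
      · rw [if_pos (by omega), if_pos ht]; congr 1; omega
      · rw [if_neg (by omega), if_neg ht])
    (hAd ▸ hB)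
    (by
      rw [hAd, hτ, skipMinor]
      refine cornerDet_congr fun s t hs ht => ?_
      unfold skipOne
      by_cases h0 : t = 0
      · simp [h0]
      · rw [if_neg h0, if_neg h0, hA s t hs ht]; congr 1; omega), hAd]
  congr 1
  rw [stdMinor, show n + 1 - max i j = m by omega]
  refine cornerDet_congr fun s t hs ht => ?_
  rw [hA1 s _ hs (by omega), if_pos (by omega), colOp]
  congr 1
  by_cases h0 : t + 1 = m
  · rw [if_pos h0, if_pos (by omega)]; congr 2; omega
  · rw [if_neg h0, if_neg (by omega)]

/-- Eliminating the lower block splits off its determinant and subtracts `τ` times column `α + 1`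
from column `α` in the upper block. -/
theorem theta_of_ne (hα : α < n) (hβ : β < n) (hn : n ≠ 2 * β) {i j : ℕ}
    (hi : i ≤ n) (hij : i + α = n + j) {τ : K} (hB : stdMinor n (entry X) 1 (β + 1) ≠ 0)
    (hτ : τ * stdMinor n (entry X) 1 (β + 1) = skipMinor n β (entry X)) :
    theta X α β i j
      = stdMinor n (entry X) 1 (β + 1) * stdMinor n (colOp α (-τ) (entry X)) i j := by
  rw [theta, if_neg hn]
  refine cornerDet_theta (x := entry X) (by omega) hα hβ hi hij (fun s t hs ht => ?_)
    (fun s t hs ht => ?_) hB hτ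
  · simp only [Pi.add_apply, block]
    rw [if_neg (by omega : ¬ ((n - i + 1 ≤ s ∧ _) ∧ _)), add_zero]
    by_cases ht : t ≤ n - i + 1
    · rw [if_pos (by omega), if_pos ht]; simp
    · rw [if_neg (by omega), if_neg ht]
  · simp only [Pi.add_apply, block]
    rw [if_neg (by omega : ¬ ((0 ≤ n - i + 1 + s ∧ _) ∧ _)), zero_add]
    by_cases ht : n - i + 1 ≤ t + 1
    · rw [if_pos (by omega), if_pos ht]; congr 1 <;> omega
    · rw [if_neg (by omega), if_neg ht]

/-- The third block is eliminated first, in the transposed array. This removes row `β + 1` of the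
second block and subtracts `σ` times it from row `β`; the remaining two blocks are glued as before.
-/
theorem theta_of_eq (hα : α < n) (hβ : β < n) (hn : n = 2 * β) {i j : ℕ}
    (hi : i ≤ n) (hij : i + α = n + j) {σ τ : K} (hA : stdMinor n (entry X) (α + 1) 1 ≠ 0)
    (hσ : σ * stdMinor n (entry X) (α + 1) 1 = skipMinor n α (tr (entry X)))
    (hB : stdMinor n (rowOp β (-σ) (entry X)) 1 (β + 1) ≠ 0)
    (hτ : τ * stdMinor n (rowOp β (-σ) (entry X)) 1 (β + 1)
      = skipMinor n β (rowOp β (-σ) (entry X))) :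
    theta X α β i j = stdMinor n (entry X) (α + 1) 1
      * stdMinor n (rowOp β (-σ) (entry X)) 1 (β + 1)
      * stdMinor n (colOp α (-τ) (entry X)) i j := by
  have hAe : stdMinor n (entry X) (α + 1) 1
      = cornerDet (n - α) (fun s t => entry X (α + 1 + t) (1 + s)) := by
    rw [stdMinor, show n + 1 - max (α + 1) 1 = n - α by omega, ← cornerDet_transpose]
  let A : ℕ → ℕ → K := fun t s => (block X i n j (α + 1) 0 0
        + block X 1 (β + 1) β n (n - i + 1) (n - i)
        + block X α n 1 (n - α) (n - i + β) (n - i + (n - β + 1))) s t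
  have hAA : ∀ s t, s < n - α → t < n - α →
      A (n - i + 1 + (n - β) + s) (n - i + 1 + (n - β) + t) = entry X (α + 1 + t) (1 + s) :=
    fun s t hs ht => by
      simp only [A, Pi.add_apply, block]
      rw [if_neg (by omega), if_neg (by omega), if_pos (by omega), zero_add, zero_add]
      congr 1 <;> omega
  have hAd : cornerDet (n - α) (fun s t => A (n - i + 1 + (n - β) + s) (n - i + 1 + (n - β) + t))
      = stdMinor n (entry X) (α + 1) 1 := by
    rw [hAe]; exact cornerDet_congr hAA
  rw [theta, if_pos hn, ← cornerDet_transpose]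
  change cornerDet _ A = _
  rw [cornerDet_glue (m := n - i + 1 + (n - β)) (r := n - α) (by omega) (τ := σ)
    (q := fun s => if n - i ≤ s then entry X (β + 1) (β + (s - (n - i))) else 0)
    (v := fun s => entry X α (1 + s))
    (fun s t hs ht => by
      simp only [A, Pi.add_apply, block]
      rw [if_neg (by omega), if_neg (by omega : ¬ ((n - i + β ≤ n - i + 1 + (n - β) + t ∧ _) ∧ _)),
        add_zero, zero_add]
      by_cases ht : t = 0
      · by_cases hs : n - i ≤ s
        · rw [if_pos (by omega), if_pos ht, if_pos hs]; congr 1; omega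
        · rw [if_neg (by omega), if_pos ht, if_neg hs]
      · rw [if_neg (by omega), if_neg ht])
    (fun s t hs ht => by
      simp only [A, Pi.add_apply, block]
      rw [if_neg (by omega : ¬ ((0 ≤ t ∧ _) ∧ _)),
        if_neg (by omega : ¬ ((n - i + 1 ≤ t ∧ _) ∧ _)), zero_add, zero_add]
      by_cases ht : t + 1 = n - i + 1 + (n - β)
      · rw [if_pos (by omega), if_pos ht]; congr 1 <;> omega
      · rw [if_neg (by omega), if_neg ht])
    (hAd ▸ hA)
    (by
      rw [hAd, hσ, skipMinor]
      refine cornerDet_congr fun s t hs ht => ?_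
      unfold skipOne tr
      by_cases h0 : t = 0
      · simp [h0]
      · rw [if_neg h0, if_neg h0, hAA s t hs ht]; congr 1; omega), hAd, mul_assoc]
  congr 1
  rw [← cornerDet_transpose]
  refine cornerDet_theta (x := entry X) (by omega) hα hβ hi hij (fun s t hs ht => ?_)
    (fun s t hs ht => ?_) hB hτ
  · simp only [A, Pi.add_apply, block]
    rw [if_neg (by omega : ¬ ((n - i + 1 ≤ s ∧ _) ∧ _)),
      if_neg (by omega : ¬ ((n - i + β ≤ s ∧ _) ∧ _)), if_neg (by omega : ¬ s + 1 = _),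
      add_zero, add_zero, add_zero]
    by_cases ht : t ≤ n - i + 1
    · rw [if_pos (by omega), if_pos ht]; simp
    · rw [if_neg (by omega), if_neg ht]
  · simp only [A, Pi.add_apply, block, rowOp]
    rw [if_neg (by omega : ¬ ((0 ≤ n - i + 1 + s ∧ _) ∧ _)),
      if_neg (by omega : ¬ ((n - i + β ≤ n - i + 1 + s ∧ _) ∧ _)), zero_add, add_zero]
    by_cases ht : n - i + 1 ≤ t + 1
    · rw [if_pos (by omega), if_pos ht]
      congr 1
      · congr 1 <;> omega
      · by_cases hs : 1 + s = β
        · rw [if_pos (by omega), if_pos hs, if_pos (by omega)]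
          congr 2 <;> omega
        · rw [if_neg (by omega), if_neg hs]
    · rw [if_neg (by omega), if_neg ht, if_neg (by omega : ¬ n - i ≤ t), mul_zero, ite_self,
        add_zero]

end Theta
-- Cluster functions as standard minors of a transformed matrix
section Gauge

variable {K : Type} [Field K] {n α β : ℕ}

/-- The array `x` is obtained from `y` by the row operation and the column operation that turn the
standard minors into the functions `φ_ij`, up to factors. -/
structure IsGauge (n α β : ℕ) (x y : ℕ → ℕ → K) (s t : K) : Prop where
  eq : x = rowOp β s (colOp α t y)
  row_ne_zero : stdMinor n y (α + 1) 1 ≠ 0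
  col_ne_zero : stdMinor n y 1 (β + 1) ≠ 0
  row_eq : s * stdMinor n y (α + 1) 1 = skipMinor n α (tr y)
  col_eq : t * stdMinor n y 1 (β + 1) = skipMinor n β y

variable {X : Matrix (Fin n) (Fin n) K} {x y : ℕ → ℕ → K} {s t : K}

theorem IsGauge.transpose (h : IsGauge n α β x y s t) : IsGauge n β α (tr x) (tr y) t s where
  eq := by rw [h.eq, tr_rowOp, tr_colOp, rowOp_colOp]
  row_ne_zero := by rw [stdMinor_tr]; exact h.col_ne_zero
  col_ne_zero := by rw [stdMinor_tr]; exact h.row_ne_zero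
  row_eq := by rw [stdMinor_tr]; exact h.col_eq
  col_eq := by rw [stdMinor_tr]; exact h.row_eq

theorem IsGauge.colOp_neg (h : IsGauge n α β x y s t) : colOp α (-t) x = rowOp β s y := by
  rw [h.eq, ← rowOp_colOp, colOp_colOp, neg_add_cancel, colOp_zero]

theorem IsGauge.rowOp_neg (h : IsGauge n α β x y s t) : rowOp β (-s) x = colOp α t y := by
  rw [h.eq, rowOp_rowOp, neg_add_cancel, rowOp_zero]

theorem IsGauge.stdMinor_eq (h : IsGauge n α β x y s t) (hα : α < n) (hβ : β < n) {i j : ℕ}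
    (h1 : i + α ≠ n + j) (h2 : j + β ≠ n + i) : stdMinor n x i j = stdMinor n y i j := by
  rw [h.eq, stdMinor_rowOp hβ _ _ h2, stdMinor_colOp hα _ _ h1]

theorem phi_of_ne {X : Matrix (Fin n) (Fin n) K} {i j : ℕ} (hi : i ≤ n) (hj : j ≤ n)
    (h1 : i + α ≠ n + j) (h2 : j + β ≠ n + i) : phi X α β i j = stdMinor n (entry X) i j := by
  rw [phi, if_neg h1, if_neg h2, f_eq_stdMinor X hi hj]

theorem IsGauge.phi_of_ne (h : IsGauge n α β (entry X) y s t) (hα : α < n) (hβ : β < n) {i j : ℕ}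
    (hi : i ≤ n) (hj : j ≤ n) (h1 : i + α ≠ n + j) (h2 : j + β ≠ n + i) :
    phi X α β i j = stdMinor n y i j := by
  rw [ExoticSL.phi_of_ne hi hj h1 h2, h.stdMinor_eq hα hβ h1 h2]

/-- The value of `φ` at `(1, β + 1)` if this is on the diagonal of the functions `ψ`. -/
theorem phi_one_of_eq (hα : α < n) (hαβ : α ≠ β) (hβ : β < n) (hn : n = 2 * β) {σ : K}
    (hA : stdMinor n (entry X) (α + 1) 1 ≠ 0)
    (hσ : σ * stdMinor n (entry X) (α + 1) 1 = skipMinor n α (tr (entry X))) :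
    phi X α β 1 (β + 1) = stdMinor n (entry X) (α + 1) 1
      * stdMinor n (rowOp β (-σ) (entry X)) 1 (β + 1) := by
  rw [phi, if_neg (by omega), if_pos (by omega), psi_eq_theta,
    theta_of_ne hβ hα (by omega) (by omega) (by omega) (τ := σ)
      (by rwa [entry_transpose, stdMinor_tr]) (by rwa [entry_transpose, stdMinor_tr]),
    entry_transpose, stdMinor_tr, ← tr_rowOp, stdMinor_tr]

/-- On this diagonal the gluing undoes the column operation of the gauge, and the row operation that
remains does not affect the minor. If `n = 2 * β`, the third block accounts for `(1, β + 1)` lying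
on the other exceptional diagonal. -/
theorem IsGauge.phi_theta (h : IsGauge n α β (entry X) y s t) (hα : α < n) (hαβ : α ≠ β)
    (hβ : β < n) {i j : ℕ} (hi : i ≤ n) (hij : i + α = n + j) :
    phi X α β i j = phi X α β 1 (β + 1) * stdMinor n y i j := by
  have h2 : stdMinor n (colOp α (-t) (entry X)) i j = stdMinor n y i j := by
    rw [h.colOp_neg, stdMinor_rowOp hβ _ _ (by omega)]
  by_cases hn : n = 2 * β
  · have hA : stdMinor n (entry X) (α + 1) 1 = stdMinor n y (α + 1) 1 :=
      h.stdMinor_eq hα hβ (by omega) (by omega)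
    have hs : s * stdMinor n (entry X) (α + 1) 1 = skipMinor n α (tr (entry X)) := by
      rw [hA, h.row_eq, h.eq, tr_rowOp, tr_colOp, skipMinor_colOp hβ hαβ.symm,
        skipMinor_rowOp (by omega)]
    have hB : stdMinor n (rowOp β (-s) (entry X)) 1 (β + 1) = stdMinor n y 1 (β + 1) := by
      rw [h.rowOp_neg, stdMinor_colOp hα _ _ (by omega)]
    rw [phi_one_of_eq hα hαβ hβ hn (hA ▸ h.row_ne_zero) hs, phi, if_pos hij,
      theta_of_eq hα hβ hn hi hij (hA ▸ h.row_ne_zero) hs (hB ▸ h.col_ne_zero) (τ := t)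
        (by rw [hB, h.col_eq, h.rowOp_neg, skipMinor_colOp hα hαβ]), h2]
  · have hB : stdMinor n (entry X) 1 (β + 1) = stdMinor n y 1 (β + 1) :=
      h.stdMinor_eq hα hβ (by omega) (by omega)
    rw [ExoticSL.phi_of_ne (i := 1) (by omega) (by omega) (by omega) (by omega), phi, if_pos hij,
      theta_of_ne hα hβ hn hi hij (τ := t) (hB ▸ h.col_ne_zero)
        (by rw [hB, h.col_eq, h.eq, skipMinor_rowOp hn, skipMinor_colOp hα hαβ]), h2]

theorem IsGauge.phi_psi (h : IsGauge n α β (entry X) y s t) (hα : α < n) (hαβ : α ≠ β)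
    (hβ : β < n) {i j : ℕ} (hi : i ≤ n) (hj : j ≤ n) (hij : j + β = n + i) :
    phi X α β i j = phi X α β (α + 1) 1 * stdMinor n y i j := by
  have h1 := h.transpose
  rw [← entry_transpose] at h1
  have := h1.phi_theta hβ hαβ.symm hα hj hij
  rwa [phi_transpose X hα hβ hi hj, phi_transpose X hα hβ (by omega) (by omega), stdMinor_tr]
    at this

/-- For `n ≠ 2 * α` the column operation does not change the minors that define `s`. So `s` can be
read off from `X`, the row operation undone, and `t` read off from the result. The excluded case
follows by transposition. -/
theorem exists_isGauge_of_ne (hα : α < n) (hαβ : α ≠ β) (hβ : β < n) (hn : n ≠ 2 * α)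
    (hA : phi X α β (α + 1) 1 ≠ 0) (hB : phi X α β 1 (β + 1) ≠ 0) :
    ∃ y s t, IsGauge n α β (entry X) y s t := by
  rw [phi_of_ne (by omega) (by omega) (by omega) (by omega)] at hA
  let s : K := skipMinor n α (tr (entry X)) / stdMinor n (entry X) (α + 1) 1
  have hs : s * stdMinor n (entry X) (α + 1) 1 = skipMinor n α (tr (entry X)) :=
    div_mul_cancel₀ _ hA
  let z := rowOp β (-s) (entry X)
  have hz : stdMinor n z 1 (β + 1) ≠ 0 := by
    by_cases hn' : n = 2 * β
    · rw [phi_one_of_eq hα hαβ hβ hn' hA hs] at hB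
      exact right_ne_zero_of_mul hB
    · rw [phi_of_ne (by omega) (by omega) (by omega) (by omega)] at hB
      simp only [z]
      rwa [stdMinor_rowOp hβ _ _ (by omega)]
  let t : K := skipMinor n β z / stdMinor n z 1 (β + 1)
  have ht : t * stdMinor n z 1 (β + 1) = skipMinor n β z := div_mul_cancel₀ _ hz
  have hzA : stdMinor n (colOp α (-t) z) (α + 1) 1 = stdMinor n (entry X) (α + 1) 1 := by
    rw [stdMinor_colOp hα _ _ (by omega), stdMinor_rowOp hβ _ _ (by omega)]
  have hzB : stdMinor n (colOp α (-t) z) 1 (β + 1) = stdMinor n z 1 (β + 1) := by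
    rw [stdMinor_colOp hα _ _ (by omega)]
  refine ⟨colOp α (-t) z, s, t, ?_, ?_, ?_, ?_, ?_⟩
  · rw [colOp_colOp, add_neg_cancel, colOp_zero, rowOp_rowOp, add_neg_cancel, rowOp_zero]
  · rwa [hzA]
  · rwa [hzB]
  · rw [hzA, hs, tr_colOp, skipMinor_rowOp hn, tr_rowOp, skipMinor_colOp hβ hαβ.symm]
  · rw [hzB, ht, skipMinor_colOp hα hαβ]

theorem exists_isGauge (hα : α < n) (hαβ : α ≠ β) (hβ : β < n)
    (hA : phi X α β (α + 1) 1 ≠ 0) (hB : phi X α β 1 (β + 1) ≠ 0) :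
    ∃ y s t, IsGauge n α β (entry X) y s t := by
  by_cases hn : n = 2 * α
  · obtain ⟨y, s, t, h⟩ := exists_isGauge_of_ne (X := X.transpose) hβ hαβ.symm hα (by omega)
      (by rwa [phi_transpose X hα hβ (by omega) (by omega)])
      (by rwa [phi_transpose X hα hβ (by omega) (by omega)])
    have := h.transpose
    rw [entry_transpose, tr_tr] at this
    exact ⟨_, _, _, this⟩
  · exact exists_isGauge_of_ne hα hαβ hβ hn hA hB

theorem IsGauge.phi_one (h : IsGauge n α β (entry X) y s t) (hα : α < n) (hαβ : α ≠ β)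
    (hβ : β < n) : phi X α β 1 (β + 1)
      = (if n = 2 * β then phi X α β (α + 1) 1 else 1) * stdMinor n y 1 (β + 1) := by
  split_ifs with hn
  · exact h.phi_psi hα hαβ hβ (by omega) (by omega) (by omega)
  · rw [one_mul]
    exact h.phi_of_ne hα hβ (by omega) (by omega) (by omega) (by omega)

theorem IsGauge.phi_row_one (h : IsGauge n α β (entry X) y s t) (hα : α < n) (hαβ : α ≠ β)
    (hβ : β < n) : phi X α β (α + 1) 1
      = (if n = 2 * α then phi X α β 1 (β + 1) else 1) * stdMinor n y (α + 1) 1 := by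
  split_ifs with hn
  · exact h.phi_theta hα hαβ hβ (by omega) (by omega)
  · rw [one_mul]
    exact h.phi_of_ne hα hβ (by omega) (by omega) (by omega) (by omega)

/-- At most one of the two functions can have the other as a factor, since `n = 2 * α` and `n = 2 *
β` exclude each other; the independent one is treated first. -/
theorem IsGauge.phi_ne_zero (h : IsGauge n α β (entry X) y s t) (hα : α < n) (hαβ : α ≠ β)
    (hβ : β < n) : phi X α β (α + 1) 1 ≠ 0 ∧ phi X α β 1 (β + 1) ≠ 0 := by
  by_cases hn : n = 2 * β
  · have h1 : phi X α β (α + 1) 1 ≠ 0 := by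
      rw [h.phi_row_one hα hαβ hβ, if_neg (by omega), one_mul]
      exact h.row_ne_zero
    refine ⟨h1, ?_⟩
    rw [h.phi_one hα hαβ hβ, if_pos hn]
    exact mul_ne_zero h1 h.col_ne_zero
  · have h1 : phi X α β 1 (β + 1) ≠ 0 := by
      rw [h.phi_one hα hαβ hβ, if_neg hn, one_mul]
      exact h.col_ne_zero
    refine ⟨?_, h1⟩
    rw [h.phi_row_one hα hαβ hβ]
    split_ifs
    · exact mul_ne_zero h1 h.row_ne_zero
    · rw [one_mul]; exact h.row_ne_zero

/-- The factor by which `φ_ij` differs from a standard minor. -/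
def gaugeFactor (n α β : ℕ) (a b : K) (i j : ℕ) : K :=
  (if i + α = n + j then b else 1) * if j + β = n + i then a else 1

/-- The exceptional diagonals are disjoint, and off both of them the row and the column operation
preserve the trailing minors. -/
theorem IsGauge.phi_eq (h : IsGauge n α β (entry X) y s t) (hα : α < n) (hαβ : α ≠ β)
    (hβ : β < n) {i j : ℕ} (hi : i ≤ n) (hj : j ≤ n) :
    phi X α β i j = gaugeFactor n α β (phi X α β (α + 1) 1) (phi X α β 1 (β + 1)) i j
      * stdMinor n y i j := by
  unfold gaugeFactor
  by_cases h1 : i + α = n + j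
  · rw [if_pos h1, if_neg (by omega), mul_one, ← h.phi_theta hα hαβ hβ hi h1]
  by_cases h2 : j + β = n + i
  · rw [if_neg h1, if_pos h2, one_mul, ← h.phi_psi hα hαβ hβ hi hj h2]
  · rw [if_neg h1, if_neg h2, one_mul, one_mul, h.phi_of_ne hα hβ hi hj h1 h2]

end Gauge
/-! ### Reconstruction of a matrix from its standard minors -/

section Reconstruction

variable {K : Type} [Field K] {n : ℕ} {y : ℕ → ℕ → K} (L : Subring K)

/-- Induction on the distance from the lower right corner: each entry is found from those weakly
below and to the right of it. -/
theorem entries_mem_of_corner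
    (h : ∀ i j, 1 ≤ i → i ≤ n → 1 ≤ j → j ≤ n →
      (∀ a b, i ≤ a → a ≤ n → j ≤ b → b ≤ n → ¬(a = i ∧ b = j) → y a b ∈ L) → y i j ∈ L) :
    ∀ i j, 1 ≤ i → i ≤ n → 1 ≤ j → j ≤ n → y i j ∈ L := by
  suffices ∀ N i j, 2 * n - i - j = N → 1 ≤ i → i ≤ n → 1 ≤ j → j ≤ n → y i j ∈ L from
    fun i j => this _ i j rfl
  intro N
  induction N using Nat.strong_induction_on with
  | _ N ih =>
    intro i j hN hi hi' hj hj'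
    exact h i j hi hi' hj hj' fun a b ha ha' hb hb' hab =>
      ih (2 * n - a - b) (by omega) a b rfl (by omega) ha' (by omega) hb'

variable {L}

/-- The minor is affine in its upper left entry, with cofactor the next minor on the same diagonal.
-/
theorem corner_mem_of_stdMinor {i j : ℕ} (hi : i ≤ n) (hj : j ≤ n)
    (h : ∀ a b, i ≤ a → a ≤ n → j ≤ b → b ≤ n → ¬(a = i ∧ b = j) → y a b ∈ L)
    (hm : stdMinor n y i j ∈ L) (h0 : stdMinor n y (i + 1) (j + 1) ≠ 0)
    (hinv : (stdMinor n y (i + 1) (j + 1))⁻¹ ∈ L) : y i j ∈ L := by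
  rw [stdMinor, show n + 1 - max i j = n - max i j + 1 by omega] at hm
  refine corner_mem L (A := fun s t => y (i + s) (j + t))
    (fun s t hs ht hst => h _ _ (by omega) (by omega) (by omega) (by omega) (by omega)) hm hinv ?_
  convert mul_inv_cancel₀ h0 using 2
  rw [stdMinor, show n + 1 - max (i + 1) (j + 1) = n - max i j by omega]
  exact cornerDet_congr fun s t _ _ => by congr 1 <;> omega

/-- The array with an additional column `n + 1`, the last vector of the standard basis. -/
def extCol (n : ℕ) (y : ℕ → ℕ → K) (i j : ℕ) : K :=
  if j = n + 1 then (if i = n then 1 else 0) else y i j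

/-- The additional column lets a minor just above the diagonal use all rows from `p` to `n`, so that
all minors of one exchange relation fit into two Desnanot-Jacobi identities even when `i = j`. -/
theorem stdMinor_eq_extCol {p q : ℕ} (hpq : q ≤ p + 1) (hp : p ≤ n + 1) :
    stdMinor n y p q = cornerDet (n + 1 - p) (fun s t => extCol n y (p + s) (q + t)) := by
  unfold stdMinor
  obtain h | h := Nat.lt_or_ge p q
  · obtain rfl : q = p + 1 := by omega
    obtain h1 | h1 := Nat.lt_or_ge n p
    · rw [show n + 1 - max p (p + 1) = 0 by omega, show n + 1 - p = 0 by omega, cornerDet_zero,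
        cornerDet_zero]
    · rw [show n + 1 - max p (p + 1) = n - p by omega, show n + 1 - p = n - p + 1 by omega,
        cornerDet_of_col_last]
      · refine cornerDet_congr fun s t hs ht => ?_
        rw [extCol, if_neg (by omega)]
      · rw [extCol, if_pos (by omega), if_pos (by omega)]
      · intro s hs
        rw [extCol, if_pos (by omega), if_neg (by omega)]
  · rw [show n + 1 - max p q = n + 1 - p by omega]
    refine cornerDet_congr fun s t hs ht => ?_
    rw [extCol, if_neg (by omega)]

/-- The numerator of the exchange relation of the standard minors at `(i + 1, j + 1)`. -/
def stdExchange (n : ℕ) (y : ℕ → ℕ → K) (i j : ℕ) : K :=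
  stdMinor n y (i + 2) (j + 1) * stdMinor n y (i + 1) (j + 2) * stdMinor n y i j
    + stdMinor n y i (j + 1) * stdMinor n y (i + 1) j * stdMinor n y (i + 2) (j + 2)

theorem stdExchange_tr (i j : ℕ) : stdExchange n (tr y) j i = stdExchange n y i j := by
  unfold stdExchange
  simp only [stdMinor_tr]
  ring

/-- Desnanot-Jacobi identities starting at columns `j` and `j + 1` share one minor with row `i + 1`
omitted. Eliminating it shows that the new variable is `H` times the minor at `(i + 1, j + 2)`,
minus the minor at `(i + 1, j)` times `H'`. -/
theorem corner_mem_of_stdExchange_of_le {i j : ℕ} (hij : j ≤ i) (hi : i < n)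
    (h : ∀ a b, i ≤ a → a ≤ n → j ≤ b → b ≤ n → ¬(a = i ∧ b = j) → y a b ∈ L)
    (hm : stdMinor n y (i + 1) j ∈ L) (h0 : stdMinor n y (i + 1) (j + 1) ≠ 0)
    (hk : stdExchange n y i j / stdMinor n y (i + 1) (j + 1) ∈ L)
    (h1 : stdMinor n y (i + 2) (j + 1) ≠ 0) (h1' : (stdMinor n y (i + 2) (j + 1))⁻¹ ∈ L)
    (h2 : stdMinor n y (i + 1) (j + 2) ≠ 0) (h2' : (stdMinor n y (i + 1) (j + 2))⁻¹ ∈ L) :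
    y i j ∈ L := by
  obtain ⟨m, hmn⟩ : ∃ m, n = i + m + 1 := ⟨n - i - 1, by omega⟩
  let A : ℕ → ℕ → K := fun s t => extCol n y (i + s) (j + t)
  have hA : ∀ s t, s < m + 2 → t < m + 3 → ¬(s = 0 ∧ t = 0) → A s t ∈ L := fun s t hs ht hst => by
    simp only [A, extCol]
    split_ifs
    · exact one_mem L
    · exact zero_mem L
    · exact h _ _ (by omega) (by omega) (by omega) (by omega) (by omega)
  have e : ∀ a b, b ≤ a + 1 → a ≤ 2 →
      stdMinor n y (i + a) (j + b) = cornerDet (m + 2 - a) (fun s t => A (s + a) (t + b)) :=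
    fun a b hab ha => by
      rw [stdMinor_eq_extCol (by omega) (by omega), show n + 1 - (i + a) = m + 2 - a by omega]
      exact cornerDet_congr fun s t _ _ => by simp only [A]; congr 1 <;> omega
  let H := cornerDet (m + 1) (fun s t => A (skipOne s) t)
  let H' := cornerDet (m + 1) (fun s t => A (skipOne s) (t + 2))
  have d1 := desnanot_jacobi m A
  have d2 := desnanot_jacobi m (fun s t => A s (t + 1))
  have e00 := e 0 0 (by omega) (by omega)
  have e21 := e 2 1 (by omega) (by omega)
  have e12 := e 1 2 (by omega) (by omega)
  have e11 := e 1 1 (by omega) (by omega)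
  have e10 := e 1 0 (by omega) (by omega)
  have e01 := e 0 1 (by omega) (by omega)
  have e22 := e 2 2 (by omega) (by omega)
  simp only [Nat.add_zero, Nat.add_sub_cancel, Nat.sub_zero,
    show m + 2 - 1 = m + 1 by omega] at e00 e21 e12 e11 e10 e01 e22
  simp only [Nat.add_assoc, Nat.reduceAdd] at d2
  rw [← e00, ← e21, ← e11, ← e10] at d1
  rw [← e01, ← e22, ← e12, ← e11] at d2
  have key : stdExchange n y i j / stdMinor n y (i + 1) (j + 1)
      = H * stdMinor n y (i + 1) (j + 2) - stdMinor n y (i + 1) j * H' := by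
    rw [div_eq_iff h0, stdExchange]
    simp only [H, H']
    linear_combination stdMinor n y (i + 1) (j + 2) * d1 + stdMinor n y (i + 1) j * d2
  have hsk : ∀ s, s < m + 1 → skipOne s < m + 2 := fun s hs => by
    unfold skipOne; split_ifs <;> omega
  -- The columns of `H'` start at `j + 2`, so the unknown corner does not occur in it.
  have hH' : H' ∈ L := cornerDet_mem L fun s t hs ht =>
    hA _ _ (hsk s hs) (by omega) (by omega)
  have hH : H ∈ L := by
    rw [key] at hk
    have := mul_mem (add_mem hk (mul_mem hm hH')) h2'
    rwa [sub_add_cancel, mul_assoc, mul_inv_cancel₀ h2, mul_one] at this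
  have hcorner : A 0 0 ∈ L := by
    -- With row `i + 1` omitted, the cofactor of the corner is the minor at `(i + 2, j + 1)` instead
    -- of the one that has lost its inverse.
    refine corner_mem L (A := fun s t => A (skipOne s) t) (fun s t hs ht hst =>
      hA _ _ (hsk s hs) (by omega) fun h => hst ⟨?_, h.2⟩) hH h1' ?_
    · have := h.1; unfold skipOne at this; split_ifs at this with h3; exact h3
    · rw [e21] at h1 ⊢
      convert mul_inv_cancel₀ h1 using 2
      exact cornerDet_congr fun s t _ _ => by simp [skipOne]
  simpa [A, extCol, show j ≠ n + 1 by omega] using hcorner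

theorem corner_mem_of_stdExchange {i j : ℕ} (hi : i < n) (hj : j < n)
    (h : ∀ a b, i ≤ a → a ≤ n → j ≤ b → b ≤ n → ¬(a = i ∧ b = j) → y a b ∈ L)
    (hm : stdMinor n y (i + 1) j ∈ L) (hm' : stdMinor n y i (j + 1) ∈ L)
    (h0 : stdMinor n y (i + 1) (j + 1) ≠ 0)
    (hk : stdExchange n y i j / stdMinor n y (i + 1) (j + 1) ∈ L)
    (h1 : stdMinor n y (i + 2) (j + 1) ≠ 0) (h1' : (stdMinor n y (i + 2) (j + 1))⁻¹ ∈ L)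
    (h2 : stdMinor n y (i + 1) (j + 2) ≠ 0) (h2' : (stdMinor n y (i + 1) (j + 2))⁻¹ ∈ L) :
    y i j ∈ L := by
  obtain hij | hij := le_total j i
  · exact corner_mem_of_stdExchange_of_le hij hi h hm h0 hk h1 h1' h2 h2'
  · refine corner_mem_of_stdExchange_of_le (y := tr y) (i := j) (j := i) hij hj
      (fun a b ha ha' hb hb' hab => h b a hb hb' ha ha' fun h => hab ⟨h.2, h.1⟩) ?_ ?_ ?_ ?_ ?_ ?_ ?_
    all_goals simpa only [stdMinor_tr, stdExchange_tr]

/-- A matrix has its entries in a ring if this contains its standard minors and the inverses of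
those with indices at least two, except that one of these inverses may be replaced by the
new variable in the exchange relation. -/
theorem entries_mem_of_stdMinor (h0 : ∀ i j, 1 ≤ i → i ≤ n → 1 ≤ j → j ≤ n → stdMinor n y i j ≠ 0)
    (hm : ∀ i j, 1 ≤ i → i ≤ n → 1 ≤ j → j ≤ n → stdMinor n y i j ∈ L) (k : ℕ × ℕ)
    (hinv : ∀ i j, 2 ≤ i → i ≤ n → 2 ≤ j → j ≤ n → (i, j) ≠ k → (stdMinor n y i j)⁻¹ ∈ L)
    (hk : ∀ i j, 1 ≤ i → i < n → 1 ≤ j → j < n → (i + 1, j + 1) = k →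
      stdExchange n y i j / stdMinor n y (i + 1) (j + 1) ∈ L) :
    ∀ i j, 1 ≤ i → i ≤ n → 1 ≤ j → j ≤ n → y i j ∈ L := by
  have h0' : ∀ i j, 1 ≤ i → 1 ≤ j → stdMinor n y i j ≠ 0 := fun i j hi hj => by
    by_cases h : n < max i j
    · rw [stdMinor_eq_one y h]; exact one_ne_zero
    · exact h0 i j hi (by omega) hj (by omega)
  have hinv' : ∀ i j, 2 ≤ i → 2 ≤ j → (i, j) ≠ k → (stdMinor n y i j)⁻¹ ∈ L :=
    fun i j hi hj hij => by
      by_cases h : n < max i j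
      · rw [stdMinor_eq_one y h, inv_one]; exact one_mem L
      · exact hinv i j hi (by omega) hj (by omega) hij
  refine entries_mem_of_corner L fun i j hi hi' hj hj' h => ?_
  by_cases hc : (i + 1, j + 1) = k ∧ i < n ∧ j < n
  · obtain ⟨hc, hin, hjn⟩ := hc
    refine corner_mem_of_stdExchange hin hjn h (hm _ _ (by omega) (by omega) hj hj')
      (hm _ _ hi hi' (by omega) (by omega)) (h0' _ _ (by omega) (by omega)) (hk i j hi hin hj hjn hc)
      (h0' _ _ (by omega) (by omega)) (hinv' _ _ (by omega) (by omega) ?_)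
      (h0' _ _ (by omega) (by omega)) (hinv' _ _ (by omega) (by omega) ?_)
    all_goals rw [← hc, Ne, Prod.mk.injEq]; omega
  · refine corner_mem_of_stdMinor hi' hj' h (hm i j hi hi' hj hj') (h0' _ _ (by omega) (by omega)) ?_
    by_cases h1 : n < max (i + 1) (j + 1)
    · rw [stdMinor_eq_one y h1, inv_one]; exact one_mem L
    · exact hinv' _ _ (by omega) (by omega) fun h2 => hc ⟨h2, by omega, by omega⟩

end Reconstruction
-- Reconstruction after mutation at the added mutable vertex of the first row
section MutationAtFirstRow

variable {K : Type} [Field K] {n α β : ℕ}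

theorem skipMinor_mem {x : ℕ → ℕ → K} {L : Subring K} (hβ : 1 ≤ β)
    (h : ∀ i j, 1 ≤ i → i ≤ n → 1 ≤ j → j ≤ n → x i j ∈ L) : skipMinor n β x ∈ L :=
  cornerDet_mem L fun s t hs ht => h _ _ (by omega) (by omega) (by omega) (by
    unfold skipOne; split_ifs <;> omega)

/-- The identity compares the multiplier `t` with its analogue one row lower, whose denominator is
the minor at `(2, β + 1)`. -/
theorem desnanot_jacobi_stdMinor (hβ1 : 1 ≤ β) (hβ : β < n) (y : ℕ → ℕ → K) :
    stdMinor n y 1 β * stdMinor n y 2 (β + 2)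
      = stdMinor n y 2 (β + 1) * skipMinor n β y
        - stdMinor n y 1 (β + 1) * skipMinor n β (fun i j => y (i + 1) j) := by
  obtain ⟨m, rfl⟩ : ∃ m, n = β + m + 1 := ⟨n - β - 1, by omega⟩
  have h := desnanot_jacobi m (fun s t => y (1 + t) (β + s))
  have e : ∀ a b, a ≤ b → stdMinor (β + m + 1) y (1 + a) (β + b)
      = cornerDet (m + 2 - b) (fun s t => y (1 + (t + a)) (β + (s + b))) := fun a b hab => by
    rw [stdMinor, show β + m + 1 + 1 - max (1 + a) (β + b) = m + 2 - b by omega,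
      ← cornerDet_transpose]
    exact cornerDet_congr fun s t _ _ => by congr 1 <;> omega
  rw [skipMinor, skipMinor, show β + m + 1 - β = m + 1 by omega,
    ← cornerDet_transpose _ (fun s t => y (1 + s) (β + skipOne t)),
    ← cornerDet_transpose _ (fun s t => y (1 + s + 1) (β + skipOne t))]
  have e0 := e 0 0 le_rfl
  have e1 := e 1 2 (by omega)
  have e2 := e 1 1 le_rfl
  have e3 := e 0 1 (by omega)
  simp only [Nat.add_zero, Nat.reduceAdd, Nat.add_sub_cancel, Nat.sub_zero,
    show m + 2 - 1 = m + 1 by omega] at e0 e1 e2 e3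
  rw [e0, e1, e2, e3]
  exact h

/-- The column `α` is multiplied by `b`. -/
def scaleCol (α : ℕ) (b : K) (y : ℕ → ℕ → K) (i j : ℕ) : K :=
  if j = α then b * y i j else y i j

theorem cornerDet_scaleCol {N p : ℕ} (hp : p < N) (b : K) (A : ℕ → ℕ → K) :
    cornerDet N (scaleCol p b A) = b * cornerDet N A := by
  have := cornerDet_col_linear hp (A := scaleCol p b A) (B := A) (C := A) b 0
    (fun s t _ _ ht => by rw [scaleCol, if_neg ht]) (fun s t _ _ ht => by rw [scaleCol, if_neg ht])
    (fun s _ => by rw [scaleCol, if_pos rfl]; ring)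
  rw [this]; ring

theorem stdMinor_scaleCol {p q : ℕ} (hα : α < n) (hp : p ≤ n) (h : p + α = n + q) (b : K)
    (y : ℕ → ℕ → K) : stdMinor n (scaleCol α b y) p q = b * stdMinor n y p q := by
  unfold stdMinor
  rw [← cornerDet_scaleCol (p := n - p) (by omega)]
  refine cornerDet_congr fun s t _ _ => ?_
  unfold scaleCol
  by_cases ht : t = n - p
  · rw [if_pos ht, if_pos (by omega)]
  · rw [if_neg ht, if_neg (by omega)]

theorem skipMinor_tr_scaleCol (hα1 : 1 ≤ α) (hn : n = 2 * α) (b : K) (y : ℕ → ℕ → K) :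
    skipMinor n α (tr (scaleCol α b y)) = b * skipMinor n α (tr y) := by
  unfold skipMinor
  rw [← cornerDet_transpose, ← cornerDet_transpose _ (fun s t => tr y (1 + s) (α + skipOne t)),
    ← cornerDet_scaleCol (p := α - 1) (by omega)]
  refine cornerDet_congr fun s t _ _ => ?_
  simp only [scaleCol, tr]
  by_cases ht : t = α - 1
  · rw [if_pos ht, if_pos (by omega)]
  · rw [if_neg ht, if_neg (by omega)]

/-- A matrix has its entries in a ring if this contains the functions `φ_ij`, the inverses of the
mutable ones but `φ_{1,β+1}`, and the new variable of the exchange relation at `(1, β + 1)`. -/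
theorem entry_mem_of_mutate {X : Matrix (Fin n) (Fin n) K} {y : ℕ → ℕ → K} {s t : K}
    {L : Subring K} (h : IsGauge n α β (entry X) y s t) (hα1 : 1 ≤ α) (hα : α < n) (hαβ : α ≠ β)
    (hβ1 : 1 ≤ β) (hβ : β < n)
    (h0 : ∀ i j, 1 ≤ i → i ≤ n → 1 ≤ j → j ≤ n → stdMinor n y i j ≠ 0)
    (hm : ∀ i j, 1 ≤ i → i ≤ n → 1 ≤ j → j ≤ n → phi X α β i j ∈ L)
    (hinv : ∀ i j, 2 ≤ i → i ≤ n → 2 ≤ j → j ≤ n → (phi X α β i j)⁻¹ ∈ L)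
    (hinvA : (phi X α β (α + 1) 1)⁻¹ ∈ L)
    (hk : (phi X α β 2 (β + 1) * phi X α β n α
      + (if β + 2 ≤ n then phi X α β 2 (β + 2) else 1) * phi X α β 1 β * phi X α β n (α + 1))
        / phi X α β 1 (β + 1) ∈ L) :
    ∀ i j, 1 ≤ i → i ≤ n → 1 ≤ j → j ≤ n → entry X i j ∈ L := by
  have hn3 : 3 ≤ n := by omega
  obtain ⟨ha0, hb0⟩ := h.phi_ne_zero hα hαβ hβ
  have hphi := fun i j hi hj => h.phi_eq (i := i) (j := j) hα hαβ hβ hi hj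
  have haL := hm (α + 1) 1 (by omega) (by omega) (by omega) (by omega)
  have hbe := h.phi_one hα hαβ hβ
  have hae := h.phi_row_one hα hαβ hβ
  set a := phi X α β (α + 1) 1 with ha
  set b := phi X α β 1 (β + 1) with hb
  set B := stdMinor n y 1 (β + 1) with hB
  -- The factor `a` is invertible in `L`, so it can be dropped wherever it occurs; only `B`, the
  -- minor behind `b`, lacks an inverse.
  have hunit : ∀ p : Prop, ∀ [Decidable p], (if p then a else 1) ∈ L ∧ (if p then a else 1)⁻¹ ∈ L
      ∧ (if p then a else 1) ≠ 0 := fun p _ => by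
    split_ifs
    · exact ⟨haL, hinvA, ha0⟩
    · simp [one_mem]
  have hdiv : ∀ {u v w : K}, u ≠ 0 → u⁻¹ ∈ L → w ∈ L → w = u * v → v ∈ L :=
    fun {u v w} hu hu' hw hwv => by
      rw [show v = u⁻¹ * w by rw [hwv, inv_mul_cancel_left₀ hu]]; exact mul_mem hu' hw
  have hdiv' : ∀ {u v w : K}, u ≠ 0 → u ∈ L → w⁻¹ ∈ L → w = u * v → v⁻¹ ∈ L :=
    fun {u v w} hu hu' hw hwv => by
      rw [show v⁻¹ = u * w⁻¹ by rw [hwv, mul_inv, mul_inv_cancel_left₀ hu]]; exact mul_mem hu' hw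
  have hBL : B ∈ L := hdiv (hunit _).2.2 (hunit _).2.1
    (hm 1 (β + 1) (by omega) (by omega) (by omega) (by omega)) hbe
  have hB0 : B ≠ 0 := h.col_ne_zero
  have hG : ∀ i j, 1 ≤ i → i ≤ n → 1 ≤ j → j ≤ n → i + α ≠ n + j →
      phi X α β i j = (if j + β = n + i then a else 1) * stdMinor n y i j :=
    fun i j hi hi' hj hj' hij => by
      rw [hphi i j hi' hj', gaugeFactor, if_neg hij, one_mul]
  have hGL : ∀ i j, 1 ≤ i → i ≤ n → 1 ≤ j → j ≤ n → i + α ≠ n + j → stdMinor n y i j ∈ L :=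
    fun i j hi hi' hj hj' hij => hdiv (hunit _).2.2 (hunit _).2.1 (hm i j hi hi' hj hj')
      (hG i j hi hi' hj hj' hij)
  have hGinv : ∀ i j, 2 ≤ i → i ≤ n → 2 ≤ j → j ≤ n → i + α ≠ n + j → (stdMinor n y i j)⁻¹ ∈ L :=
    fun i j hi hi' hj hj' hij => hdiv' (hunit _).2.2 (hunit _).1 (hinv i j hi hi' hj hj')
      (hG i j (by omega) hi' (by omega) hj' hij)
  have hT : ∀ i j, 1 ≤ i → i ≤ n → 1 ≤ j → j ≤ n → i + α = n + j →
      phi X α β i j = (if n = 2 * β then a else 1) * (B * stdMinor n y i j) :=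
    fun i j hi hi' hj hj' hij => by
      rw [h.phi_theta hα hαβ hβ hi' hij, ← hb, hbe, mul_assoc]
  have hTL : ∀ i j, 1 ≤ i → i ≤ n → 1 ≤ j → j ≤ n → i + α = n + j → B * stdMinor n y i j ∈ L :=
    fun i j hi hi' hj hj' hij => hdiv (hunit _).2.2 (hunit _).2.1 (hm i j hi hi' hj hj')
      (hT i j hi hi' hj hj' hij)
  have hTinv : ∀ i j, 2 ≤ i → i ≤ n → 2 ≤ j → j ≤ n → i + α = n + j →
      (B * stdMinor n y i j)⁻¹ ∈ L :=
    fun i j hi hi' hj hj' hij => hdiv' (hunit _).2.2 (hunit _).1 (hinv i j hi hi' hj hj')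
      (hT i j (by omega) hi' (by omega) hj' hij)
  -- the new gauge
  set D' := skipMinor n β (fun i j => y (i + 1) j) with hD'
  have hG2 : stdMinor n y 2 (β + 1) ≠ 0 := h0 _ _ (by omega) (by omega) (by omega) (by omega)
  have hG2inv : (stdMinor n y 2 (β + 1))⁻¹ ∈ L :=
    hGinv _ _ (by omega) (by omega) (by omega) (by omega) (by omega)
  have hG22 : stdMinor n y 2 (β + 2) ∈ L := by
    by_cases h2 : β + 2 ≤ n
    · exact hGL _ _ (by omega) (by omega) (by omega) (by omega) (by omega)
    · rw [stdMinor_eq_one y (by omega)]; exact one_mem L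
  set κ := stdMinor n y 1 β * stdMinor n y 2 (β + 2) * (stdMinor n y 2 (β + 1))⁻¹ with hκ
  have hκL : κ ∈ L :=
    mul_mem (mul_mem (hGL _ _ (by omega) (by omega) (by omega) (by omega) (by omega)) hG22) hG2inv
  -- This multiplier replaces `t`, whose denominator `B` is not invertible. The difference of the
  -- two has only a simple pole along `B`, and its residue `κ` is in `L`.
  set t' := D' * (stdMinor n y 2 (β + 1))⁻¹ with ht'
  have hBt : B * (t - t') = κ := by
    have h1 := desnanot_jacobi_stdMinor hβ1 hβ y
    rw [← h.col_eq, ← hB, ← hD'] at h1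
    rw [hκ, h1, ht']
    field_simp
  set z := colOp α (t - t') y with hz
  have hzne : ∀ i j, j ≠ α → z i j = y i j := fun i j hj => by rw [hz, colOp, if_neg hj, add_zero]
  have hzα : ∀ i, B * y i α = B * z i α - κ * z i (α + 1) := fun i => by
    rw [hzne i (α + 1) (by omega), hz, colOp, if_pos rfl, ← hBt]; ring
  have hyz : y = colOp α (t' - t) z := by
    rw [hz, colOp_colOp, show t' - t + (t - t') = 0 by ring, colOp_zero]
  -- Entries of `y` in column `α` belong to `L` only after multiplication by `B`; scaling this
  -- column matches the factor `B` in the functions of the exceptional diagonal.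
  have hW : ∀ i j, z i j ∈ L → z i (α + 1) ∈ L → scaleCol α B y i j ∈ L := fun i j h1 h2 => by
    unfold scaleCol
    split_ifs with hj
    · rw [hj] at h1 ⊢
      rw [hzα]; exact sub_mem (mul_mem hBL h1) (mul_mem hκL h2)
    · rw [← hzne i j hj]; exact h1
  have hzL : ∀ i j, 1 ≤ i → i ≤ n → 1 ≤ j → j ≤ n → z i j ∈ L := by
    refine entries_mem_of_corner L fun i j hi hi' hj hj' hij => ?_
    by_cases hθ : i + α = n + j
    · by_cases hin : i < n
      · have h1 : scaleCol α B y i j = z i j := by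
          rw [scaleCol, if_neg (by omega), hzne i j (by omega)]
        rw [← h1]
        have h2 := stdMinor_scaleCol (p := i + 1) (q := j + 1) hα (by omega) (by omega) B y
        refine corner_mem_of_stdMinor hi' hj' (fun c d hc hc' hd hd' hcd =>
          hW _ _ (hij _ _ hc hc' hd hd' hcd)
            (hij _ _ hc hc' (by omega) (by omega) (by omega))) ?_ ?_ ?_
        · rw [stdMinor_scaleCol hα hi' hθ]
          exact hTL i j hi hi' hj hj' hθ
        · rw [h2]
          exact mul_ne_zero hB0 (h0 _ _ (by omega) (by omega) (by omega) (by omega))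
        · rw [h2]
          exact hTinv _ _ (by omega) (by omega) (by omega) (by omega) (by omega)
      -- Only at `(n, α)` is the new variable needed: there the exchange relation gives `z n α`
      -- times the minor at `(2, β + 1)`, up to powers of `a`.
      · obtain rfl : i = n := by omega
        obtain rfl : j = α := by omega
        have e1 : stdMinor i y i j = y i j := by
          rw [stdMinor, show i + 1 - max i j = 1 by omega, cornerDet_one]; simp
        have e2 : stdMinor i y i (j + 1) = y i (j + 1) := by
          rw [stdMinor, show i + 1 - max i (j + 1) = 1 by omega, cornerDet_one]; simp
        have e3 : (if β + 2 ≤ i then phi X j β 2 (β + 2) else 1)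
            = (if i = 2 * β then a else 1) * stdMinor i y 2 (β + 2) := by
          by_cases h2 : β + 2 ≤ i
          · rw [if_pos h2, hG _ _ (by omega) (by omega) (by omega) (by omega) (by omega)]
            congr 1
            simp only [show (β + 2 + β = i + 2) ↔ (i = 2 * β) by omega]
          · rw [if_neg h2, stdMinor_eq_one y (by omega), if_neg (by omega), one_mul]
        rw [e3, hG 2 (β + 1) (by omega) (by omega) (by omega) (by omega) (by omega),
          hG 1 β (by omega) (by omega) (by omega) (by omega) (by omega),
          hT i j hi le_rfl hj hj' hθ, e1,
          hG i (j + 1) (by omega) (by omega) (by omega) (by omega) (by omega), e2, hbe,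
          if_neg (by omega : ¬ j + 1 + β = i + i), one_mul] at hk
        simp only [show (β + 1 + β = i + 2) ↔ (β + β = i + 1) by omega] at hk
        refine hdiv (mul_ne_zero (hunit (β + β = i + 1)).2.2 hG2) ?_ hk ?_
        · rw [mul_inv]; exact mul_mem (hunit _).2.1 hG2inv
        · have hu := (hunit (i = 2 * β)).2.2
          rw [div_eq_iff (mul_ne_zero hu hB0)]
          have h5 := hzα i
          rw [hzne i (j + 1) (by omega)] at h5
          have h6 : stdMinor i y 1 β * stdMinor i y 2 (β + 2) = κ * stdMinor i y 2 (β + 1) := by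
            rw [hκ, inv_mul_cancel_right₀ hG2]
          linear_combination (if β + β = i + 1 then a else 1) * (if i = 2 * β then a else 1)
            * stdMinor i y 2 (β + 1) * h5
            + (if β + β = i + 1 then a else 1) * (if i = 2 * β then a else 1) * y i (j + 1) * h6
    · have e : ∀ p q, p + α ≠ n + q → stdMinor n z p q = stdMinor n y p q := fun p q hpq => by
        rw [hz, stdMinor_colOp hα _ _ hpq]
      have h2 : i + 1 + α ≠ n + (j + 1) := by omega
      refine corner_mem_of_stdMinor hi' hj' hij ?_ ?_ ?_
      · rw [e i j hθ]; exact hGL i j hi hi' hj hj' hθ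
      · rw [e _ _ h2]
        by_cases h3 : n < max (i + 1) (j + 1)
        · rw [stdMinor_eq_one y h3]; exact one_ne_zero
        · exact h0 _ _ (by omega) (by omega) (by omega) (by omega)
      · rw [e _ _ h2]
        by_cases h3 : n < max (i + 1) (j + 1)
        · rw [stdMinor_eq_one y h3, inv_one]; exact one_mem L
        · exact hGinv _ _ (by omega) (by omega) (by omega) (by omega) h2
  -- The minor `D'` is unchanged by the column operation, hence can be computed from `z`.
  have ht'L : t' ∈ L := by
    refine mul_mem ?_ hG2inv
    have : (fun i j => y (i + 1) j) = colOp α (t' - t) (fun i j => z (i + 1) j) := by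
      rw [hyz]; rfl
    rw [hD', this, skipMinor_colOp hα hαβ]
    exact cornerDet_mem L fun s t hs ht => hzL _ _ (by omega) (by omega) (by omega) (by
      unfold skipOne; split_ifs <;> omega)
  have hsL : s ∈ L := by
    have h1 := h.row_eq
    -- In this case the numerator of `s` ends with column `α`, and `a` contains a factor `B`, which
    -- is exactly what scaling this column provides.
    by_cases hn : n = 2 * α
    · rw [if_pos hn, hbe, if_neg (by omega), one_mul] at hae
      refine hdiv (v := s) (w := skipMinor n α (tr (scaleCol α B y))) ha0 hinvA ?_ ?_
      · exact skipMinor_mem hα1 fun i j hi hi' hj hj' =>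
          hW j i (hzL _ _ hj hj' hi hi') (hzL _ _ hj hj' (by omega) (by omega))
      · rw [skipMinor_tr_scaleCol hα1 hn, ← h1, hae]; ring
    · rw [if_neg hn, one_mul] at hae
      refine hdiv (v := s) (w := skipMinor n α (tr z)) ha0 hinvA ?_ ?_
      · exact skipMinor_mem hα1 fun i j hi hi' hj hj' => hzL _ _ hj hj' hi hi'
      · rw [hz, tr_colOp, skipMinor_rowOp hn, ← h1, hae]; ring
  intro i j hi hi' hj hj'
  have hcol : ∀ i j, 1 ≤ i → i ≤ n → 1 ≤ j → j ≤ n → colOp α t y i j ∈ L :=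
    fun i j hi hi' hj hj' => by
      rw [hyz, colOp_colOp, add_sub_cancel, colOp]
      split_ifs with h1
      · exact add_mem (hzL i j hi hi' hj hj')
          (mul_mem ht'L (hzL _ _ hi hi' (by omega) (by omega)))
      · rw [add_zero]; exact hzL i j hi hi' hj hj'
  rw [h.eq, rowOp]
  split_ifs with h1
  · exact add_mem (hcol i j hi hi' hj hj') (mul_mem hsL (hcol _ _ (by omega) (by omega) hj hj'))
  · rw [add_zero]; exact hcol i j hi hi' hj hj'

end MutationAtFirstRow
/-! ### The function field of `SL_n` -/

section FunctionField

theorem det_X_ne_zero {σ : Type} {m : ℕ} (e : Fin m × Fin m → σ) (he : Function.Injective e) :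
    (Matrix.of fun s t => (MvPolynomial.X (e (s, t)) : MvPolynomial σ ℂ)).det ≠ 0 := by
  have h := Matrix.det_mvPolynomialX_ne_zero (Fin m) ℂ
  have h1 : (Matrix.of fun s t => (MvPolynomial.X (e (s, t)) : MvPolynomial σ ℂ))
      = (MvPolynomial.rename e).toRingHom.mapMatrix (Matrix.mvPolynomialX (Fin m) (Fin m) ℂ) := by
    ext s t
    simp [Matrix.mvPolynomialX]
  rw [h1, ← RingHom.map_det]
  exact fun h0 => h (MvPolynomial.rename_injective e he (by simpa using h0))

theorem map_entry {R S : Type} [CommRing R] [CommRing S] (g : R →+* S) {n : ℕ}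
    (X : Matrix (Fin n) (Fin n) R) (i j : ℕ) : g (entry X i j) = entry (X.map g) i j := by
  unfold entry
  split_ifs <;> simp

theorem map_stdMinor {R S : Type} [CommRing R] [CommRing S] (g : R →+* S) {n : ℕ}
    (X : Matrix (Fin n) (Fin n) R) (i j : ℕ) :
    g (stdMinor n (entry X) i j) = stdMinor n (entry (X.map g)) i j := by
  unfold stdMinor
  simp only [map_cornerDet, map_entry]

theorem map_block {R S : Type} [CommRing R] [CommRing S] (g : R →+* S) {n : ℕ}
    (X : Matrix (Fin n) (Fin n) R) (r r' c c' p q s t : ℕ) :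
    g (block X r r' c c' p q s t) = block (X.map g) r r' c c' p q s t := by
  unfold block
  split_ifs
  · rw [map_entry]
  · exact map_zero g

theorem map_phi {R S : Type} [CommRing R] [CommRing S] (g : R →+* S) {n : ℕ}
    (X : Matrix (Fin n) (Fin n) R) (α β i j : ℕ) :
    g (phi X α β i j) = phi (X.map g) α β i j := by
  unfold phi theta psi f
  split_ifs <;> simp only [map_cornerDet, Pi.add_apply, map_add, map_block] <;> rfl

theorem det_eq_add_of_eq_off_corner {R : Type} [CommRing R] {m : ℕ}
    {X Y : Matrix (Fin (m + 1)) (Fin (m + 1)) R}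
    (h : ∀ i j, ¬(i = 0 ∧ j = 0) → X i j = Y i j) :
    X.det = (X 0 0 - Y 0 0) * (Y.submatrix Fin.succ Fin.succ).det + Y.det := by
  have hs : ∀ j : Fin (m + 1), X.submatrix Fin.succ j.succAbove = Y.submatrix Fin.succ j.succAbove :=
    fun j => by
      ext s t
      exact h _ _ fun h0 => Fin.succ_ne_zero _ h0.1
  rw [Matrix.det_succ_row_zero X, Matrix.det_succ_row_zero Y, Fin.sum_univ_succ, Fin.sum_univ_succ]
  have : ∀ j : Fin m, X 0 j.succ = Y 0 j.succ := fun j => h _ _ fun h0 => Fin.succ_ne_zero _ h0.2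
  have h0 := hs 0
  rw [Fin.succAbove_zero] at h0
  simp only [hs, this, h0, Fin.succAbove_zero, Fin.val_zero, pow_zero, one_mul]
  ring

/-- The homomorphism from the coordinate ring of `SL_n` given by a matrix of determinant one. -/
theorem exists_hom_of_det_eq_one {n : ℕ} {A : Type} [CommRing A] [Algebra ℂ A]
    (Z : Matrix (Fin n) (Fin n) A) (hZ : Z.det = 1) :
    ∃ g : SLCoordRing n →ₐ[ℂ] A, (coordMatrix n).map g = Z := by
  let e : MvPolynomial (Fin n × Fin n) ℂ →ₐ[ℂ] A := MvPolynomial.aeval fun p => Z p.1 p.2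
  have he : e.mapMatrix (Matrix.mvPolynomialX (Fin n) (Fin n) ℂ) = Z := by
    ext i j
    simp [e, Matrix.mvPolynomialX]
  have hdet : e (Matrix.mvPolynomialX (Fin n) (Fin n) ℂ).det = 1 := by
    rw [AlgHom.map_det, he, hZ]
  refine ⟨Ideal.Quotient.liftₐ _ e fun a ha => ?_, ?_⟩
  · obtain ⟨c, rfl⟩ := Ideal.mem_span_singleton'.1 ha
    rw [map_mul, map_sub, hdet, map_one, sub_self, mul_zero]
  · ext i j
    rw [← he]
    rfl

/-- Dividing the first row of a matrix of independent variables by its determinant gives a point of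
`SL_n` at which the minor is a nonzero multiple of a generic minor. -/
theorem coordMatrix_stdMinor_ne_zero {n i j : ℕ} (hi1 : 1 ≤ i) (hi : i ≤ n) (hj1 : 1 ≤ j)
    (hj : j ≤ n) : stdMinor n (entry (coordMatrix n)) i j ≠ 0 := by
  let P := MvPolynomial (Fin n × Fin n) ℂ
  let F := FractionRing P
  have hinj : Function.Injective (algebraMap P F) := IsFractionRing.injective P F
  let Y : Matrix (Fin n) (Fin n) P := Matrix.mvPolynomialX (Fin n) (Fin n) ℂ
  let Y' : Matrix (Fin n) (Fin n) F := Y.map (algebraMap P F)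
  have hY : Y'.det ≠ 0 := by
    have : Y'.det = algebraMap P F Y.det := by rw [RingHom.map_det]; rfl
    rw [this]
    exact (map_ne_zero_iff _ hinj).2 (Matrix.det_mvPolynomialX_ne_zero (Fin n) ℂ)
  let d : Fin n → F := fun i => if i.1 = 0 then Y'.det⁻¹ else 1
  have hd : (Matrix.diagonal d * Y').det = 1 := by
    rw [Matrix.det_mul, Matrix.det_diagonal]
    rw [Finset.prod_eq_single ⟨0, by omega⟩]
    · simp only [d, if_true]
      exact inv_mul_cancel₀ hY
    · intro b _ hb
      exact if_neg fun h => hb (Fin.ext h)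
    · simp
  obtain ⟨g, hg⟩ := exists_hom_of_det_eq_one _ hd
  have hmin : stdMinor n (entry Y) i j ≠ 0 := by
    have hm := det_X_ne_zero (m := n + 1 - max i j) (σ := Fin n × Fin n)
      (fun p => (⟨i + p.1 - 1, by have := p.1.2; omega⟩, ⟨j + p.2 - 1, by have := p.2.2; omega⟩))
      (fun p q h => by
        simp only [Prod.mk.injEq, Fin.mk.injEq] at h
        exact Prod.ext (Fin.ext (by omega)) (Fin.ext (by omega)))
    convert hm using 1
    unfold stdMinor cornerDet
    congr 1
    ext s t : 2
    have hs := s.2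
    have ht := t.2
    simp only [Matrix.of_apply]
    rw [entry, dif_pos (by omega)]
    rfl
  have hmin' : stdMinor n (entry Y') i j ≠ 0 := by
    rw [← map_stdMinor]
    exact (map_ne_zero_iff _ hinj).2 hmin
  have hZ : ∀ p q, entry (Matrix.diagonal d * Y') p q = scaleCol 1 Y'.det⁻¹ (tr (entry Y')) q p := by
    intro p q
    unfold scaleCol tr entry
    by_cases h : (1 ≤ p ∧ p ≤ n) ∧ 1 ≤ q ∧ q ≤ n
    · rw [dif_pos h, dif_pos h, Matrix.diagonal_mul]
      simp only [d]
      by_cases hp : p = 1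
      · rw [if_pos (by omega), if_pos hp]
      · rw [if_neg (by omega), if_neg hp, one_mul]
    · rw [dif_neg h, dif_neg h]; simp
  have hZmin : stdMinor n (entry (Matrix.diagonal d * Y')) i j ≠ 0 := by
    have e1 : entry (Matrix.diagonal d * Y') = tr (scaleCol 1 Y'.det⁻¹ (tr (entry Y'))) := by
      funext p q; exact hZ p q
    rw [e1, stdMinor_tr]
    rw [← stdMinor_tr] at hmin'
    by_cases h1 : i = 1
    · have : stdMinor n (scaleCol 1 Y'.det⁻¹ (tr (entry Y'))) j i
          = Y'.det⁻¹ * stdMinor n (tr (entry Y')) j i := by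
        unfold stdMinor
        rw [← cornerDet_scaleCol (p := 0) (by omega)]
        refine cornerDet_congr fun s t _ _ => ?_
        simp only [scaleCol, h1, show 1 + t = 1 ↔ t = 0 by omega]
      rw [this]
      exact mul_ne_zero (inv_ne_zero hY) hmin'
    · convert hmin' using 1
      refine cornerDet_congr fun s t _ _ => ?_
      rw [scaleCol, if_neg (by omega)]
  intro h0
  apply hZmin
  rw [← hg]
  have := map_stdMinor g.toRingHom (coordMatrix n) i j
  rw [h0, map_zero] at this
  exact this.symm

theorem algebraMap_coordMatrix_injective (n : ℕ) :
    Function.Injective (algebraMap (SLCoordRing n) (SLFunctionField n)) :=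
  IsFractionRing.injective _ _

theorem genericMatrix_stdMinor_ne_zero {n i j : ℕ} (hi1 : 1 ≤ i) (hi : i ≤ n) (hj1 : 1 ≤ j)
    (hj : j ≤ n) : stdMinor n (entry (genericMatrix n)) i j ≠ 0 := by
  rw [genericMatrix, ← map_stdMinor]
  exact (map_ne_zero_iff _ (algebraMap_coordMatrix_injective n)).2
    (coordMatrix_stdMinor_ne_zero hi1 hi hj1 hj)

theorem det_genericMatrix (n : ℕ) : (genericMatrix n).det = 1 := by
  have : (genericMatrix n).det = algebraMap _ (SLFunctionField n) (coordMatrix n).det := by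
    rw [RingHom.map_det]; rfl
  rw [this, det_coordMatrix, map_one]

theorem entry_transvection_mul {K : Type} [Field K] {n β : ℕ} (hβ1 : 1 ≤ β) (hβ : β < n) (s : K)
    (Y : Matrix (Fin n) (Fin n) K) :
    entry (Matrix.transvection (⟨β - 1, by omega⟩ : Fin n) ⟨β, hβ⟩ s * Y) = rowOp β s (entry Y) := by
  funext i j
  unfold rowOp
  by_cases h : (1 ≤ i ∧ i ≤ n) ∧ 1 ≤ j ∧ j ≤ n
  · by_cases hi : i = β
    · subst hi
      rw [if_pos rfl, entry, dif_pos h, entry, dif_pos h, entry, dif_pos (by omega),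
        Matrix.transvection_mul_apply_same]
      simp
    · rw [if_neg hi, entry, dif_pos h, entry, dif_pos h, Matrix.transvection_mul_apply_of_ne, add_zero]
      exact fun h1 => hi (by have := congrArg Fin.val h1; simp only at this; omega)
  · rw [entry, dif_neg h, entry, dif_neg h]
    split_ifs with hi
    · rw [entry, dif_neg (by omega)]; simp
    · simp

/-- The gauge is run backwards: with the generic matrix as `y`, two transvections produce a matrix
`Z` of determinant one. At this point of `SL_n` the function is a product of nonzero standard
minors. -/
theorem phi_genericMatrix_ne_zero {n α β : ℕ} (hα1 : 1 ≤ α) (hα : α < n) (hαβ : α ≠ β)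
    (hβ1 : 1 ≤ β) (hβ : β < n) {i j : ℕ} (hi1 : 1 ≤ i) (hi : i ≤ n) (hj1 : 1 ≤ j) (hj : j ≤ n) :
    phi (genericMatrix n) α β i j ≠ 0 := by
  let K := SLFunctionField n
  let Y : Matrix (Fin n) (Fin n) K := genericMatrix n
  have hne : ∀ i j, 1 ≤ i → i ≤ n → 1 ≤ j → j ≤ n → stdMinor n (entry Y) i j ≠ 0 :=
    fun i j h1 h2 h3 h4 => genericMatrix_stdMinor_ne_zero h1 h2 h3 h4
  let s : K := skipMinor n α (tr (entry Y)) / stdMinor n (entry Y) (α + 1) 1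
  let t : K := skipMinor n β (entry Y) / stdMinor n (entry Y) 1 (β + 1)
  let U := Matrix.transvection (⟨β - 1, by omega⟩ : Fin n) ⟨β, hβ⟩ s
  let W := Matrix.transvection (⟨α - 1, by omega⟩ : Fin n) ⟨α, hα⟩ t
  let Z : Matrix (Fin n) (Fin n) K := U * (W * Y.transpose).transpose
  have hU : U.det = 1 := Matrix.det_transvection_of_ne _ _ (by simp [Fin.ext_iff]; omega) _
  have hW : W.det = 1 := Matrix.det_transvection_of_ne _ _ (by simp [Fin.ext_iff]; omega) _
  have hZ : Z.det = 1 := by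
    simp only [Z]
    rw [Matrix.det_mul, Matrix.det_transpose, Matrix.det_mul, Matrix.det_transpose, hU, hW]
    simp only [Y, one_mul]
    exact det_genericMatrix n
  have hG : IsGauge n α β (entry Z) (entry Y) s t := by
    refine ⟨?_, hne _ _ (by omega) (by omega) (by omega) (by omega),
      hne _ _ (by omega) (by omega) (by omega) (by omega),
      div_mul_cancel₀ _ (hne _ _ (by omega) (by omega) (by omega) (by omega)),
      div_mul_cancel₀ _ (hne _ _ (by omega) (by omega) (by omega) (by omega))⟩
    simp only [Z, U, W]
    rw [entry_transvection_mul hβ1 hβ, entry_transpose, entry_transvection_mul hα1 hα,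
      entry_transpose, tr_rowOp, tr_tr]
  obtain ⟨g, hg⟩ := exists_hom_of_det_eq_one Z hZ
  have hφ : phi Z α β i j ≠ 0 := by
    obtain ⟨h1, h2⟩ := hG.phi_ne_zero hα hαβ hβ
    rw [hG.phi_eq hα hαβ hβ hi hj, gaugeFactor]
    refine mul_ne_zero (mul_ne_zero ?_ ?_) (hne _ _ hi1 hi hj1 hj)
    · split_ifs <;> [exact h2; exact one_ne_zero]
    · split_ifs <;> [exact h1; exact one_ne_zero]
  have hc : phi (coordMatrix n) α β i j ≠ 0 := by
    intro h0
    apply hφ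
    rw [← hg]
    have := map_phi g.toRingHom (coordMatrix n) α β i j
    rw [h0, map_zero] at this
    exact this.symm
  rw [genericMatrix, ← map_phi]
  exact (map_ne_zero_iff _ (algebraMap_coordMatrix_injective n)).2 hc

/-- The coordinates other than `x_11` are independent, since they can be specialized to independent
variables while `x_11` is adjusted to make the determinant one. -/
theorem card_vertex_le_trdeg {n : ℕ} (hn : 2 ≤ n) :
    Cardinal.mk (Vertex n) ≤ Algebra.trdeg ℂ (SLFunctionField n) := by
  obtain ⟨m, rfl⟩ : ∃ m, n = m + 1 := ⟨n - 1, by omega⟩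
  let P := MvPolynomial (Vertex (m + 1)) ℂ
  let F := FractionRing P
  have hinj : Function.Injective (algebraMap P F) := IsFractionRing.injective P F
  have hv : ∀ i j : Fin (m + 1), ¬(i = 0 ∧ j = 0) →
      (i.1 + 1, j.1 + 1) ∈ (Finset.Icc 1 (m + 1) ×ˢ Finset.Icc 1 (m + 1)).erase (1, 1) :=
    fun i j h => by
      simp only [Fin.ext_iff, Fin.val_zero] at h
      simp only [Finset.mem_erase, Finset.mem_product, Finset.mem_Icc, ne_eq, Prod.mk.injEq]
      omega
  let Y : F → Matrix (Fin (m + 1)) (Fin (m + 1)) F := fun c => Matrix.of fun i j =>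
    if h : i = 0 ∧ j = 0 then c else algebraMap P F (MvPolynomial.X ⟨_, hv i j h⟩)
  have hY : ∀ c i j (h : ¬(i = 0 ∧ j = 0)),
      Y c i j = algebraMap P F (MvPolynomial.X ⟨_, hv i j h⟩) := fun c i j h => dif_neg h
  have hY0 : ∀ c, Y c 0 0 = c := fun c => by
    simp only [Y, Matrix.of_apply]
    exact dif_pos ⟨trivial, trivial⟩
  let N : F := ((Y 0).submatrix Fin.succ Fin.succ).det
  have hN : N ≠ 0 := by
    have h1 := det_X_ne_zero (m := m) (σ := Vertex (m + 1))
      (fun p => ⟨_, hv p.1.succ p.2.succ fun h => Fin.succ_ne_zero _ h.1⟩)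
      (fun p q h => by
        simp only [Subtype.mk.injEq, Prod.mk.injEq, Fin.val_succ] at h
        exact Prod.ext (Fin.ext (by omega)) (Fin.ext (by omega)))
    have h2 := (map_ne_zero_iff (algebraMap P F) hinj).2 h1
    rw [RingHom.map_det] at h2
    have e : (Y 0).submatrix Fin.succ Fin.succ = (algebraMap P F).mapMatrix
        (Matrix.of fun s t => MvPolynomial.X
          ⟨_, hv s.succ t.succ fun h => Fin.succ_ne_zero _ h.1⟩) := by
      ext s t : 2
      exact hY 0 _ _ fun h => Fin.succ_ne_zero _ h.1
    simp only [N]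
    rw [e]
    exact h2
  -- The determinant is affine in the corner entry, with nonzero cofactor `N`.
  let c : F := (1 - (Y 0).det) / N
  have hdet : (Y c).det = 1 := by
    rw [det_eq_add_of_eq_off_corner (Y := Y 0) fun i j h => (hY c i j h).trans (hY 0 i j h).symm,
      hY0, hY0, sub_zero]
    change (1 - (Y 0).det) / N * N + _ = _
    rw [div_mul_cancel₀ _ hN, sub_add_cancel]
  obtain ⟨g, hg⟩ := exists_hom_of_det_eq_one (Y c) hdet
  have hvi : ∀ v : Vertex (m + 1), 1 ≤ v.1.1 ∧ v.1.1 ≤ m + 1 ∧ 1 ≤ v.1.2 ∧ v.1.2 ≤ m + 1 ∧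
      ¬(v.1.1 = 1 ∧ v.1.2 = 1) := fun v => by
    have := v.2
    simp only [Finset.mem_erase, Finset.mem_product, Finset.mem_Icc, ne_eq, Prod.ext_iff] at this
    omega
  let x : Vertex (m + 1) → SLCoordRing (m + 1) := fun v =>
    coordMatrix (m + 1) ⟨v.1.1 - 1, by have := hvi v; omega⟩ ⟨v.1.2 - 1, by have := hvi v; omega⟩
  have hgx : ∀ v, g (x v) = algebraMap P F (MvPolynomial.X v) := fun v => by
    have h := hvi v
    have h1 : g (x v) = (coordMatrix (m + 1)).map g ⟨v.1.1 - 1, by omega⟩ ⟨v.1.2 - 1, by omega⟩ := rfl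
    rw [h1, hg, hY c _ _ (by simp only [Fin.ext_iff, Fin.val_zero]; omega)]
    congr 2
    apply Subtype.ext
    apply Prod.ext <;> simp only <;> omega
  have hx : AlgebraicIndependent ℂ x := by
    have h1 : AlgebraicIndependent ℂ
        fun v => IsScalarTower.toAlgHom ℂ P F (MvPolynomial.X v) :=
      (MvPolynomial.algebraicIndependent_X _ _).map' hinj
    refine AlgebraicIndependent.of_comp g ?_
    convert h1 using 1
    funext v
    exact hgx v
  exact (hx.map' (f := IsScalarTower.toAlgHom ℂ _ (SLFunctionField (m + 1)))
    (algebraMap_coordMatrix_injective _)).cardinalMk_le_trdeg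

end FunctionField
/-! ### The initial quiver -/

section Quiver

variable {n α β : ℕ}

theorem mem_vertex {p q : ℕ} : (p, q) ∈ (Finset.Icc 1 n ×ˢ Finset.Icc 1 n).erase (1, 1) ↔
    1 ≤ p ∧ p ≤ n ∧ 1 ≤ q ∧ q ≤ n ∧ ¬(p = 1 ∧ q = 1) := by
  simp only [Finset.mem_erase, Finset.mem_product, Finset.mem_Icc, ne_eq, Prod.mk.injEq]
  omega

theorem arrow_iff {i j p q : ℕ} : Arrow n α β (i, j) (p, q) ↔
    (((p = i + 1 ∧ q = j) ∨ (p = i ∧ q = j + 1) ∨ (i = p + 1 ∧ j = q + 1)) ∧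
      ¬((i = 1 ∨ j = 1) ∧ (p = 1 ∨ q = 1))) ∨
    ((i = α ∧ j = 1) ∧ p = α + 1 ∧ q = 1) ∨ ((i = 1 ∧ j = β) ∧ p = 1 ∧ q = β + 1) ∨
    ((i = n ∧ j = α + 1) ∧ p = 1 ∧ q = β + 1) ∨ ((i = 1 ∧ j = β + 1) ∧ p = n ∧ q = α) ∨
    ((i = β + 1 ∧ j = n) ∧ p = α + 1 ∧ q = 1) ∨ ((i = α + 1 ∧ j = 1) ∧ p = β ∧ q = n) := by
  simp only [Arrow, StandardArrow, AddedArrow, Prod.mk.injEq]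

/-- The number of arrows from `u` to `v`. -/
def arrowCount (n α β : ℕ) (u v : ℕ × ℕ) : ℕ := if Arrow n α β u v then 1 else 0

theorem ite_or_eq_add {P Q : Prop} [Decidable P] [Decidable Q] (h : ¬(P ∧ Q)) :
    (if P ∨ Q then 1 else 0 : ℕ) = (if P then 1 else 0) + (if Q then 1 else 0) := by
  by_cases hP : P <;> by_cases hQ : Q <;> simp_all

theorem arrowCount_eq {u v : ℕ × ℕ} {P : Prop} [Decidable P] (h : Arrow n α β u v ↔ P) :
    arrowCount n α β u v = if P then 1 else 0 := by
  unfold arrowCount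
  exact if_congr h rfl rfl

/-- In the absence of 2-cycles no arrows cancel, and positive and negative parts of the exchange
matrix count outgoing and incoming arrows. -/
theorem not_arrow_and_arrow (hα : 1 ≤ α) (hαβ : α < β) (hβ : β < n) {i j p q : ℕ}
    (hi : i ≤ n) (hj : j ≤ n) (hp : p ≤ n) (hq : q ≤ n)
    (h : Arrow n α β (i, j) (p, q)) : ¬Arrow n α β (p, q) (i, j) := by
  rw [arrow_iff] at h ⊢
  omega

variable (hα : 1 ≤ α) (hαβ : α < β) (hβ : β < n)
include hα hαβ hβ

/-- The possible arrows exclude one another, so their number is a sum of indicators. This makes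
exchange monomials factor and turns column equations into sums. -/
theorem arrow_from_interior {i j p q : ℕ} (hi1 : 2 ≤ i) (hi : i ≤ n) (hj1 : 2 ≤ j) (hj : j ≤ n)
    (hp : 1 ≤ p) (hq : 1 ≤ q) : arrowCount n α β (i, j) (p, q) =
      (if p = i + 1 ∧ q = j then 1 else 0) + (if p = i ∧ q = j + 1 then 1 else 0)
      + (if p = i - 1 ∧ q = j - 1 then 1 else 0)
      + (if (i = n ∧ j = α + 1) ∧ p = 1 ∧ q = β + 1 then 1 else 0)
      + (if (i = β + 1 ∧ j = n) ∧ p = α + 1 ∧ q = 1 then 1 else 0) := by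
  rw [arrowCount_eq (P := (((((p = i + 1 ∧ q = j) ∨ (p = i ∧ q = j + 1)) ∨ (p = i - 1 ∧ q = j - 1)) ∨ ((i = n ∧ j = α + 1) ∧ p = 1 ∧ q = β + 1)) ∨ ((i = β + 1 ∧ j = n) ∧ p = α + 1 ∧ q = 1)))
    (by rw [arrow_iff]; grind (splits := 40)),
    ite_or_eq_add (by omega), ite_or_eq_add (by omega), ite_or_eq_add (by omega), ite_or_eq_add (by omega)]

theorem arrow_to_interior {i j p q : ℕ} (hi1 : 2 ≤ i) (hi : i ≤ n) (hj1 : 2 ≤ j) (hj : j ≤ n)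
    (hp : 1 ≤ p) (hq : 1 ≤ q) : arrowCount n α β (p, q) (i, j) =
      (if p = i - 1 ∧ q = j then 1 else 0) + (if p = i ∧ q = j - 1 then 1 else 0)
      + (if p = i + 1 ∧ q = j + 1 then 1 else 0)
      + (if (i = n ∧ j = α) ∧ p = 1 ∧ q = β + 1 then 1 else 0)
      + (if (i = β ∧ j = n) ∧ p = α + 1 ∧ q = 1 then 1 else 0) := by
  rw [arrowCount_eq (P := (((((p = i - 1 ∧ q = j) ∨ (p = i ∧ q = j - 1)) ∨ (p = i + 1 ∧ q = j + 1)) ∨ ((i = n ∧ j = α) ∧ p = 1 ∧ q = β + 1)) ∨ ((i = β ∧ j = n) ∧ p = α + 1 ∧ q = 1)))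
    (by rw [arrow_iff]; grind (splits := 40)),
    ite_or_eq_add (by omega), ite_or_eq_add (by omega), ite_or_eq_add (by omega), ite_or_eq_add (by omega)]

theorem arrow_from_row {j p q : ℕ} (hj1 : 2 ≤ j) (hj : j ≤ n)
    (hp : 1 ≤ p) (hq : 1 ≤ q) : arrowCount n α β (1, j) (p, q) =
      (if p = 2 ∧ q = j then 1 else 0)
      + (if j = β ∧ p = 1 ∧ q = β + 1 then 1 else 0)
      + (if j = β + 1 ∧ p = n ∧ q = α then 1 else 0) := by
  rw [arrowCount_eq (P := (((p = 2 ∧ q = j) ∨ (j = β ∧ p = 1 ∧ q = β + 1)) ∨ (j = β + 1 ∧ p = n ∧ q = α)))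
    (by rw [arrow_iff]; grind (splits := 40)),
    ite_or_eq_add (by omega), ite_or_eq_add (by omega)]

theorem arrow_to_row {j p q : ℕ} (hj1 : 2 ≤ j) (hj : j ≤ n)
    (hp : 1 ≤ p) (hq : 1 ≤ q) : arrowCount n α β (p, q) (1, j) =
      (if p = 2 ∧ q = j + 1 then 1 else 0)
      + (if j = β + 1 ∧ p = 1 ∧ q = β then 1 else 0)
      + (if j = β + 1 ∧ p = n ∧ q = α + 1 then 1 else 0) := by
  rw [arrowCount_eq (P := (((p = 2 ∧ q = j + 1) ∨ (j = β + 1 ∧ p = 1 ∧ q = β)) ∨ (j = β + 1 ∧ p = n ∧ q = α + 1)))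
    (by rw [arrow_iff]; grind (splits := 40)),
    ite_or_eq_add (by omega), ite_or_eq_add (by omega)]

theorem arrow_from_col {i p q : ℕ} (hi1 : 2 ≤ i) (hi : i ≤ n)
    (hp : 1 ≤ p) (hq : 1 ≤ q) : arrowCount n α β (i, 1) (p, q) =
      (if p = i ∧ q = 2 then 1 else 0)
      + (if i = α ∧ p = α + 1 ∧ q = 1 then 1 else 0)
      + (if i = α + 1 ∧ p = β ∧ q = n then 1 else 0) := by
  rw [arrowCount_eq (P := (((p = i ∧ q = 2) ∨ (i = α ∧ p = α + 1 ∧ q = 1)) ∨ (i = α + 1 ∧ p = β ∧ q = n)))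
    (by rw [arrow_iff]; grind (splits := 40)),
    ite_or_eq_add (by omega), ite_or_eq_add (by omega)]

/-- For `α = 1` the added arrow into `(n, α)` ends in the first column, which accounts for the extra
term. -/
theorem arrow_to_col {i p q : ℕ} (hi1 : 2 ≤ i) (hi : i ≤ n)
    (hp : 1 ≤ p) (hq : 1 ≤ q) : arrowCount n α β (p, q) (i, 1) =
      (if p = i + 1 ∧ q = 2 then 1 else 0)
      + (if i = α + 1 ∧ p = α ∧ q = 1 then 1 else 0)
      + (if (i = n ∧ α = 1) ∧ p = 1 ∧ q = β + 1 then 1 else 0)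
      + (if i = α + 1 ∧ p = β + 1 ∧ q = n then 1 else 0) := by
  rw [arrowCount_eq (P := ((((p = i + 1 ∧ q = 2) ∨ (i = α + 1 ∧ p = α ∧ q = 1)) ∨ ((i = n ∧ α = 1) ∧ p = 1 ∧ q = β + 1)) ∨ (i = α + 1 ∧ p = β + 1 ∧ q = n)))
    (by rw [arrow_iff]; grind (splits := 40)),
    ite_or_eq_add (by omega), ite_or_eq_add (by omega), ite_or_eq_add (by omega)]

omit hα hαβ hβ in
theorem mat_initialSeed (u : mutableVertices n α β) (v : Vertex n) :
    (initialSeed n α β).mat u v = (arrowCount n α β u.1.1 v.1 : ℤ) - arrowCount n α β v.1 u.1.1 := by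
  unfold arrowCount
  simp only [initialSeed]
  push_cast
  rfl

theorem mat_toNat (u : mutableVertices n α β) (v : Vertex n) :
    ((initialSeed n α β).mat u v).toNat = arrowCount n α β u.1.1 v.1 ∧
    (-(initialSeed n α β).mat u v).toNat = arrowCount n α β v.1 u.1.1 := by
  rw [mat_initialSeed]
  obtain ⟨⟨⟨i, j⟩, hu⟩, hm⟩ := u
  obtain ⟨⟨p, q⟩, hv⟩ := v
  have h1 := mem_vertex.1 hu
  have h2 := mem_vertex.1 hv
  simp only
  have h3 := not_arrow_and_arrow hα hαβ hβ (i := i) (j := j) (p := p) (q := q)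
    (by omega) (by omega) (by omega) (by omega)
  unfold arrowCount
  split_ifs with h4 h5 <;> simp
  exact h3 h4 h5

/-- The function attached to a vertex, extended by one. -/
noncomputable def vertexVar (n α β p q : ℕ) : SLFunctionField n :=
  if (p, q) ∈ (Finset.Icc 1 n ×ˢ Finset.Icc 1 n).erase (1, 1) then phi (genericMatrix n) α β p q
  else 1

omit hα hαβ hβ in
theorem prod_vertex (c : Prop) [Decidable c] (p q : ℕ) :
    ∏ v : Vertex n, (initialSeed n α β).var v ^ (if c ∧ v.1.1 = p ∧ v.1.2 = q then 1 else 0)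
      = if c then vertexVar n α β p q else 1 := by
  by_cases hc : c
  · simp only [hc, true_and, if_true]
    unfold vertexVar
    split_ifs with h
    · rw [Finset.prod_eq_single ⟨_, h⟩]
      · simp [initialSeed]
      · rintro ⟨⟨a, b⟩, hv⟩ _ hne
        rw [if_neg, pow_zero]
        rintro ⟨rfl, rfl⟩
        exact hne rfl
      · simp
    · refine Finset.prod_eq_one fun v _ => ?_
      rw [if_neg, pow_zero]
      rintro ⟨rfl, rfl⟩
      exact h v.2
  · simp [hc]

omit hα hαβ hβ in
theorem prod_vertex' (p q : ℕ) :
    ∏ v : Vertex n, (initialSeed n α β).var v ^ (if v.1.1 = p ∧ v.1.2 = q then 1 else 0)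
      = vertexVar n α β p q := by
  simpa using prod_vertex (n := n) (α := α) (β := β) True p q

theorem exchangeVar_interior {i j : ℕ} (hi1 : 2 ≤ i) (hi : i ≤ n) (hj1 : 2 ≤ j) (hj : j ≤ n)
    (k : mutableVertices n α β) (hk : k.1.1 = (i, j)) :
    (initialSeed n α β).exchangeVar k =
      (vertexVar n α β (i + 1) j * vertexVar n α β i (j + 1) * vertexVar n α β (i - 1) (j - 1)
        * (if i = n ∧ j = α + 1 then vertexVar n α β 1 (β + 1) else 1)
        * (if i = β + 1 ∧ j = n then vertexVar n α β (α + 1) 1 else 1)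
      + vertexVar n α β (i - 1) j * vertexVar n α β i (j - 1) * vertexVar n α β (i + 1) (j + 1)
        * (if i = n ∧ j = α then vertexVar n α β 1 (β + 1) else 1)
        * (if i = β ∧ j = n then vertexVar n α β (α + 1) 1 else 1)) / phi (genericMatrix n) α β i j := by
  have e1 : ∀ v : Vertex n, _ := fun v => arrow_from_interior hα hαβ hβ hi1 hi hj1 hj
    (mem_vertex.1 v.2).1 (mem_vertex.1 v.2).2.2.1
  have e2 : ∀ v : Vertex n, _ := fun v => arrow_to_interior hα hαβ hβ hi1 hi hj1 hj
    (mem_vertex.1 v.2).1 (mem_vertex.1 v.2).2.2.1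
  unfold Seed.exchangeVar
  simp only [(mat_toNat hα hαβ hβ k _).1, (mat_toNat hα hαβ hβ k _).2, hk, e1, e2, pow_add,
    Finset.prod_mul_distrib, prod_vertex, prod_vertex']
  simp only [initialSeed, hk]

theorem exchangeVar_row (k : mutableVertices n α β) (hk : k.1.1 = (1, β + 1)) :
    (initialSeed n α β).exchangeVar k =
      (vertexVar n α β 2 (β + 1) * vertexVar n α β n α
      + vertexVar n α β 2 (β + 2) * vertexVar n α β 1 β * vertexVar n α β n (α + 1)) /
        phi (genericMatrix n) α β 1 (β + 1) := by
  have e1 : ∀ v : Vertex n, _ := fun v => arrow_from_row hα hαβ hβ (j := β + 1) (by omega) (by omega)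
    (mem_vertex.1 v.2).1 (mem_vertex.1 v.2).2.2.1
  have e2 : ∀ v : Vertex n, _ := fun v => arrow_to_row hα hαβ hβ (j := β + 1) (by omega) (by omega)
    (mem_vertex.1 v.2).1 (mem_vertex.1 v.2).2.2.1
  unfold Seed.exchangeVar
  simp only [(mat_toNat hα hαβ hβ k _).1, (mat_toNat hα hαβ hβ k _).2, hk, e1, e2, pow_add,
    Finset.prod_mul_distrib, prod_vertex, prod_vertex']
  simp [initialSeed, hk]

theorem exchangeVar_col (k : mutableVertices n α β) (hk : k.1.1 = (α + 1, 1)) :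
    (initialSeed n α β).exchangeVar k =
      (vertexVar n α β (α + 1) 2 * vertexVar n α β β n
      + vertexVar n α β (α + 2) 2 * vertexVar n α β α 1 * vertexVar n α β (β + 1) n) /
        phi (genericMatrix n) α β (α + 1) 1 := by
  have e1 : ∀ v : Vertex n, _ := fun v => arrow_from_col hα hαβ hβ (i := α + 1) (by omega) (by omega)
    (mem_vertex.1 v.2).1 (mem_vertex.1 v.2).2.2.1
  have e2 : ∀ v : Vertex n, _ := fun v => arrow_to_col hα hαβ hβ (i := α + 1) (by omega) (by omega)
    (mem_vertex.1 v.2).1 (mem_vertex.1 v.2).2.2.1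
  unfold Seed.exchangeVar
  simp only [(mat_toNat hα hαβ hβ k _).1, (mat_toNat hα hαβ hβ k _).2, hk, e1, e2, pow_add,
    Finset.prod_mul_distrib, prod_vertex, prod_vertex']
  have h0 : ¬(α + 1 = n ∧ α = 1) := by omega
  simp [initialSeed, hk, h0]

end Quiver
/-! ### The exchange matrix has full rank -/

section Rank

variable {n α β : ℕ}

/-- The mixed second difference of a function on the grid. -/
def secondDiff (c : ℕ → ℕ → ℤ) (p q : ℕ) : ℤ :=
  c (p + 1) (q + 1) - c (p + 1) q - c p (q + 1) + c p q

/-- The contribution of the added arrows at an interior vertex of the last row or column. -/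
def addedTerm (n α β : ℕ) (a b : ℤ) (p q : ℕ) : ℤ :=
  (if p = n then b * ((if q = α + 1 then 1 else 0) - (if q = α then 1 else 0)) else 0)
    + (if q = n then a * ((if p = β + 1 then 1 else 0) - (if p = β then 1 else 0)) else 0)

theorem eq_zero_of_secondDiff_eq_zero {c : ℕ → ℕ → ℤ} (hr : ∀ q, c 1 q = 0) (hc : ∀ p, c p 1 = 0)
    (hd : ∀ p q, 1 ≤ p → p < n → 1 ≤ q → q < n → secondDiff c p q = 0) :
    ∀ p q, 1 ≤ p → p ≤ n → 1 ≤ q → q ≤ n → c p q = 0 := by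
  intro p
  induction p with
  | zero => omega
  | succ p ihp =>
    intro q
    induction q with
    | zero => omega
    | succ q ihq =>
      intro _ hp _ hq
      by_cases hp1 : p = 0
      · subst hp1; exact hr _
      by_cases hq1 : q = 0
      · subst hq1; exact hc _
      have h := hd p q (by omega) (by omega) (by omega) (by omega)
      unfold secondDiff at h
      have h1 := ihp (q + 1) (by omega) (by omega) (by omega) (by omega)
      have h2 := ihp q (by omega) (by omega) (by omega) (by omega)
      have h3 := ihq (by omega) (by omega) (by omega) (by omega)
      omega

theorem sum_secondDiff_row (c : ℕ → ℕ → ℤ) (n q : ℕ) :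
    ∑ p ∈ Finset.range n, secondDiff c (p + 1) q
      = (c (n + 1) (q + 1) - c (n + 1) q) - (c 1 (q + 1) - c 1 q) := by
  rw [← Finset.sum_range_sub (fun p => c (p + 1) (q + 1) - c (p + 1) q) n]
  refine Finset.sum_congr rfl fun p _ => ?_
  unfold secondDiff
  ring

theorem sum_secondDiff_col (c : ℕ → ℕ → ℤ) (n p : ℕ) :
    ∑ q ∈ Finset.range n, secondDiff c p (q + 1)
      = (c (p + 1) (n + 1) - c p (n + 1)) - (c (p + 1) 1 - c p 1) := by
  rw [← Finset.sum_range_sub (fun q => c (p + 1) (q + 1) - c p (q + 1)) n]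
  refine Finset.sum_congr rfl fun q _ => ?_
  unfold secondDiff
  ring

theorem sum_range_ite_succ {n m : ℕ} (h1 : 1 ≤ m) (hm : m ≤ n) (x : ℤ) :
    ∑ p ∈ Finset.range n, (if p + 1 = m then x else 0) = x := by
  rw [Finset.sum_eq_single (m - 1)]
  · rw [if_pos (by omega)]
  · intro b _ hb
    rw [if_neg (by omega)]
  · intro h
    exact absurd (Finset.mem_range.2 (by omega)) h

/-- The interior equations say that the mixed second difference of `c` is constant along diagonals,
up to corrections in the last row and column. The boundary equations fix these constants, except `ε`
on the main diagonal. Telescoping sums along rows and columns then force all remaining parameters to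
vanish. -/
theorem eq_zero_of_grid_equations (hα : 1 ≤ α) (hαβ : α < β) (hβ : β < n) {c : ℕ → ℕ → ℤ}
    (hr : ∀ q, q ≠ β + 1 → c 1 q = 0) (hc : ∀ p, p ≠ α + 1 → c p 1 = 0)
    (hn : ∀ q, c (n + 1) q = 0) (hn' : ∀ p, c p (n + 1) = 0)
    (e1 : ∀ q, 2 ≤ q → q ≤ n → c 2 (q + 1) - c 2 q - (if q = β then c 1 (β + 1) else 0)
      + (if q = β + 1 then c n (α + 1) - c n α else 0) = 0)
    (e2 : ∀ p, 2 ≤ p → p ≤ n → c (p + 1) 2 - c p 2 - (if p = α then c (α + 1) 1 else 0)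
      + (if p = n ∧ α = 1 then c 1 (β + 1) else 0)
      + (if p = α + 1 then c (β + 1) n - c β n else 0) = 0)
    (e : ∀ p q, 1 ≤ p → p < n → 1 ≤ q → q < n → secondDiff c (p + 1) (q + 1) - secondDiff c p q
      = addedTerm n α β (c (α + 1) 1) (c 1 (β + 1)) (p + 1) (q + 1)) :
    ∀ p q, 1 ≤ p → p ≤ n → 1 ≤ q → q ≤ n → c p q = 0 := by
  obtain ⟨a, ha⟩ : ∃ a, a = c (α + 1) 1 := ⟨_, rfl⟩
  obtain ⟨b, hb⟩ : ∃ b, b = c 1 (β + 1) := ⟨_, rfl⟩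
  obtain ⟨x, hx⟩ : ∃ x, x = c n α - c n (α + 1) := ⟨_, rfl⟩
  obtain ⟨y, hy⟩ : ∃ y, y = c β n - c (β + 1) n := ⟨_, rfl⟩
  obtain ⟨ε, hε⟩ : ∃ ε, ε = secondDiff c 1 1 := ⟨_, rfl⟩
  rw [← ha, ← hb] at e
  have hJ : ∀ p q, p ≠ n → q ≠ n → addedTerm n α β a b p q = 0 := fun p q h1 h2 => by
    unfold addedTerm
    rw [if_neg h1, if_neg h2, add_zero]
  have hd : ∀ p q, 1 ≤ p → p ≤ n → 1 ≤ q → q ≤ n → secondDiff c p q =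
      (if p = q + α then a + y else 0) + (if q = p + β then b + x else 0) + (if p = q then ε else 0)
      + addedTerm n α β a b p q := by
    intro p
    induction p with
    | zero => omega
    | succ p ih =>
      intro q hp1 hp hq1 hq
      obtain ⟨r, rfl⟩ : ∃ r, q = r + 1 := ⟨q - 1, by omega⟩
      by_cases hp0 : p = 0
      · subst hp0
        by_cases hr0 : r = 0
        · subst hr0
          rw [hJ _ _ (by omega) (by omega), if_neg (by omega), if_neg (by omega), if_pos rfl, ← hε]
          ring
        · have h := e1 (r + 1) (by omega) (by omega)
          have h1 : c 1 (r + 1 + 1) = if r + 1 = β then b else 0 := by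
            split_ifs with h0
            · rw [h0, hb]
            · exact hr _ (by omega)
          have h2 : c 1 (r + 1) = if r + 1 = β + 1 then b else 0 := by
            split_ifs with h0
            · rw [h0, hb]
            · exact hr _ (by omega)
          have h3 : addedTerm n α β a b (0 + 1) (r + 1) = 0 := by
            unfold addedTerm
            rw [if_neg (by omega)]
            rw [if_neg (show ¬0 + 1 = β + 1 by omega), if_neg (show ¬0 + 1 = β by omega)]
            simp
          rw [h3, if_neg (by omega), if_neg (show ¬0 + 1 = r + 1 by omega)]
          rw [← hb] at h
          unfold secondDiff
          simp only [Nat.zero_add, Nat.reduceAdd]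
          rw [h1, h2]
          split_ifs at h ⊢ <;> omega
      · by_cases hr0 : r = 0
        · subst hr0
          have h := e2 (p + 1) (by omega) (by omega)
          have h1 : c (p + 1 + 1) 1 = if p + 1 = α then a else 0 := by
            split_ifs with h0
            · rw [h0, ha]
            · exact hc _ (by omega)
          have h2 : c (p + 1) 1 = if p + 1 = α + 1 then a else 0 := by
            split_ifs with h0
            · rw [h0, ha]
            · exact hc _ (by omega)
          have h3 : addedTerm n α β a b (p + 1) (0 + 1) = if p + 1 = n ∧ α = 1 then -b else 0 := by
            unfold addedTerm
            rw [if_neg (show ¬0 + 1 = n by omega), if_neg (show ¬0 + 1 = α + 1 by omega)]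
            by_cases h4 : p + 1 = n <;> by_cases h5 : α = 1
            · simp [h4, h5]
            · rw [if_neg (show ¬0 + 1 = α by omega)]; simp [h5]
            · simp [h4]
            · simp [h4]
          rw [h3, if_neg (show ¬0 + 1 = p + 1 + β by omega), if_neg (show ¬p + 1 = 0 + 1 by omega)]
          rw [← ha, ← hb] at h
          unfold secondDiff
          simp only [Nat.zero_add, Nat.reduceAdd]
          rw [h1, h2]
          split_ifs at h ⊢ <;> omega
        · have h := e p r (by omega) (by omega) (by omega) (by omega)
          rw [ih r (by omega) (by omega) (by omega) (by omega),
            hJ p r (by omega) (by omega)] at h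
          simp only [show p + 1 = r + 1 + α ↔ p = r + α by omega,
            show r + 1 = p + 1 + β ↔ r = p + β by omega, Nat.add_right_cancel_iff]
          omega
  have hx' := hd n α (by omega) (by omega) (by omega) (by omega)
  have hy' := hd β n (by omega) (by omega) (by omega) (by omega)
  have hxd : secondDiff c n α = x := by
    unfold secondDiff
    rw [hn, hn, hx]; ring
  have hyd : secondDiff c β n = y := by
    unfold secondDiff
    rw [hn', hn', hy]; ring
  rw [hxd, addedTerm, if_pos rfl, if_neg (show ¬α = α + 1 by omega), if_pos rfl,
    if_neg (show ¬α = n by omega), if_neg (show ¬α = n + β by omega),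
    if_neg (show ¬n = α by omega)] at hx'
  rw [hyd, addedTerm, if_neg (show ¬β = n by omega), if_pos rfl, if_neg (show ¬β = β + 1 by omega),
    if_pos rfl, if_neg (show ¬β = n + α by omega), if_neg (show ¬β = n by omega)] at hy'
  -- At `(n, α)` and `(β, n)` one finds that `b + x` is `a + y` if `n = 2 * α` and zero otherwise,
  -- and that `a + y` is `b + x` if `n = 2 * β` and zero otherwise. Both conditions cannot hold at
  -- once.
  have hxy : a + y = 0 ∧ b + x = 0 := by
    split_ifs at hx' hy' <;> constructor <;> linarith
  rw [hxy.1, hxy.2] at hd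
  simp only [ite_self, zero_add] at hd
  have hrow : ∀ q, 1 ≤ q → q ≤ n → ε + (if q = α + 1 then b else 0) - (if q = α then b else 0)
      = (if q = β + 1 then b else 0) - (if q = β then b else 0) := fun q h1 h2 => by
    have h := sum_secondDiff_row c n q
    have h3 : ∀ p ∈ Finset.range n, secondDiff c (p + 1) q = (if p + 1 = q then ε else 0)
        + ((if p + 1 = n then (b * ((if q = α + 1 then 1 else 0) - (if q = α then 1 else 0))) else 0)
        + ((if p + 1 = β + 1 then (if q = n then a else 0) else 0)
          + (if p + 1 = β then (if q = n then -a else 0) else 0))) := fun p hp => by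
      rw [hd _ _ (by omega) (by have := Finset.mem_range.1 hp; omega) h1 h2, addedTerm]
      congr 2
      split_ifs <;> omega
    rw [Finset.sum_congr rfl h3, Finset.sum_add_distrib, Finset.sum_add_distrib,
      Finset.sum_add_distrib, sum_range_ite_succ h1 h2, sum_range_ite_succ (by omega) le_rfl,
      sum_range_ite_succ (by omega) (by omega), sum_range_ite_succ (by omega) (by omega), hn, hn] at h
    have h4 : c 1 (q + 1) = if q = β then b else 0 := by
      split_ifs with h0
      · rw [h0, hb]
      · exact hr _ (by omega)
    have h5 : c 1 q = if q = β + 1 then b else 0 := by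
      split_ifs with h0
      · rw [h0, hb]
      · exact hr _ (by omega)
    rw [h4, h5] at h
    split_ifs at h ⊢ <;> linarith
  -- The equation at `α` gives `ε = b`, while the one at `β` gives `ε = -b`, or `ε = -2b` if `β = α
  -- + 1`.
  have hb0 : b = 0 ∧ ε = 0 := by
    have h1 := hrow α (by omega) (by omega)
    have h2 := hrow (β + 1) (by omega) (by omega)
    have h3 := hrow β (by omega) (by omega)
    rw [if_neg (by omega), if_pos rfl, if_neg (by omega), if_neg (by omega)] at h1
    rw [if_neg (by omega), if_neg (by omega), if_pos rfl, if_neg (by omega)] at h2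
    rw [if_neg (show ¬β = α by omega), if_neg (show ¬β = β + 1 by omega), if_pos rfl] at h3
    split_ifs at h3 <;> constructor <;> linarith
  -- With `b = ε = 0`, only the added arrow at `(β + 1, n)` contributes to this sum, which therefore
  -- isolates `a`.
  have hcol := sum_secondDiff_col c n (β + 1)
  have h3 : ∀ q ∈ Finset.range n, secondDiff c (β + 1) (q + 1)
      = if q + 1 = n then a else 0 := fun q hq => by
    rw [hd _ _ (by omega) (by omega) (by omega) (by have := Finset.mem_range.1 hq; omega), addedTerm,
      hb0.1, hb0.2, if_pos rfl, if_neg (show ¬β + 1 = β by omega)]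
    simp
  rw [Finset.sum_congr rfl h3, sum_range_ite_succ (by omega) le_rfl, hn', hn', hc (β + 1 + 1) (by omega),
    hc (β + 1) (by omega)] at hcol
  have ha0 : a = 0 := by simpa using hcol
  refine eq_zero_of_secondDiff_eq_zero (n := n) (fun q => ?_) (fun p => ?_) fun p q h1 h2 h3 h4 => ?_
  · by_cases h : q = β + 1
    · rw [h, ← hb, hb0.1]
    · exact hr q h
  · by_cases h : p = α + 1
    · rw [h, ← ha, ha0]
    · exact hc p h
  · rw [hd p q h1 h2.le h3 h4.le, hb0.2, hJ _ _ (by omega) (by omega)]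
    simp

variable (hα : 1 ≤ α) (hαβ : α < β) (hβ : β < n)
include hα hαβ hβ

/-- A combination of the mutable vertices, as a function on the grid. -/
noncomputable def gridFun (g : mutableVertices n α β → ℤ) (p q : ℕ) : ℤ :=
  open Classical in
  if h : ∃ hv : (p, q) ∈ (Finset.Icc 1 n ×ˢ Finset.Icc 1 n).erase (1, 1),
    (⟨(p, q), hv⟩ : Vertex n) ∈ mutableVertices n α β then g ⟨⟨(p, q), h.1⟩, h.2⟩ else 0

omit hα hαβ hβ in
theorem sum_ite_eq_gridFun (g : mutableVertices n α β → ℤ) [Fintype (mutableVertices n α β)]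
    (c : Prop) [Decidable c] (p q : ℕ) :
    ∑ k, g k * ((if c ∧ k.1.1.1 = p ∧ k.1.1.2 = q then 1 else 0 : ℕ) : ℤ)
      = if c then gridFun g p q else 0 := by
  by_cases hc : c
  · simp only [hc, true_and, if_true]
    unfold gridFun
    split_ifs with h
    · obtain ⟨hv, hm⟩ := h
      rw [Finset.sum_eq_single ⟨⟨(p, q), hv⟩, hm⟩]
      · simp
      · rintro ⟨⟨⟨a, b⟩, hv'⟩, hm'⟩ _ hne
        rw [if_neg, Nat.cast_zero, mul_zero]
        rintro ⟨rfl, rfl⟩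
        exact hne rfl
      · simp
    · refine Finset.sum_eq_zero fun k _ => ?_
      rw [if_neg, Nat.cast_zero, mul_zero]
      rintro ⟨rfl, rfl⟩
      exact h ⟨k.1.2, k.2⟩
  · simp [hc]

omit hα hαβ hβ in
theorem sum_ite_eq_gridFun' (g : mutableVertices n α β → ℤ) [Fintype (mutableVertices n α β)]
    (p q : ℕ) :
    ∑ k, g k * ((if k.1.1.1 = p ∧ k.1.1.2 = q then 1 else 0 : ℕ) : ℤ) = gridFun g p q := by
  simpa using sum_ite_eq_gridFun g True p q

omit hα hαβ hβ in
theorem gridFun_eq_zero (g : mutableVertices n α β → ℤ) {p q : ℕ}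
    (h : p = 0 ∨ q = 0 ∨ n < p ∨ n < q ∨ (p = 1 ∧ q ≠ β + 1) ∨ (q = 1 ∧ p ≠ α + 1)) :
    gridFun g p q = 0 := by
  unfold gridFun
  rw [dif_neg]
  rintro ⟨hv, hm⟩
  have h1 := mem_vertex.1 hv
  simp only [mutableVertices, Set.mem_ofPred_eq, Prod.mk.injEq] at hm
  omega

/-- The coefficients of a relation among rows, extended by zero to the grid, satisfy one difference
equation for each column of the matrix, frozen columns included. -/
theorem linearIndependent_mat :
    LinearIndependent ℤ (initialSeed n α β).mat := by
  classical
  have : Fintype (mutableVertices n α β) := Fintype.ofFinite _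
  rw [Fintype.linearIndependent_iff]
  intro g hg
  have hv : ∀ i j, 1 ≤ i → i ≤ n → 1 ≤ j → j ≤ n → ¬(i = 1 ∧ j = 1) →
      ∑ k, g k * ((arrowCount n α β k.1.1 (i, j) : ℤ)) = ∑ k, g k * (arrowCount n α β (i, j) k.1.1 : ℤ) := by
    intro i j h1 h2 h3 h4 h5
    have h := congrFun hg ⟨(i, j), mem_vertex.2 ⟨h1, h2, h3, h4, h5⟩⟩
    simp only [Finset.sum_apply, Pi.smul_apply, smul_eq_mul, mat_initialSeed, mul_sub,
      Finset.sum_sub_distrib, Pi.zero_apply] at h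
    exact sub_eq_zero.1 h
  have hk : ∀ k : mutableVertices n α β, 1 ≤ k.1.1.1 ∧ 1 ≤ k.1.1.2 := fun k =>
    ⟨(mem_vertex.1 k.1.2).1, (mem_vertex.1 k.1.2).2.2.1⟩
  have key := eq_zero_of_grid_equations hα hαβ hβ (c := gridFun g)
    (fun q hq => gridFun_eq_zero g (by omega)) (fun p hp => gridFun_eq_zero g (by omega))
    (fun q => gridFun_eq_zero g (by omega)) (fun p => gridFun_eq_zero g (by omega))
    (fun q h1 h2 => by
      have h := hv 1 q (by omega) (by omega) (by omega) (by omega) (by omega)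
      have e1 : ∀ k : mutableVertices n α β, _ := fun k =>
        arrow_from_row hα hαβ hβ h1 h2 (hk k).1 (hk k).2
      have e2 : ∀ k : mutableVertices n α β, _ := fun k =>
        arrow_to_row hα hαβ hβ h1 h2 (hk k).1 (hk k).2
      simp only [Prod.mk.eta] at e1 e2
      simp only [e1, e2, Nat.cast_add, mul_add, Finset.sum_add_distrib, sum_ite_eq_gridFun,
        sum_ite_eq_gridFun'] at h
      rw [gridFun_eq_zero g (p := 1) (q := β) (by omega)] at h
      split_ifs at h ⊢ <;> omega)
    (fun p h1 h2 => by
      have h := hv p 1 (by omega) (by omega) (by omega) (by omega) (by omega)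
      have e1 : ∀ k : mutableVertices n α β, _ := fun k =>
        arrow_from_col hα hαβ hβ h1 h2 (hk k).1 (hk k).2
      have e2 : ∀ k : mutableVertices n α β, _ := fun k =>
        arrow_to_col hα hαβ hβ h1 h2 (hk k).1 (hk k).2
      simp only [Prod.mk.eta] at e1 e2
      simp only [e1, e2, Nat.cast_add, mul_add, Finset.sum_add_distrib, sum_ite_eq_gridFun,
        sum_ite_eq_gridFun'] at h
      rw [gridFun_eq_zero g (p := α) (q := 1) (by omega)] at h
      split_ifs at h ⊢ <;> omega)
    (fun p q h1 h2 h3 h4 => by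
      have h := hv (p + 1) (q + 1) (by omega) (by omega) (by omega) (by omega) (by omega)
      have e1 : ∀ k : mutableVertices n α β, _ := fun k =>
        arrow_from_interior hα hαβ hβ (i := p + 1) (j := q + 1) (by omega) (by omega) (by omega)
          (by omega) (hk k).1 (hk k).2
      have e2 : ∀ k : mutableVertices n α β, _ := fun k =>
        arrow_to_interior hα hαβ hβ (i := p + 1) (j := q + 1) (by omega) (by omega) (by omega)
          (by omega) (hk k).1 (hk k).2
      simp only [Prod.mk.eta] at e1 e2
      simp only [e1, e2, Nat.cast_add, mul_add, Finset.sum_add_distrib, sum_ite_eq_gridFun,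
        sum_ite_eq_gridFun', Nat.add_sub_cancel] at h
      unfold secondDiff addedTerm
      have h5 : (if p + 1 = n then gridFun g 1 (β + 1) *
            ((if q + 1 = α + 1 then 1 else 0) - (if q + 1 = α then 1 else 0)) else 0)
          = (if p + 1 = n ∧ q + 1 = α + 1 then gridFun g 1 (β + 1) else 0)
            - (if p + 1 = n ∧ q + 1 = α then gridFun g 1 (β + 1) else 0) := by
        by_cases h6 : p + 1 = n
        · simp only [h6, if_true, true_and, mul_sub, mul_ite, mul_one, mul_zero]
        · simp [h6]
      have h6 : (if q + 1 = n then gridFun g (α + 1) 1 *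
            ((if p + 1 = β + 1 then 1 else 0) - (if p + 1 = β then 1 else 0)) else 0)
          = (if p + 1 = β + 1 ∧ q + 1 = n then gridFun g (α + 1) 1 else 0)
            - (if p + 1 = β ∧ q + 1 = n then gridFun g (α + 1) 1 else 0) := by
        by_cases h6 : q + 1 = n
        · simp only [h6, if_true, and_true, mul_sub, mul_ite, mul_one, mul_zero]
        · simp [h6]
      rw [h5, h6]
      omega)
  intro k
  have h1 := mem_vertex.1 k.1.2
  have h2 := key k.1.1.1 k.1.1.2 h1.1 h1.2.1 h1.2.2.1 h1.2.2.2.1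
  unfold gridFun at h2
  rwa [dif_pos ⟨k.1.2, k.2⟩] at h2

end Rank
-- Integral Laurent subrings of a seed and of its mutations
namespace Seed

variable {V : Type} [Fintype V] [DecidableEq V] {M : Set V} {K : Type} [Field K]

/-- The ring of integral Laurent polynomials in the cluster of `S`, as a subring. -/
noncomputable def laurentSubring (S : Seed V M K) : Subring K := (S.laurentRing ℤ).toSubring

theorem var_mem_laurentSubring (S : Seed V M K) (j : V) : S.var j ∈ S.laurentSubring :=
  S.var_mem_laurentRing j

theorem inv_mem_laurentSubring (S : Seed V M K) (k : M) : (S.var k)⁻¹ ∈ S.laurentSubring :=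
  S.inv_mem_laurentRing k

theorem exchangeVar_mem_laurentSubring_mutate (S : Seed V M K) (k : M) :
    S.exchangeVar k ∈ (S.mutate k).laurentSubring := by
  have h := (S.mutate k).var_mem_laurentSubring k
  rwa [mutate_var_self, ← exchangeVar_eq] at h

theorem mem_adjoin_of_mem_laurentSubring (F : Type) [Field F] [Algebra F K] (S : Seed V M K) {z : K}
    (hz : z ∈ S.laurentSubring) : z ∈ IntermediateField.adjoin F (Set.range S.var) := by
  change z ∈ S.laurentRing ℤ at hz
  induction hz using Algebra.adjoin_induction with
  | mem x hx =>
    rcases hx with hx | ⟨k, rfl⟩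
    · exact IntermediateField.subset_adjoin _ _ hx
    · exact inv_mem (IntermediateField.subset_adjoin _ _ ⟨k, rfl⟩)
  | algebraMap r => simp
  | add x y _ _ hx hy => exact add_mem hx hy
  | mul x y _ _ hx hy => exact mul_mem hx hy

variable {F : Type} [Field F] [CharZero F] [Algebra F K] {S : Seed V M K}

theorem IsFull.var_mem_laurentSubring_mutate (h : S.IsFull F)
    (hV : Cardinal.mk V ≤ Algebra.trdeg F K) (k : M) (j : V) :
    S.var j ∈ (S.mutate k).laurentSubring := by
  by_cases hj : j = k
  · subst hj
    have h1 := h.mutate_var_mul hV k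
    have h2 : (S.mutate k).var k ≠ 0 := (h.mutate hV k).var_ne_zero hV k
    rw [← mul_div_cancel_left₀ (S.var k) h2, h1, div_eq_mul_inv]
    exact mul_mem (aeval_mem_laurentRing _ _) (inv_mem_laurentRing _ _)
  · rw [← S.mutate_var_of_ne k hj]
    exact var_mem_laurentSubring _ _

theorem IsFull.mem_upperClusterAlgebra_of_mem_laurentSubring [A : Algebra ℤ K] (h : S.IsFull F)
    (hV : Cardinal.mk V ≤ Algebra.trdeg F K) {z : K} (h0 : z ∈ S.laurentSubring)
    (h1 : ∀ k, z ∈ (S.mutate k).laurentSubring) :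
    z ∈ S.upperClusterAlgebra ℤ ∧ z ∈ S.upperClusterAlgebra F := by
  -- The instance found in the final statement may differ from the canonical one; uniqueness of the
  -- `ℤ`-algebra structure identifies them.
  obtain rfl : A = Ring.toIntAlgebra K := Subsingleton.elim _ _
  have h2 := h.mem_upperClusterAlgebra hV h0 h1
  exact ⟨h2, S.upperClusterAlgebra_int_subset F h2⟩

end Seed

/-! ### Reconstruction when both gauge factors are invertible -/

section Interior

variable {K : Type} [Field K] {n α β : ℕ} {X : Matrix (Fin n) (Fin n) K} {y : ℕ → ℕ → K} {s t : K}

/-- The factor depends only on the diagonal; this is why it cancels consistently in exchange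
relations. -/
theorem gaugeFactor_congr {a b : K} {i j i' j' : ℕ} (h : i + j' = i' + j) :
    gaugeFactor n α β a b i j = gaugeFactor n α β a b i' j' := by
  unfold gaugeFactor
  rw [if_congr (show i + α = n + j ↔ i' + α = n + j' by omega) rfl rfl,
    if_congr (show j + β = n + i ↔ j' + β = n + i' by omega) rfl rfl]

theorem gaugeFactor_ne_zero {a b : K} (ha : a ≠ 0) (hb : b ≠ 0) (i j : ℕ) :
    gaugeFactor n α β a b i j ≠ 0 := by
  unfold gaugeFactor
  refine mul_ne_zero ?_ ?_ <;> split_ifs <;> first | assumption | exact one_ne_zero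

theorem gaugeFactor_mem {L : Subring K} {a b : K} (ha : a ∈ L) (hb : b ∈ L) (i j : ℕ) :
    gaugeFactor n α β a b i j ∈ L := by
  unfold gaugeFactor
  refine mul_mem ?_ ?_ <;> split_ifs <;> first | assumption | exact one_mem L

theorem gaugeFactor_inv (a b : K) (i j : ℕ) :
    (gaugeFactor n α β a b i j)⁻¹ = gaugeFactor n α β a⁻¹ b⁻¹ i j := by
  unfold gaugeFactor
  rw [mul_inv]
  congr 1 <;> split_ifs <;> simp

/-- Invertible `a` and `b` let one pass from the `φ_ij` to the minors of `y`. These give the entries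
of `y`, and the multipliers `s` and `t` have invertible denominators. -/
theorem IsGauge.entry_mem {L : Subring K} (h : IsGauge n α β (entry X) y s t) (hα1 : 1 ≤ α)
    (hα : α < n) (hαβ : α ≠ β) (hβ1 : 1 ≤ β) (hβ : β < n)
    (h0 : ∀ i j, 1 ≤ i → i ≤ n → 1 ≤ j → j ≤ n → stdMinor n y i j ≠ 0)
    (hm : ∀ i j, 1 ≤ i → i ≤ n → 1 ≤ j → j ≤ n → phi X α β i j ∈ L)
    (hA : (phi X α β (α + 1) 1)⁻¹ ∈ L) (hB : (phi X α β 1 (β + 1))⁻¹ ∈ L) (k : ℕ × ℕ)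
    (hinv : ∀ i j, 2 ≤ i → i ≤ n → 2 ≤ j → j ≤ n → (i, j) ≠ k → (phi X α β i j)⁻¹ ∈ L)
    (hk : ∀ i j, 1 ≤ i → i < n → 1 ≤ j → j < n → (i + 1, j + 1) = k →
      stdExchange n y i j / stdMinor n y (i + 1) (j + 1) ∈ L) :
    ∀ i j, 1 ≤ i → i ≤ n → 1 ≤ j → j ≤ n → entry X i j ∈ L := by
  obtain ⟨ha0, hb0⟩ := h.phi_ne_zero hα hαβ hβ
  have haL := hm (α + 1) 1 (by omega) (by omega) (by omega) (by omega)
  have hbL := hm 1 (β + 1) (by omega) (by omega) (by omega) (by omega)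
  have hF : ∀ i j, i ≤ n → j ≤ n → stdMinor n y i j
      = gaugeFactor n α β (phi X α β (α + 1) 1)⁻¹ (phi X α β 1 (β + 1))⁻¹ i j * phi X α β i j :=
    fun i j hi hj => by
      rw [h.phi_eq hα hαβ hβ hi hj, ← gaugeFactor_inv, inv_mul_cancel_left₀
        (gaugeFactor_ne_zero ha0 hb0 i j)]
  have hFm : ∀ i j, 1 ≤ i → i ≤ n → 1 ≤ j → j ≤ n → stdMinor n y i j ∈ L := fun i j h1 h2 h3 h4 => by
    rw [hF i j h2 h4]
    exact mul_mem (gaugeFactor_mem hA hB i j) (hm i j h1 h2 h3 h4)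
  have hFinv : ∀ i j, i ≤ n → j ≤ n → (phi X α β i j)⁻¹ ∈ L → (stdMinor n y i j)⁻¹ ∈ L :=
    fun i j hi hj hφ => by
      rw [hF i j hi hj, mul_inv, gaugeFactor_inv, inv_inv, inv_inv]
      exact mul_mem (gaugeFactor_mem haL hbL i j) hφ
  have hy := entries_mem_of_stdMinor h0 hFm k
    (fun i j h1 h2 h3 h4 h5 => hFinv i j h2 h4 (hinv i j h1 h2 h3 h4 h5)) hk
  have hs : s ∈ L := by
    rw [eq_div_of_mul_eq h.row_ne_zero h.row_eq, div_eq_mul_inv]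
    exact mul_mem (skipMinor_mem hα1 fun i j h1 h2 h3 h4 => hy j i h3 h4 h1 h2)
      (hFinv _ _ (by omega) (by omega) hA)
  have ht : t ∈ L := by
    rw [eq_div_of_mul_eq h.col_ne_zero h.col_eq, div_eq_mul_inv]
    exact mul_mem (skipMinor_mem hβ1 hy) (hFinv _ _ (by omega) (by omega) hB)
  have hc : ∀ i j, 1 ≤ i → i ≤ n → 1 ≤ j → j ≤ n → colOp α t y i j ∈ L := fun i j h1 h2 h3 h4 => by
    unfold colOp
    split_ifs with hj
    · exact add_mem (hy i j h1 h2 h3 h4) (mul_mem ht (hy _ _ h1 h2 (by omega) (by omega)))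
    · rw [add_zero]; exact hy i j h1 h2 h3 h4
  intro i j h1 h2 h3 h4
  rw [h.eq]
  unfold rowOp
  split_ifs with hi
  · exact add_mem (hc i j h1 h2 h3 h4) (mul_mem hs (hc _ _ (by omega) (by omega) h3 h4))
  · rw [add_zero]; exact hc i j h1 h2 h3 h4

end Interior

/-! ### The initial seed and its neighbours -/

section Main

variable {n α β : ℕ} (hα : 1 ≤ α) (hαβ : α < β) (hβ : β < n)
include hα hαβ hβ

theorem exists_isGauge_genericMatrix : ∃ y s t,
    IsGauge n α β (entry (genericMatrix n)) y s t ∧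
      ∀ i j, 1 ≤ i → i ≤ n → 1 ≤ j → j ≤ n → stdMinor n y i j ≠ 0 := by
  have h0 : ∀ i j, 1 ≤ i → i ≤ n → 1 ≤ j → j ≤ n → phi (genericMatrix n) α β i j ≠ 0 :=
    fun i j h1 h2 h3 h4 => phi_genericMatrix_ne_zero hα (by omega) (by omega) (by omega) hβ h1 h2 h3 h4
  obtain ⟨y, s, t, h⟩ := exists_isGauge (X := genericMatrix n) (α := α) (β := β) (by omega) (by omega) hβ
    (h0 _ _ (by omega) (by omega) (by omega) (by omega))
    (h0 _ _ (by omega) (by omega) (by omega) (by omega))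
  refine ⟨y, s, t, h, fun i j h1 h2 h3 h4 => ?_⟩
  have := h0 i j h1 h2 h3 h4
  rw [h.phi_eq (by omega) (by omega) hβ h2 h4] at this
  exact right_ne_zero_of_mul this

omit hα hαβ hβ in
theorem genericMatrix_eq_entry (i j : Fin n) :
    genericMatrix n i j = entry (genericMatrix n) (i + 1) (j + 1) := by
  have hi := i.2
  have hj := j.2
  rw [entry, dif_pos (by omega)]
  rfl

/-- The determinant is one on `SL_n`, which is why the omitted vertex `(1, 1)` may be treated as
carrying the variable 1. -/
theorem phi_one_one : phi (genericMatrix n) α β 1 1 = 1 := by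
  rw [phi_of_ne (by omega) (by omega) (by omega) (by omega), stdMinor, ← det_genericMatrix n,
    show n + 1 - max 1 1 = n by omega]
  unfold cornerDet
  congr 1
  ext s t
  rw [Matrix.of_apply, genericMatrix_eq_entry s t]
  change entry _ (1 + s.1) (1 + t.1) = _
  rw [Nat.add_comm 1, Nat.add_comm 1]

theorem vertexVar_eq {p q : ℕ} (hp1 : 1 ≤ p) (hp : p ≤ n) (hq1 : 1 ≤ q) (hq : q ≤ n) :
    vertexVar n α β p q = phi (genericMatrix n) α β p q := by
  unfold vertexVar
  split_ifs with h
  · rfl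
  · rw [mem_vertex] at h
    obtain ⟨rfl, rfl⟩ : p = 1 ∧ q = 1 := by omega
    exact (phi_one_one hα hαβ hβ).symm

omit hα hαβ hβ in
theorem vertexVar_of_lt {p q : ℕ} (h : n < p ∨ n < q) : vertexVar n α β p q = 1 := by
  unfold vertexVar
  rw [if_neg]
  rw [mem_vertex]
  omega

/-- The functions of the initial cluster, continued by the added arrows, as multiples of standard
minors. -/
theorem IsGauge.vertexVar_mul {y : ℕ → ℕ → SLFunctionField n} {s t : SLFunctionField n}
    (h : IsGauge n α β (entry (genericMatrix n)) y s t) {p q : ℕ} (hp1 : 1 ≤ p) (hp : p ≤ n + 1)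
    (hq1 : 1 ≤ q) (hq : q ≤ n + 1) : vertexVar n α β p q
      * (if p = n + 1 ∧ q = α + 1 then vertexVar n α β 1 (β + 1) else 1)
      * (if p = β + 1 ∧ q = n + 1 then vertexVar n α β (α + 1) 1 else 1)
      = gaugeFactor n α β (phi (genericMatrix n) α β (α + 1) 1) (phi (genericMatrix n) α β 1 (β + 1)) p q
        * stdMinor n y p q := by
  rw [vertexVar_eq hα hαβ hβ (p := 1) (q := β + 1) (by omega) (by omega) (by omega) (by omega),
    vertexVar_eq hα hαβ hβ (p := α + 1) (q := 1) (by omega) (by omega) (by omega) (by omega)]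
  by_cases h1 : p ≤ n ∧ q ≤ n
  · rw [if_neg (by omega), if_neg (by omega), mul_one, mul_one,
      vertexVar_eq hα hαβ hβ hp1 h1.1 hq1 h1.2, h.phi_eq (by omega) (by omega) hβ h1.1 h1.2]
  · rw [vertexVar_of_lt (by omega), stdMinor_eq_one y (by omega), one_mul, mul_one, gaugeFactor]
    rw [if_congr (show p = n + 1 ∧ q = α + 1 ↔ p + α = n + q by omega) rfl rfl,
      if_congr (show p = β + 1 ∧ q = n + 1 ↔ q + β = n + p by omega) rfl rfl]

/-- Both exchange monomials run over the same three diagonals and so acquire the same product of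
factors. At the edge of the grid, the added arrows supply the factors of the missing neighbours. -/
theorem IsGauge.stdExchange_div {y : ℕ → ℕ → SLFunctionField n} {s t : SLFunctionField n}
    (h : IsGauge n α β (entry (genericMatrix n)) y s t) {i j : ℕ} (hi1 : 1 ≤ i) (hi : i < n)
    (hj1 : 1 ≤ j) (hj : j < n) (k : mutableVertices n α β) (hk : k.1.1 = (i + 1, j + 1)) :
    stdExchange n y i j / stdMinor n y (i + 1) (j + 1)
      = (initialSeed n α β).exchangeVar k
        * (gaugeFactor n α β (phi (genericMatrix n) α β (α + 1) 1)
            (phi (genericMatrix n) α β 1 (β + 1)) (i + 2) (j + 1)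
          * gaugeFactor n α β (phi (genericMatrix n) α β (α + 1) 1)
            (phi (genericMatrix n) α β 1 (β + 1)) (i + 1) (j + 2))⁻¹ := by
  obtain ⟨ha0, hb0⟩ := h.phi_ne_zero (by omega) (by omega) hβ
  rw [exchangeVar_interior hα hαβ hβ (i := i + 1) (j := j + 1) (by omega) (by omega) (by omega)
    (by omega) k hk, h.phi_eq (by omega) (by omega) hβ (by omega) (by omega)]
  simp only [Nat.add_sub_cancel, show i + 1 + 1 = i + 2 from rfl, show j + 1 + 1 = j + 2 from rfl]
  have e1 := h.vertexVar_mul hα hαβ hβ (p := i + 2) (q := j + 1) (by omega) (by omega) (by omega)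
    (by omega)
  have e2 := h.vertexVar_mul hα hαβ hβ (p := i + 1) (q := j + 2) (by omega) (by omega) (by omega)
    (by omega)
  have e3 := h.vertexVar_mul hα hαβ hβ (p := i) (q := j) (by omega) (by omega) (by omega) (by omega)
  have e4 := h.vertexVar_mul hα hαβ hβ (p := i) (q := j + 1) (by omega) (by omega) (by omega)
    (by omega)
  have e5 := h.vertexVar_mul hα hαβ hβ (p := i + 1) (q := j) (by omega) (by omega) (by omega)
    (by omega)
  have e6 := h.vertexVar_mul hα hαβ hβ (p := i + 2) (q := j + 2) (by omega) (by omega) (by omega)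
    (by omega)
  rw [if_neg (show ¬(i + 2 = β + 1 ∧ j + 1 = n + 1) by omega), mul_one] at e1
  rw [if_neg (show ¬(i + 1 = n + 1 ∧ j + 2 = α + 1) by omega), mul_one] at e2
  rw [if_neg (by omega), if_neg (by omega), mul_one, mul_one] at e3 e4 e5
  rw [if_congr (show i + 2 = n + 1 ∧ j + 1 = α + 1 ↔ i + 1 = n ∧ j + 1 = α + 1 by omega) rfl rfl]
    at e1
  rw [if_congr (show i + 1 = β + 1 ∧ j + 2 = n + 1 ↔ i + 1 = β + 1 ∧ j + 1 = n by omega) rfl rfl]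
    at e2
  rw [if_congr (show i + 2 = n + 1 ∧ j + 2 = α + 1 ↔ i + 1 = n ∧ j + 1 = α by omega) rfl rfl,
    if_congr (show i + 2 = β + 1 ∧ j + 2 = n + 1 ↔ i + 1 = β ∧ j + 1 = n by omega) rfl rfl] at e6
  rw [gaugeFactor_congr (i := i) (j := j) (i' := i + 1) (j' := j + 1) (by omega)] at e3
  rw [gaugeFactor_congr (i := i) (j := j + 1) (i' := i + 1) (j' := j + 2) (by omega)] at e4
  rw [gaugeFactor_congr (i := i + 1) (j := j) (i' := i + 2) (j' := j + 1) (by omega)] at e5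
  rw [gaugeFactor_congr (i := i + 2) (j := j + 2) (i' := i + 1) (j' := j + 1) (by omega)] at e6
  have g1 := gaugeFactor_ne_zero (n := n) (α := α) (β := β) ha0 hb0 (i + 2) (j + 1)
  have g2 := gaugeFactor_ne_zero (n := n) (α := α) (β := β) ha0 hb0 (i + 1) (j + 2)
  have g3 := gaugeFactor_ne_zero (n := n) (α := α) (β := β) ha0 hb0 (i + 1) (j + 1)
  have E1 := congrArg₂ HMul.hMul (congrArg₂ HMul.hMul e1 e2) e3
  have E2 := congrArg₂ HMul.hMul (congrArg₂ HMul.hMul e4 e5) e6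
  unfold stdExchange
  rw [div_mul_eq_mul_div, ← div_eq_mul_inv, div_div,
    ← mul_div_mul_left _ _ (mul_ne_zero (mul_ne_zero g1 g2) g3)]
  congr 1
  · linear_combination -E1 - E2
  · ring

theorem phi_mem_of_var_mem {L : Subring (SLFunctionField n)}
    (h : ∀ v, (initialSeed n α β).var v ∈ L) (i j : ℕ) (hi1 : 1 ≤ i) (hi : i ≤ n) (hj1 : 1 ≤ j)
    (hj : j ≤ n) : phi (genericMatrix n) α β i j ∈ L := by
  by_cases h1 : i = 1 ∧ j = 1
  · rw [h1.1, h1.2, phi_one_one hα hαβ hβ]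
    exact one_mem L
  · exact h ⟨(i, j), mem_vertex.2 ⟨hi1, hi, hj1, hj, h1⟩⟩

theorem entry_mem_laurentSubring (i j : ℕ) (hi1 : 1 ≤ i) (hi : i ≤ n) (hj1 : 1 ≤ j) (hj : j ≤ n) :
    entry (genericMatrix n) i j ∈ (initialSeed n α β).laurentSubring := by
  obtain ⟨y, s, t, h, h0⟩ := exists_isGauge_genericMatrix hα hαβ hβ
  have hinv : ∀ i j (hv : 1 ≤ i ∧ i ≤ n ∧ 1 ≤ j ∧ j ≤ n ∧ ¬(i = 1 ∧ j = 1)),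
      (⟨(i, j), mem_vertex.2 hv⟩ : Vertex n) ∈ mutableVertices n α β →
      (phi (genericMatrix n) α β i j)⁻¹ ∈ (initialSeed n α β).laurentSubring :=
    fun i j hv hm => (initialSeed n α β).inv_mem_laurentSubring ⟨_, hm⟩
  exact h.entry_mem (L := (initialSeed n α β).laurentSubring) hα (by omega) (by omega)
    (by omega) hβ h0
    (phi_mem_of_var_mem hα hαβ hβ fun v => (initialSeed n α β).var_mem_laurentSubring v)
    -- The pair `(0, 0)` lies outside the grid, so that no inverse is missing.
    (hinv _ _ (by omega) (Or.inr (Or.inl rfl))) (hinv _ _ (by omega) (Or.inr (Or.inr rfl))) (0, 0)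
    (fun i j h1 h2 h3 h4 _ => hinv i j (by omega) (Or.inl ⟨h1, h3⟩))
    (fun i j _ _ _ _ h5 => by simp at h5) i j hi1 hi hj1 hj

omit hα hαβ hβ in
theorem eq_top_of_genericMatrix_mem (E : IntermediateField ℂ (SLFunctionField n))
    (h : ∀ i j, genericMatrix n i j ∈ E) : E = ⊤ := by
  have h1 : ∀ p : MvPolynomial (Fin n × Fin n) ℂ,
      algebraMap (SLCoordRing n) (SLFunctionField n) (Ideal.Quotient.mk _ p) ∈ E := fun p => by
    induction p using MvPolynomial.induction_on with
    | C a => exact E.algebraMap_mem a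
    | add p q hp hq => rw [map_add, map_add]; exact add_mem hp hq
    | mul_X p v hp => rw [map_mul, map_mul]; exact mul_mem hp (h v.1 v.2)
  rw [eq_top_iff]
  intro z _
  obtain ⟨a, b, _, rfl⟩ := IsFractionRing.div_surjective (A := SLCoordRing n) z
  obtain ⟨p, rfl⟩ := Ideal.Quotient.mk_surjective a
  obtain ⟨q, rfl⟩ := Ideal.Quotient.mk_surjective b
  exact div_mem (h1 p) (h1 q)

/-- The field is generated because the matrix entries have already been found to be Laurent in the
initial cluster. -/
theorem isFull_initialSeed : (initialSeed n α β).IsFull ℂ where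
  adjoin_eq_top := by
    refine eq_top_of_genericMatrix_mem _ fun i j => ?_
    have h := entry_mem_laurentSubring hα hαβ hβ (i + 1) (j + 1) (by omega) i.2 (by omega) j.2
    rw [← genericMatrix_eq_entry] at h
    exact Seed.mem_adjoin_of_mem_laurentSubring ℂ _ h
  skew := fun i j => by
    rw [mat_initialSeed, mat_initialSeed, neg_sub]
  rows := linearIndependent_mat hα hαβ hβ

theorem entry_mem_laurentSubring_mutate (k : mutableVertices n α β) (i j : ℕ) (hi1 : 1 ≤ i) (hi : i ≤ n)
    (hj1 : 1 ≤ j) (hj : j ≤ n) :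
    entry (genericMatrix n) i j ∈ ((initialSeed n α β).mutate k).laurentSubring := by
  obtain ⟨y, s, t, h, h0⟩ := exists_isGauge_genericMatrix hα hαβ hβ
  let L := ((initialSeed n α β).mutate k).laurentSubring
  have hV := card_vertex_le_trdeg (n := n) (by omega)
  have hm := phi_mem_of_var_mem hα hαβ hβ (L := L)
    ((isFull_initialSeed hα hαβ hβ).var_mem_laurentSubring_mutate hV k)
  have hinv : ∀ i j (hv : 1 ≤ i ∧ i ≤ n ∧ 1 ≤ j ∧ j ≤ n ∧ ¬(i = 1 ∧ j = 1)),
      (⟨(i, j), mem_vertex.2 hv⟩ : Vertex n) ∈ mutableVertices n α β → (i, j) ≠ k.1.1 →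
      (phi (genericMatrix n) α β i j)⁻¹ ∈ L := fun i j hv hm hne => by
    have h1 := ((initialSeed n α β).mutate k).inv_mem_laurentSubring ⟨_, hm⟩
    rw [Seed.mutate_var_of_ne _ _ fun h2 => hne (congrArg Subtype.val h2)] at h1
    exact h1
  have hvar : (initialSeed n α β).exchangeVar k ∈ L :=
    (initialSeed n α β).exchangeVar_mem_laurentSubring_mutate k
  have hkm : k.1 ∈ mutableVertices n α β := k.2
  simp only [mutableVertices, Set.mem_ofPred_eq] at hkm
  rcases hkm with hk | hk | hk
  · have hA := hinv (α + 1) 1 (by omega) (Or.inr (Or.inl rfl)) (fun h1 => by rw [← h1] at hk; simp at hk)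
    have hB := hinv 1 (β + 1) (by omega) (Or.inr (Or.inr rfl)) (fun h1 => by rw [← h1] at hk; simp at hk)
    refine h.entry_mem (L := L) hα (by omega) (by omega) (by omega) hβ h0 hm hA hB k.1.1
      (fun i j h1 h2 h3 h4 h5 => hinv i j (by omega) (Or.inl ⟨h1, h3⟩) h5)
      (fun i j h1 h2 h3 h4 h5 => ?_) i j hi1 hi hj1 hj
    rw [h.stdExchange_div hα hαβ hβ h1 h2 h3 h4 k h5.symm, mul_inv, gaugeFactor_inv, gaugeFactor_inv]
    exact mul_mem hvar (mul_mem (gaugeFactor_mem hA hB _ _) (gaugeFactor_mem hA hB _ _))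
  -- Transposition exchanges `α` and `β` and reduces this vertex of the first column to the one in
  -- the first row.
  · rw [exchangeVar_col hα hαβ hβ k hk] at hvar
    have hT : ∀ i j, i ≤ n → j ≤ n →
        phi (genericMatrix n).transpose β α j i = phi (genericMatrix n) α β i j :=
      fun i j hi hj => phi_transpose _ (by omega) hβ hi hj
    have hg := h.transpose
    rw [← entry_transpose] at hg
    have := entry_mem_of_mutate (L := L) hg (by omega) hβ (by omega) hα (by omega)
      (fun i j h1 h2 h3 h4 => by rw [stdMinor_tr]; exact h0 j i h3 h4 h1 h2)
      (fun i j h1 h2 h3 h4 => by rw [hT _ _ h4 h2]; exact hm j i h3 h4 h1 h2)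
      (fun i j h1 h2 h3 h4 => by
        rw [hT _ _ h4 h2]
        exact hinv j i (by omega) (Or.inl ⟨h3, h1⟩) (by rw [hk]; simp; omega))
      (by
        rw [hT _ _ (by omega) (by omega)]
        exact hinv _ _ (by omega) (Or.inr (Or.inr rfl)) (by rw [hk]; simp; omega))
      (by
        have hW : (if α + 2 ≤ n then phi (genericMatrix n).transpose β α 2 (α + 2) else 1)
            = vertexVar n α β (α + 2) 2 := by
          split_ifs with h1
          · rw [hT _ _ (by omega) (by omega),
              vertexVar_eq hα hαβ hβ (by omega) (by omega) (by omega) (by omega)]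
          · rw [vertexVar_of_lt (by omega)]
        rw [hW, hT _ _ (by omega) (by omega), hT _ _ (by omega) (by omega),
          hT _ _ (by omega) (by omega), hT _ _ (by omega) (by omega), hT _ _ (by omega) (by omega)]
        rwa [vertexVar_eq hα hαβ hβ (by omega) (by omega) (by omega) (by omega),
          vertexVar_eq hα hαβ hβ (by omega) (by omega) (by omega) (by omega),
          vertexVar_eq hα hαβ hβ (p := α) (by omega) (by omega) (by omega) (by omega),
          vertexVar_eq hα hαβ hβ (p := β + 1) (by omega) (by omega) (by omega) (by omega)] at hvar)
      j i hj1 hj hi1 hi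
    rwa [entry_transpose] at this
  · rw [exchangeVar_row hα hαβ hβ k hk] at hvar
    exact entry_mem_of_mutate (L := L) h hα (by omega) (by omega) (by omega) hβ h0 hm
      (fun i j h1 h2 h3 h4 => hinv i j (by omega) (Or.inl ⟨h1, h3⟩) (by rw [hk]; simp; omega))
      (hinv _ _ (by omega) (Or.inr (Or.inl rfl)) (by rw [hk]; simp; omega))
      (by
        convert hvar using 2
        rw [vertexVar_eq hα hαβ hβ (by omega) (by omega) (by omega) (by omega),
          vertexVar_eq hα hαβ hβ (by omega) (by omega) (by omega) (by omega),
          vertexVar_eq hα hαβ hβ (p := 1) (by omega) (by omega) (by omega) (by omega),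
          vertexVar_eq hα hαβ hβ (p := n) (q := α + 1) (by omega) (by omega) (by omega) (by omega)]
        split_ifs with h1
        · rw [vertexVar_eq hα hαβ hβ (by omega) (by omega) (by omega) (by omega)]
        · rw [vertexVar_of_lt (by omega)])
      i j hi1 hi hj1 hj

end Main
end ExoticSL

theorem mainTheorem2 (n α β : ℕ) (hα : 1 ≤ α) (hαβ : α < β) (hβ : β < n)
    (i j : Fin n) :
    ExoticSL.genericMatrix n i j ∈ (ExoticSL.initialSeed n α β).upperClusterAlgebra ℤ ∧
      ExoticSL.genericMatrix n i j ∈ (ExoticSL.initialSeed n α β).upperClusterAlgebra ℂ := by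
  rw [ExoticSL.genericMatrix_eq_entry]
  exact (ExoticSL.isFull_initialSeed hα hαβ hβ).mem_upperClusterAlgebra_of_mem_laurentSubring
    (ExoticSL.card_vertex_le_trdeg (by omega))
    (ExoticSL.entry_mem_laurentSubring hα hαβ hβ _ _ (by omega) i.2 (by omega) j.2)
    fun k => ExoticSL.entry_mem_laurentSubring_mutate hα hαβ hβ k _ _ (by omega) i.2 (by omega) j.2
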